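/- Consider online busy time scheduling of unit-length jobs on heterogeneous machines. There are machine types $0,\dots,K-1$ with $K\ge 1$, and unlimitedly many machines of each type. A machine of type $k$ can execute at most $B_k$ jobs at once ($B_k\ge 1$ an integer) and costs $c_k\ge 1$ (a real number) for each time step in which it executes at least one job. As usual, types with equal capacity and dominated types are removed, so that $B_0<B_1<\dots<B_{K-1}$ and $c_0<c_1<\dots<c_{K-1}$. There are $n$ unit-length jobs. Job $j$ has an integral release time $r_j\ge 0$ and an integral deadline $d_j\ge r_j$; both become known at time $r_j$. A valid schedule partitions the jobs into batches. Each batch $X$ has a machine type $t(X)$, an execution time $\tau(X)$ and a nonempty set $J(X)$ of at most $B_{t(X)}$ jobs, with $r_j\le\tau(X)\le d_j$ for all $j\in J(X)$. The cost of the schedule is $\sum_X c_{t(X)}$. Let $\mathrm{OPT}$ be the minimum cost of a valid schedule, computed with full knowledge of the instance. An online algorithm knows the machine types from the start, learns of a job at its release time, and executes batches irrevocably as time proceeds: what it executes at time $\tau$ depends only on the machine types and on the jobs released up to time $\tau$. Theorem. There is a deterministic online algorithm that on every instance (every choice of machine types, release times and deadlines, with no agreeability assumption) produces a valid schedule of cost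 at most $8\cdot\mathrm{OPT}$. It can be implemented on a random access machine, with unit cost for each elementary operation, so that its total running time is $O(n\log n)$. The constant in the bound is absolute; in particular it does not depend on the machine types, on their number $K$, or on the time horizon. -/

import Mathlib

/-! Busy time scheduling of unit-length jobs on heterogeneous machines. -/

/-- The available machine types `0, …, K - 1`, with unlimited supply of each type.
They are labelled by increasing capacity, and dominated types have been removed, so that a
larger capacity costs strictly more. -/
structure MachineTypes where
  K : ℕ
  K_pos : 0 < K
  cap : Fin K → ℕ
  cost : Fin K → ℝ
  one_le_cap : ∀ k, 1 ≤ cap k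
  one_le_cost : ∀ k, 1 ≤ cost k
  cap_strictMono : StrictMono cap
  cost_strictMono : StrictMono cost

/-- Capacity of type `k`, and `0` if there is no such type. -/
def MachineTypes.capAt (M : MachineTypes) (k : ℕ) : ℕ :=
  if h : k < M.K then M.cap ⟨k, h⟩ else 0

/-- Cost of type `k`, and `0` if there is no such type. -/
noncomputable def MachineTypes.costAt (M : MachineTypes) (k : ℕ) : ℝ :=
  if h : k < M.K then M.cost ⟨k, h⟩ else 0

/-- A problem instance: machine types and `n` unit-length jobs with integral release times and
deadlines. The jobs are numbered in their order of arrival. -/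
structure Problem where
  types : MachineTypes
  n : ℕ
  release : Fin n → ℕ
  deadline : Fin n → ℕ
  release_mono : Monotone release
  release_le_deadline : ∀ j, release j ≤ deadline j

/-- A batch: the time at which it is executed, its machine type, and its jobs. -/
structure Batch where
  time : ℕ
  kind : ℕ
  jobs : List ℕ

/-- A valid schedule: the jobs are partitioned into (nonempty) batches, no batch exceeds the
capacity of its machine type, and every job is executed between its release time and its
deadline. -/
structure Problem.IsSchedule (I : Problem) (S : List Batch) : Prop where
  partition : (S.flatMap Batch.jobs).Perm (List.range I.n)
  nonempty : ∀ X ∈ S, X.jobs ≠ []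
  kind_lt : ∀ X ∈ S, X.kind < I.types.K
  capacity : ∀ X ∈ S, X.jobs.length ≤ I.types.capAt X.kind
  window : ∀ X ∈ S, ∀ j : Fin I.n, (j : ℕ) ∈ X.jobs →
    I.release j ≤ X.time ∧ X.time ≤ I.deadline j

/-- The cost of a schedule: every batch pays the cost of its machine type. -/
noncomputable def Problem.cost (I : Problem) (S : List Batch) : ℝ :=
  (S.map fun X => I.types.costAt X.kind).sum

/-- The cost of an optimal offline schedule. -/
noncomputable def Problem.opt (I : Problem) : ℝ :=
  sInf {x | ∃ S, I.IsSchedule S ∧ x = I.cost S}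

/-! Online algorithms: programs for a random access machine. The memory consists of arrays of
natural numbers and arrays of real numbers, all of them zero at the start; a program names
finitely many of them. The arithmetic is addition, subtraction, comparison, and halving of
natural numbers. A read-only part of the machine shows what is known at the current time. -/

/-- What is known at time `now`: the machine types and the jobs that have arrived, which are
the jobs with numbers below `arrived`. -/
structure View where
  now : ℕ
  arrived : ℕ
  release : ℕ → ℕ
  deadline : ℕ → ℕ
  numTypes : ℕ
  cap : ℕ → ℕ
  cost : ℕ → ℝ

/-- The view at time `τ`. Nothing about jobs with release time after `τ` enters it. -/
noncomputable def Problem.view (I : Problem) (τ : ℕ) : View where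
  now := τ
  arrived := (Finset.univ.filter fun j => I.release j ≤ τ).card
  release j := if h : j < I.n then
    (if I.release ⟨j, h⟩ ≤ τ then I.release ⟨j, h⟩ else 0) else 0
  deadline j := if h : j < I.n then
    (if I.release ⟨j, h⟩ ≤ τ then I.deadline ⟨j, h⟩ else 0) else 0
  numTypes := I.types.K
  cap := I.types.capAt
  cost := I.types.costAt

/-- The state of the machine: the two memories, the time at which the program asks to be woken
up next (if that is in the future), and the batches executed so far. -/
structure State where
  nat : ℕ → ℕ → ℕ
  real : ℕ → ℕ → ℝ
  alarm : ℕ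
  out : List Batch

/-- The initial state. -/
noncomputable def State.start : State where
  nat _ _ := 0
  real _ _ := 0
  alarm := 0
  out := []

/-- Write `x` to cell `i` of array `a` of natural numbers. -/
def State.setNat (s : State) (a i x : ℕ) : State :=
  { s with nat := fun b j => if b = a ∧ j = i then x else s.nat b j }

/-- Write `x` to cell `i` of array `a` of real numbers. -/
noncomputable def State.setReal (s : State) (a i : ℕ) (x : ℝ) : State :=
  { s with real := fun b j => if b = a ∧ j = i then x else s.real b j }

/-- Expressions for natural numbers. -/
inductive NExp where
  | const (c : ℕ)
  | load (a : ℕ) (i : NExp)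
  | now
  | arrived
  | release (j : NExp)
  | deadline (j : NExp)
  | numTypes
  | cap (k : NExp)
  | add (x y : NExp)
  | sub (x y : NExp)
  | half (x : NExp)

/-- Expressions for real numbers. -/
inductive RExp where
  | const (c : ℕ)
  | load (a : ℕ) (i : NExp)
  | cost (k : NExp)
  | add (x y : RExp)
  | sub (x y : RExp)

/-- Tests. -/
inductive BExp where
  | nle (x y : NExp)
  | rle (x y : RExp)
  | not (b : BExp)
  | and (b c : BExp)

def NExp.eval (v : View) (s : State) : NExp → ℕ
  | .const c => c
  | .load a i => s.nat a (i.eval v s)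
  | .now => v.now
  | .arrived => v.arrived
  | .release j => v.release (j.eval v s)
  | .deadline j => v.deadline (j.eval v s)
  | .numTypes => v.numTypes
  | .cap k => v.cap (k.eval v s)
  | .add x y => x.eval v s + y.eval v s
  | .sub x y => x.eval v s - y.eval v s
  | .half x => x.eval v s / 2

noncomputable def RExp.eval (v : View) (s : State) : RExp → ℝ
  | .const c => c
  | .load a i => s.real a (i.eval v s)
  | .cost k => v.cost (k.eval v s)
  | .add x y => x.eval v s + y.eval v s
  | .sub x y => x.eval v s - y.eval v s

def BExp.eval (v : View) (s : State) : BExp → Prop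
  | .nle x y => x.eval v s ≤ y.eval v s
  | .rle x y => x.eval v s ≤ y.eval v s
  | .not b => ¬ b.eval v s
  | .and b c => b.eval v s ∧ c.eval v s

/-- Programs. `launch k a m` executes, at the current time and on a new machine of type `k`,
a batch of the `m` jobs whose numbers are in cells `0, …, m - 1` of array `a`. -/
inductive Cmd where
  | skip
  | nstore (a : ℕ) (i e : NExp)
  | rstore (a : ℕ) (i : NExp) (e : RExp)
  | setAlarm (e : NExp)
  | launch (k : NExp) (a : ℕ) (m : NExp)
  | seq (p q : Cmd)
  | ite (b : BExp) (p q : Cmd)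
  | loop (b : BExp) (p : Cmd)

/-- `Exec v p s s' t`: started in state `s`, with `v` in view, the program `p` halts in state
`s'` after `t` steps. A command or a test takes one step (its expressions have a fixed size),
and launching a batch takes one more step for every job of the batch. -/
inductive Exec (v : View) : Cmd → State → State → ℕ → Prop where
  | skip (s : State) : Exec v .skip s s 1
  | nstore (a : ℕ) (i e : NExp) (s : State) : Exec v (.nstore a i e) s
      (s.setNat a (i.eval v s) (e.eval v s)) 1
  | rstore (a : ℕ) (i : NExp) (e : RExp) (s : State) : Exec v (.rstore a i e) s
      (s.setReal a (i.eval v s) (e.eval v s)) 1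
  | setAlarm (e : NExp) (s : State) : Exec v (.setAlarm e) s { s with alarm := e.eval v s } 1
  | launch (k : NExp) (a : ℕ) (m : NExp) (s : State) : Exec v (.launch k a m) s
      { s with out := ⟨v.now, k.eval v s, (List.range (m.eval v s)).map (s.nat a)⟩ :: s.out }
      (1 + m.eval v s)
  | seq {p q : Cmd} {s s' s'' : State} {t t' : ℕ} :
      Exec v p s s' t → Exec v q s' s'' t' → Exec v (.seq p q) s s'' (t + t')
  | iteTrue {b : BExp} {p : Cmd} (q : Cmd) {s s' : State} {t : ℕ} :
      b.eval v s → Exec v p s s' t → Exec v (.ite b p q) s s' (1 + t)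
  | iteFalse {b : BExp} (p : Cmd) {q : Cmd} {s s' : State} {t : ℕ} :
      ¬ b.eval v s → Exec v q s s' t → Exec v (.ite b p q) s s' (1 + t)
  | loopTrue {b : BExp} {p : Cmd} {s s' s'' : State} {t t' : ℕ} :
      b.eval v s → Exec v p s s' t → Exec v (.loop b p) s' s'' t' →
      Exec v (.loop b p) s s'' (1 + t + t')
  | loopFalse {b : BExp} (p : Cmd) {s : State} :
      ¬ b.eval v s → Exec v (.loop b p) s s 1

/-- The machine is active at time `τ` if some job arrives then or the alarm is set to `τ`. -/
def Problem.IsEvent (I : Problem) (s : State) (τ : ℕ) : Prop :=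
  (∃ j, I.release j = τ) ∨ s.alarm = τ

/-- `Run A I τ₀ s s' t`: from state `s` on, and with events from time `τ₀` on, the online
algorithm `A` ends in state `s'` after `t` steps. At every event, in the order of time, the
program `A` runs once, on the memory left by its previous run and with the view of that time;
it may execute batches at that time and set the alarm. The run ends when no event is left. -/
inductive Run (A : Cmd) (I : Problem) : ℕ → State → State → ℕ → Prop where
  | done {τ₀ : ℕ} {s : State} :
      (∀ τ, τ₀ ≤ τ → ¬ I.IsEvent s τ) → Run A I τ₀ s s 0
  | event {τ₀ τ : ℕ} {s s' s'' : State} {t t' : ℕ} :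
      τ₀ ≤ τ → I.IsEvent s τ → (∀ σ, τ₀ ≤ σ → σ < τ → ¬ I.IsEvent s σ) →
      Exec (I.view τ) A s s' t → Run A I (τ + 1) s' s'' t' →
      Run A I τ₀ s s'' (1 + t + t')

/-- On the instance `I` the online algorithm `A` halts, and it produces the batches `S` in a
total of `t` steps. -/
def Produces (A : Cmd) (I : Problem) (S : List Batch) (t : ℕ) : Prop :=
  ∃ s, Run A I 0 State.start s t ∧ s.out = S

/-- Programs are deterministic. -/
theorem Exec.unique {v : View} {p : Cmd} {s s₁ s₂ : State} {t₁ t₂ : ℕ}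
    (h₁ : Exec v p s s₁ t₁) (h₂ : Exec v p s s₂ t₂) : s₁ = s₂ ∧ t₁ = t₂ := by
  induction h₁ generalizing s₂ t₂ with
  | skip | nstore | rstore | setAlarm | launch => cases h₂; exact ⟨rfl, rfl⟩
  | seq _ _ ih ih' =>
    cases h₂ with
    | seq h h' =>
      obtain ⟨rfl, rfl⟩ := ih h
      obtain ⟨rfl, rfl⟩ := ih' h'
      exact ⟨rfl, rfl⟩
  | iteTrue _ hb _ ih =>
    cases h₂ with
    | iteTrue _ _ h => obtain ⟨rfl, rfl⟩ := ih h; exact ⟨rfl, rfl⟩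
    | iteFalse _ hn _ => exact absurd hb hn
  | iteFalse _ hb _ ih =>
    cases h₂ with
    | iteTrue _ hp _ => exact absurd hp hb
    | iteFalse _ _ h => obtain ⟨rfl, rfl⟩ := ih h; exact ⟨rfl, rfl⟩
  | loopTrue hb _ _ ih ih' =>
    cases h₂ with
    | loopTrue _ h h' =>
      obtain ⟨rfl, rfl⟩ := ih h
      obtain ⟨rfl, rfl⟩ := ih' h'
      exact ⟨rfl, rfl⟩
    | loopFalse _ hn => exact absurd hb hn
  | loopFalse _ hb =>
    cases h₂ with
    | loopTrue hp _ _ => exact absurd hp hb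
    | loopFalse => exact ⟨rfl, rfl⟩

/-- Online algorithms are deterministic. -/
theorem Run.unique {A : Cmd} {I : Problem} {τ₀ : ℕ} {s s₁ s₂ : State} {t₁ t₂ : ℕ}
    (h₁ : Run A I τ₀ s s₁ t₁) (h₂ : Run A I τ₀ s s₂ t₂) : s₁ = s₂ ∧ t₁ = t₂ := by
  induction h₁ generalizing s₂ t₂ with
  | done h =>
    cases h₂ with
    | done => exact ⟨rfl, rfl⟩
    | event hle he => exact absurd he (h _ hle)
  | @event _ τ _ _ _ _ _ hle he hmin hx _ ih =>
    cases h₂ with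
    | done h => exact absurd he (h _ hle)
    | @event _ τ' _ _ _ _ _ hle' he' hmin' hx' hr' =>
      have hτ : τ = τ' := by
        rcases lt_trichotomy τ τ' with h | h | h
        · exact absurd he (hmin' _ hle h)
        · exact h
        · exact absurd he' (hmin _ hle' h)
      subst hτ
      obtain ⟨rfl, rfl⟩ := hx.unique hx'
      obtain ⟨rfl, rfl⟩ := ih hr'
      exact ⟨rfl, rfl⟩

/-! Nothing is executed until some pending job `j` is due. Every launch has a rank, and rank `r` has
a budget. `budget 0` is the cost of the cheapest type. `kindOf r` is the type of least cost per unit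
of capacity among those costing at most `budget r`, and `budget (r + 1)` exceeds `budget r` by its
cost. A launch takes jobs by earliest deadline. It uses the smallest type that could hold all jobs
arrived so far if `budget r` pays for it, and `kindOf r` otherwise.

The job numbers below the number of arrivals at the latest launch are cut into intervals, the
cohorts, one for each launch still remembered; ranks strictly decrease towards the youngest. If `j`
arrived after the latest launch, a launch of rank `0` is made for the jobs since then. Otherwise `j`
was left behind by the launch of its cohort, of rank `r` say. That launch was therefore a full batch
of type `kindOf r` whose jobs are all due no later than `j`: it becomes a witness. A launch of rank
`r + 1` for all jobs from the start of that cohort on replaces this cohort and the younger ones; the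
next older cohort is absorbed too if its rank is also `r + 1`.

Upper bound: unused budget is kept as credit. A witness of rank `r` releases `budget r - c`, where
`c` is the cost of `kindOf r`; together with `2 * c` this pays `budget (r + 1)`. So the total cost
is at most twice the cost of the witnesses plus the cheapest cost for every launch of rank `0`
(`Invariant.cost_le`).

Lower bound: jobs triggering rank `0` have pairwise disjoint windows, so they force that many
batches (`length_mul_le`). The witnesses cost at most three times any schedule
(`WitnessesOK.sum_cost_le`): each distributes its cost evenly over its jobs, and a batch `X` of the
schedule is charged for the jobs it contains. Witnesses whose budget covers the cost of `X` are no
less efficient than `X` and charge at most its cost in total. Among the others, `X` meets at most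
one of each rank, because two witnesses of equal rank have disjoint windows, and the costs over
these ranks telescope to at most twice the cost of `X`. This gives the factor `2 * 3 + 1 = 7`, which
is more than enough.

Running time: a tournament tree over job numbers answers "earliest deadline from `st` on" in
logarithmic time. Only types with capacity below the number of arrived jobs are scanned, hence at
most `n`, and the stack of cohorts and the pointer to the dearest affordable type are amortized. -/

/-! ### Machine types: efficiency, ranks and budgets. -/

namespace MachineTypes

variable (M : MachineTypes)

theorem capAt_of_lt {k : ℕ} (h : k < M.K) : M.capAt k = M.cap ⟨k, h⟩ := by simp [capAt, h]

theorem costAt_of_lt {k : ℕ} (h : k < M.K) : M.costAt k = M.cost ⟨k, h⟩ := by simp [costAt, h]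

theorem one_le_capAt {k : ℕ} (h : k < M.K) : 1 ≤ M.capAt k := by
  rw [M.capAt_of_lt h]; exact M.one_le_cap _

theorem one_le_costAt {k : ℕ} (h : k < M.K) : 1 ≤ M.costAt k := by
  rw [M.costAt_of_lt h]; exact M.one_le_cost _

theorem costAt_nonneg (k : ℕ) : 0 ≤ M.costAt k := by
  by_cases h : k < M.K
  · linarith [M.one_le_costAt h]
  · simp [costAt, h]

theorem capAt_lt {j k : ℕ} (hjk : j < k) (h : k < M.K) : M.capAt j < M.capAt k := by
  rw [M.capAt_of_lt h, M.capAt_of_lt (hjk.trans h)]; exact M.cap_strictMono hjk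

theorem costAt_lt {j k : ℕ} (hjk : j < k) (h : k < M.K) : M.costAt j < M.costAt k := by
  rw [M.costAt_of_lt h, M.costAt_of_lt (hjk.trans h)]; exact M.cost_strictMono hjk

theorem costAt_le {j k : ℕ} (hjk : j ≤ k) (h : k < M.K) : M.costAt j ≤ M.costAt k := by
  rcases hjk.eq_or_lt with rfl | hjk
  · exact le_rfl
  · exact (M.costAt_lt hjk h).le

/-- Capacities are strictly increasing positive integers. This bounds the number of types of
capacity below `a` by `a`, which makes the running time independent of `K`. -/
theorem lt_capAt {k : ℕ} (h : k < M.K) : k < M.capAt k := by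
  induction k with
  | zero => exact M.one_le_capAt h
  | succ k ih =>
    have := ih (by omega)
    have := M.capAt_lt (show k < k + 1 by omega) h
    omega

/-- `b` is the first type that minimizes the cost per unit of capacity among the types up
to `k`. -/
def IsBestUpTo (k b : ℕ) : Prop :=
  b ≤ k ∧ (∀ j < b, (M.capAt j : ℝ) * M.costAt b < M.capAt b * M.costAt j) ∧
    ∀ j ≤ k, (M.capAt j : ℝ) * M.costAt b ≤ M.capAt b * M.costAt j

theorem isBestUpTo_zero : M.IsBestUpTo 0 0 :=
  ⟨le_rfl, by simp, by simp⟩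

/-- Transitivity of the comparison of cost per capacity. The ratios are cross-multiplied, the form
in which the program compares them, so the common factor `capAt b` has to be cancelled. -/
theorem IsBestUpTo.succ_of_lt {M : MachineTypes} {k b : ℕ} (h : M.IsBestUpTo k b)
    (hk : k + 1 < M.K)
    (hlt : (M.capAt b : ℝ) * M.costAt (k + 1) < M.capAt (k + 1) * M.costAt b) :
    M.IsBestUpTo (k + 1) (k + 1) := by
  have hb : (0 : ℝ) < M.capAt b := by exact_mod_cast M.one_le_capAt (h.1.trans_lt (by omega))
  have key : ∀ j ≤ k, (M.capAt j : ℝ) * M.costAt (k + 1) < M.capAt (k + 1) * M.costAt j := by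
    intro j hj
    have h1 := h.2.2 j hj
    have hj0 : (0 : ℝ) < M.capAt j := by exact_mod_cast M.one_le_capAt (hj.trans_lt (by omega))
    have h2 := mul_lt_mul_of_pos_left hlt hj0
    have h3 : (M.capAt (k + 1) : ℝ) * (M.capAt j * M.costAt b) ≤
        M.capAt (k + 1) * (M.capAt b * M.costAt j) :=
      mul_le_mul_of_nonneg_left h1 (Nat.cast_nonneg _)
    refine lt_of_mul_lt_mul_left (a := (M.capAt b : ℝ)) ?_ hb.le
    nlinarith
  refine ⟨le_rfl, fun j hj => key j (by omega), fun j hj => ?_⟩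
  rcases Nat.lt_or_ge k j with h' | h'
  · obtain rfl : j = k + 1 := by omega
    exact le_rfl
  · exact (key j h').le

theorem IsBestUpTo.succ_of_le {M : MachineTypes} {k b : ℕ} (h : M.IsBestUpTo k b)
    (hle : (M.capAt (k + 1) : ℝ) * M.costAt b ≤ M.capAt b * M.costAt (k + 1)) :
    M.IsBestUpTo (k + 1) b := by
  refine ⟨h.1.trans (by omega), h.2.1, fun j hj => ?_⟩
  rcases Nat.lt_or_ge k j with h' | h'
  · obtain rfl : j = k + 1 := by omega
    exact hle
  · exact h.2.2 j h'

theorem exists_isBestUpTo {k : ℕ} (hk : k < M.K) : ∃ b, M.IsBestUpTo k b := by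
  induction k with
  | zero => exact ⟨0, M.isBestUpTo_zero⟩
  | succ k ih =>
    obtain ⟨b, hb⟩ := ih (by omega)
    rcases lt_or_ge ((M.capAt b : ℝ) * M.costAt (k + 1)) (M.capAt (k + 1) * M.costAt b) with h | h
    · exact ⟨_, hb.succ_of_lt hk h⟩
    · exact ⟨_, hb.succ_of_le h⟩

theorem IsBestUpTo.unique {M : MachineTypes} {k b b' : ℕ} (h : M.IsBestUpTo k b)
    (h' : M.IsBestUpTo k b') : b = b' := by
  rcases lt_trichotomy b b' with hlt | heq | hlt
  · have := h'.2.1 b hlt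
    have := h.2.2 b' h'.1
    linarith
  · exact heq
  · have := h.2.1 b' hlt
    have := h'.2.2 b h.1
    linarith

/-- `b` is the first type of minimum density among the types of cost at most `x`. -/
def IsEff (x : ℝ) (b : ℕ) : Prop :=
  ∃ k < M.K, M.costAt k ≤ x ∧ (∀ j < M.K, M.costAt j ≤ x → j ≤ k) ∧ M.IsBestUpTo k b

theorem IsEff.unique {M : MachineTypes} {x : ℝ} {b b' : ℕ} (h : M.IsEff x b)
    (h' : M.IsEff x b') : b = b' := by
  obtain ⟨k, hk, hx, hm, hb⟩ := h
  obtain ⟨k', hk', hx', hm', hb'⟩ := h'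
  obtain rfl : k = k' := le_antisymm (hm' k hk hx) (hm k' hk' hx')
  exact hb.unique hb'

theorem exists_isEff {x : ℝ} (hx : M.costAt 0 ≤ x) : ∃ b, M.IsEff x b := by
  classical
  set s := (Finset.range M.K).filter fun k => M.costAt k ≤ x with hs
  have hne : s.Nonempty := ⟨0, by simp [hs, M.K_pos, hx]⟩
  have hmem := s.max'_mem hne
  simp only [hs, Finset.mem_filter, Finset.mem_range] at hmem
  obtain ⟨b, hb⟩ := M.exists_isBestUpTo hmem.1
  exact ⟨b, _, hmem.1, hmem.2, fun j hj hjx => s.le_max' j (by simp [hs, hj, hjx]), hb⟩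

open Classical in
/-- The first type of minimum density among the types of cost at most `x`. -/
noncomputable def eff (x : ℝ) : ℕ := if h : ∃ b, M.IsEff x b then h.choose else 0

theorem isEff_eff {x : ℝ} (hx : M.costAt 0 ≤ x) : M.IsEff x (M.eff x) := by
  have h := M.exists_isEff hx
  rw [eff, dif_pos h]
  exact h.choose_spec

theorem IsEff.eq_eff {M : MachineTypes} {x : ℝ} {b : ℕ} (h : M.IsEff x b) : b = M.eff x := by
  refine h.unique (M.isEff_eff ?_)
  obtain ⟨k, hk, hx, -⟩ := h
  exact (M.costAt_le (Nat.zero_le k) hk).trans hx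

/-- The budget for launches of rank `r`: the costs of one efficient launch of each smaller
rank, on top of the cost of the cheapest type. -/
noncomputable def budget : ℕ → ℝ
  | 0 => M.costAt 0
  | r + 1 => budget r + M.costAt (M.eff (budget r))

/-- The type used for launches of rank `r` that do not clear. -/
noncomputable def kindOf (r : ℕ) : ℕ := M.eff (M.budget r)

theorem budget_succ (r : ℕ) : M.budget (r + 1) = M.budget r + M.costAt (M.kindOf r) := rfl

theorem budget_mono : Monotone M.budget :=
  monotone_nat_of_le_succ fun r => by
    rw [budget_succ]; linarith [M.costAt_nonneg (M.kindOf r)]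

theorem costAt_zero_le_budget (r : ℕ) : M.costAt 0 ≤ M.budget r := M.budget_mono (Nat.zero_le r)

theorem isEff_kindOf (r : ℕ) : M.IsEff (M.budget r) (M.kindOf r) :=
  M.isEff_eff (M.costAt_zero_le_budget r)

theorem kindOf_lt (r : ℕ) : M.kindOf r < M.K := by
  obtain ⟨k, hk, -, -, hb⟩ := M.isEff_kindOf r
  exact hb.1.trans_lt hk

theorem costAt_kindOf_le (r : ℕ) : M.costAt (M.kindOf r) ≤ M.budget r := by
  obtain ⟨k, hk, hx, -, hb⟩ := M.isEff_kindOf r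
  exact (M.costAt_le hb.1 hk).trans hx

theorem density_kindOf_le {r j : ℕ} (hj : j < M.K) (h : M.costAt j ≤ M.budget r) :
    (M.capAt j : ℝ) * M.costAt (M.kindOf r) ≤ M.capAt (M.kindOf r) * M.costAt j := by
  obtain ⟨k, hk, hx, hm, hb⟩ := M.isEff_kindOf r
  exact hb.2.2 j (hm j hj h)

theorem sum_range_kindOf (m : ℕ) :
    ∑ r ∈ Finset.range m, M.costAt (M.kindOf r) = M.budget m - M.costAt 0 := by
  induction m with
  | zero => simp [budget]
  | succ m ih => rw [Finset.sum_range_succ, ih, budget_succ]; ring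

/-- The costs of all ranks below the largest rank `m` of `s` telescope to less than `budget m`, and
rank `m` itself costs at most `budget m < x`. -/
theorem sum_kindOf_le_of_budget_lt (s : Finset ℕ) (x : ℝ) (hx : 0 ≤ x)
    (h : ∀ r ∈ s, M.budget r < x) :
    ∑ r ∈ s, M.costAt (M.kindOf r) ≤ 2 * x := by
  rcases s.eq_empty_or_nonempty with rfl | hne
  · simp [hx]
  · have hm := h _ (s.max'_mem hne)
    calc ∑ r ∈ s, M.costAt (M.kindOf r)
        ≤ ∑ r ∈ Finset.range (s.max' hne + 1), M.costAt (M.kindOf r) :=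
          Finset.sum_le_sum_of_subset_of_nonneg
            (fun r hr => Finset.mem_range.2 (Nat.lt_succ_of_le (s.le_max' r hr)))
            fun _ _ _ => M.costAt_nonneg _
      _ = M.budget (s.max' hne) + M.costAt (M.kindOf (s.max' hne)) - M.costAt 0 := by
          rw [sum_range_kindOf, budget_succ]
      _ ≤ 2 * x := by
          linarith [M.costAt_kindOf_le (s.max' hne), M.costAt_nonneg 0]

end MachineTypes

/-! ### Lower bounds: charging witnesses to an arbitrary schedule. -/

/-- The release time of job `q`, and `0` if there is no such job. -/
def Problem.rel (I : Problem) (q : ℕ) : ℕ := if h : q < I.n then I.release ⟨q, h⟩ else 0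

/-- The deadline of job `q`, and `0` if there is no such job. -/
def Problem.due (I : Problem) (q : ℕ) : ℕ := if h : q < I.n then I.deadline ⟨q, h⟩ else 0

/-- A launch of rank `rank` that did not clear its jobs: it was full with the jobs `jobs`, all
with deadlines at most `time`, the time at which a job left behind was due. At that time `bound`
jobs had arrived. -/
structure Witness where
  rank : ℕ
  jobs : List ℕ
  time : ℕ
  bound : ℕ

/-- What the analysis uses about the list of witnesses, the last one first. -/
structure Problem.WitnessesOK (I : Problem) (W : List Witness) : Prop where
  nodup : (W.flatMap Witness.jobs).Nodup
  full : ∀ w ∈ W, w.jobs.length = I.types.capAt (I.types.kindOf w.rank)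
  due : ∀ w ∈ W, ∀ x ∈ w.jobs, I.due x ≤ w.time
  rel : ∀ w ∈ W, ∀ x < I.n, w.bound ≤ x → w.time < I.rel x
  rank : W.Pairwise fun w' w => w'.rank = w.rank → ∀ x ∈ w'.jobs, w.bound ≤ x

section Schedules

variable {I : Problem} {S : List Batch}

theorem Problem.IsSchedule.jobs_lt (hS : I.IsSchedule S) {X : Batch} (hX : X ∈ S) {x : ℕ}
    (hx : x ∈ X.jobs) : x < I.n := by
  have : x ∈ S.flatMap Batch.jobs := List.mem_flatMap.2 ⟨X, hX, hx⟩
  simpa using hS.partition.subset this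

theorem Problem.IsSchedule.rel_le (hS : I.IsSchedule S) {X : Batch} (hX : X ∈ S) {x : ℕ}
    (hx : x ∈ X.jobs) : I.rel x ≤ X.time := by
  have h := hS.jobs_lt hX hx
  simpa [Problem.rel, h] using (hS.window X hX ⟨x, h⟩ hx).1

theorem Problem.IsSchedule.le_due (hS : I.IsSchedule S) {X : Batch} (hX : X ∈ S) {x : ℕ}
    (hx : x ∈ X.jobs) : X.time ≤ I.due x := by
  have h := hS.jobs_lt hX hx
  simpa [Problem.due, h] using (hS.window X hX ⟨x, h⟩ hx).2

theorem Problem.IsSchedule.nodup_flatMap (hS : I.IsSchedule S) :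
    (S.flatMap Batch.jobs).Nodup := hS.partition.nodup_iff.2 List.nodup_range

theorem Problem.IsSchedule.nodup (hS : I.IsSchedule S) {X : Batch} (hX : X ∈ S) :
    X.jobs.Nodup := (List.nodup_flatMap.1 hS.nodup_flatMap).1 X hX

theorem Problem.IsSchedule.sum_count (hS : I.IsSchedule S) {x : ℕ} (hx : x < I.n) :
    (S.map fun X => X.jobs.count x).sum = 1 := by
  have h := hS.partition.count_eq x
  rw [List.count_flatMap, List.count_eq_one_of_mem List.nodup_range (by simpa using hx)] at h
  exact h

/-- The number of jobs in `l` that belong to the batch `X`. -/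
def meet (l : List ℕ) (X : Batch) : ℕ := (l.map fun x => X.jobs.count x).sum

theorem meet_append (l l' : List ℕ) (X : Batch) : meet (l ++ l') X = meet l X + meet l' X := by
  simp [meet]

theorem Problem.IsSchedule.sum_meet (hS : I.IsSchedule S) (l : List ℕ) (hl : ∀ x ∈ l, x < I.n) :
    (S.map fun X => meet l X).sum = l.length := by
  induction l with
  | nil => simp [meet]
  | cons x l ih =>
    have : (fun X => meet (x :: l) X) = fun X : Batch => X.jobs.count x + meet l X := by
      funext X; simp [meet]
    rw [this, List.sum_map_add, hS.sum_count (hl x (by simp)), ih fun y hy => hl y (by simp [hy])]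
    simp [add_comm]

theorem meet_le_length {X : Batch} (hX : X.jobs.Nodup) (l : List ℕ) : meet l X ≤ l.length := by
  induction l with
  | nil => simp [meet]
  | cons x l ih =>
    have := List.nodup_iff_count_le_one.1 hX x
    simp only [meet, List.map_cons, List.sum_cons, List.length_cons] at ih ⊢
    omega

theorem exists_mem_of_meet_pos {X : Batch} {l : List ℕ} (h : 0 < meet l X) :
    ∃ x ∈ l, x ∈ X.jobs := by
  by_contra hcon
  push Not at hcon
  have : meet l X = 0 := by
    rw [meet, List.sum_eq_zero]
    intro a ha
    obtain ⟨x, hx, rfl⟩ := List.mem_map.1 ha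
    exact List.count_eq_zero.2 (hcon x hx)
  omega

theorem meet_le_of_nodup {l : List ℕ} (hl : l.Nodup) (X : Batch) : meet l X ≤ X.jobs.length := by
  have h1 : meet l X = ∑ x ∈ l.toFinset, X.jobs.count x := (List.sum_toFinset _ hl).symm
  rw [h1]
  calc ∑ x ∈ l.toFinset, X.jobs.count x ≤ ∑ x ∈ l.toFinset ∪ X.jobs.toFinset, X.jobs.count x :=
        Finset.sum_le_sum_of_subset Finset.subset_union_left
    _ = X.jobs.length := by
        have := Multiset.sum_count_eq_card (s := l.toFinset ∪ X.jobs.toFinset)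
          (m := (X.jobs : Multiset ℕ)) (by intro a ha; simp at ha; simp [ha])
        simpa using this

theorem list_sum_comm {α β : Type*} (l : List α) (l' : List β) (f : α → β → ℝ) :
    (l.map fun a => (l'.map fun b => f a b).sum).sum =
      (l'.map fun b => (l.map fun a => f a b).sum).sum := by
  induction l with
  | nil => simp
  | cons a l ih => simp [ih, List.sum_map_add]

theorem sum_meet_witnesses (W : List Witness) (X : Batch) :
    (W.map fun w => meet w.jobs X).sum = meet (W.flatMap Witness.jobs) X := by
  induction W with
  | nil => simp [meet]
  | cons w W ih => rw [List.map_cons, List.sum_cons, ih, List.flatMap_cons, meet_append]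

variable {W : List Witness}

/-- Of two witnesses of equal rank, the jobs of the later one are released after the time of the
earlier one, by which all jobs of the earlier one are due. A single batch cannot contain a job of
each. -/
theorem Problem.WitnessesOK.ranks_nodup (hW : I.WitnessesOK W) (hS : I.IsSchedule S) {X : Batch}
    (hX : X ∈ S) : ((W.filter fun w => 0 < meet w.jobs X).map Witness.rank).Nodup := by
  rw [List.Nodup, List.pairwise_map]
  have h : (W.filter fun w => 0 < meet w.jobs X).Pairwise
      fun w' w => w'.rank = w.rank → ∀ x ∈ w'.jobs, w.bound ≤ x := hW.rank.filter _
  refine h.imp_of_mem ?_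
  intro w' w hw' hw hr heq
  simp only [List.mem_filter, decide_eq_true_eq] at hw' hw
  obtain ⟨x', hx', hx'X⟩ := exists_mem_of_meet_pos hw'.2
  obtain ⟨x, hx, hxX⟩ := exists_mem_of_meet_pos hw.2
  have h1 := hr heq x' hx'
  have h2 := hW.rel w hw.1 x' (hS.jobs_lt hX hx'X) h1
  have h3 := hW.due w hw.1 x hx
  have h4 := hS.rel_le hX hx'X
  have h5 := hS.le_due hX hxX
  omega

/-- The cost that the analysis charges to `X` for witness `w`. -/
noncomputable def Problem.charge (I : Problem) (w : Witness) (X : Batch) : ℝ :=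
  I.types.costAt (I.types.kindOf w.rank) / I.types.capAt (I.types.kindOf w.rank) * meet w.jobs X

theorem list_sum_filter_split {α : Type*} (l : List α) (f : α → ℝ) (p : α → Prop)
    [DecidablePred p] :
    (l.map f).sum = ((l.filter fun a => p a).map f).sum +
      ((l.filter fun a => ¬ p a).map f).sum := by
  induction l with
  | nil => simp
  | cons a l ih =>
    by_cases h : p a
    · simp [h, ih, add_assoc]
    · simp [h, ih]; ring

theorem list_sum_nonneg_filter_le {α : Type*} (l : List α) (f : α → ℝ) (p : α → Prop)
    [DecidablePred p] (hf : ∀ a, 0 ≤ f a) :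
    ((l.filter fun a => p a).map f).sum ≤ (l.map f).sum := by
  rw [list_sum_filter_split l f p]
  have : 0 ≤ ((l.filter fun a => ¬ p a).map f).sum :=
    List.sum_nonneg (by intro x hx; obtain ⟨a, -, rfl⟩ := List.mem_map.1 hx; exact hf a)
  linarith

/-- When the budget covers the type of `X`, that type competed for `kindOf`, so each job is charged
at most the cost per capacity of `X`. Witnesses have disjoint jobs, hence at most `capAt X.kind`
jobs are charged. -/
theorem Problem.WitnessesOK.sum_charge_cheap (hW : I.WitnessesOK W) (hS : I.IsSchedule S)
    {X : Batch} (hX : X ∈ S) :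
    ((W.filter fun w => I.types.costAt X.kind ≤ I.types.budget w.rank).map
      fun w => I.charge w X).sum ≤ I.types.costAt X.kind := by
  set M := I.types with hM
  have hk := hS.kind_lt X hX
  have hcap : (0 : ℝ) < M.capAt X.kind := by exact_mod_cast M.one_le_capAt hk
  have h1 : ((W.filter fun w => M.costAt X.kind ≤ M.budget w.rank).map
      fun w => I.charge w X).sum ≤
      ((W.filter fun w => M.costAt X.kind ≤ M.budget w.rank).map
      fun w => M.costAt X.kind / M.capAt X.kind * (meet w.jobs X : ℝ)).sum := by
    refine List.sum_le_sum fun w hw => ?_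
    simp only [List.mem_filter, decide_eq_true_eq] at hw
    have hc : (0 : ℝ) < M.capAt (M.kindOf w.rank) := by
      exact_mod_cast M.one_le_capAt (M.kindOf_lt _)
    refine mul_le_mul_of_nonneg_right ?_ (Nat.cast_nonneg _)
    rw [div_le_div_iff₀ hc hcap]
    have := M.density_kindOf_le hk hw.2
    linarith
  have h2 : ((W.filter fun w => M.costAt X.kind ≤ M.budget w.rank).map
      fun w => M.costAt X.kind / M.capAt X.kind * (meet w.jobs X : ℝ)).sum ≤
      (W.map fun w => M.costAt X.kind / M.capAt X.kind * (meet w.jobs X : ℝ)).sum := by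
    refine list_sum_nonneg_filter_le _ _ _ fun w => ?_
    have := M.costAt_nonneg X.kind
    positivity
  have h3 : (W.map fun w => M.costAt X.kind / M.capAt X.kind * (meet w.jobs X : ℝ)).sum =
      M.costAt X.kind / M.capAt X.kind * (meet (W.flatMap Witness.jobs) X : ℕ) := by
    rw [← sum_meet_witnesses, List.sum_map_mul_left, Nat.cast_list_sum, List.map_map]
    rfl
  have h4 : (meet (W.flatMap Witness.jobs) X : ℝ) ≤ M.capAt X.kind := by
    exact_mod_cast (meet_le_of_nodup hW.nodup X).trans (hS.capacity X hX)
  calc _ ≤ _ := h1.trans h2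
    _ = _ := h3
    _ ≤ M.costAt X.kind / M.capAt X.kind * M.capAt X.kind :=
        mul_le_mul_of_nonneg_left h4 (div_nonneg (M.costAt_nonneg _) hcap.le)
    _ = _ := by field_simp

/-- Each witness that meets `X` charges at most its whole cost, and these witnesses have distinct
ranks with budgets below the cost of `X`, so `sum_kindOf_le_of_budget_lt` applies. -/
theorem Problem.WitnessesOK.sum_charge_dear (hW : I.WitnessesOK W) (hS : I.IsSchedule S)
    {X : Batch} (hX : X ∈ S) :
    ((W.filter fun w => ¬ I.types.costAt X.kind ≤ I.types.budget w.rank).map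
      fun w => I.charge w X).sum ≤ 2 * I.types.costAt X.kind := by
  set M := I.types with hM
  set D := W.filter fun w => ¬ M.costAt X.kind ≤ M.budget w.rank with hD
  set E := D.filter fun w => 0 < meet w.jobs X with hE
  have hnd : (E.map Witness.rank).Nodup := by
    have : E = (W.filter fun w => 0 < meet w.jobs X).filter
        fun w => ¬ M.costAt X.kind ≤ M.budget w.rank := by
      rw [hE, hD, List.filter_filter, List.filter_filter]
      congr 1; funext w; exact Bool.and_comm _ _
    rw [this]
    exact (List.filter_sublist.map _).nodup (hW.ranks_nodup hS hX)
  have h1 : (D.map fun w => I.charge w X).sum = (E.map fun w => I.charge w X).sum := by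
    rw [list_sum_filter_split D _ fun w => 0 < meet w.jobs X, ← hE, add_eq_left]
    refine List.sum_eq_zero fun a ha => ?_
    obtain ⟨w, hw, rfl⟩ := List.mem_map.1 ha
    simp only [List.mem_filter, decide_eq_true_eq] at hw
    have : meet w.jobs X = 0 := by omega
    simp [Problem.charge, this]
  have h2 : (E.map fun w => I.charge w X).sum ≤
      (E.map fun w => M.costAt (M.kindOf w.rank)).sum := by
    refine List.sum_le_sum fun w hw => ?_
    have hwW : w ∈ W := List.mem_of_mem_filter (List.mem_of_mem_filter hw)
    have hc : (0 : ℝ) < M.capAt (M.kindOf w.rank) := by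
      exact_mod_cast M.one_le_capAt (M.kindOf_lt _)
    have hm : (meet w.jobs X : ℝ) ≤ M.capAt (M.kindOf w.rank) := by
      rw [hM, ← hW.full w hwW]; exact_mod_cast meet_le_length (hS.nodup hX) _
    calc I.charge w X ≤ M.costAt (M.kindOf w.rank) / M.capAt (M.kindOf w.rank) *
          M.capAt (M.kindOf w.rank) :=
          mul_le_mul_of_nonneg_left hm (div_nonneg (M.costAt_nonneg _) hc.le)
      _ = _ := by field_simp
  have h3 : (E.map fun w => M.costAt (M.kindOf w.rank)).sum =
      ∑ r ∈ (E.map Witness.rank).toFinset, M.costAt (M.kindOf r) := by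
    rw [List.sum_toFinset _ hnd, List.map_map]; rfl
  rw [h1]
  refine h2.trans (h3.le.trans (M.sum_kindOf_le_of_budget_lt _ _ (M.costAt_nonneg _) ?_))
  intro r hr
  simp only [List.mem_toFinset, List.mem_map] at hr
  obtain ⟨w, hw, rfl⟩ := hr
  have := List.mem_of_mem_filter hw
  simpa [hD] using (List.mem_filter.1 this).2

/-- The witnesses cost at most three times as much as any schedule. -/
theorem Problem.WitnessesOK.sum_cost_le (hW : I.WitnessesOK W) (hS : I.IsSchedule S)
    (hlt : ∀ x ∈ W.flatMap Witness.jobs, x < I.n) :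
    (W.map fun w => I.types.costAt (I.types.kindOf w.rank)).sum ≤ 3 * I.cost S := by
  have h1 : ∀ w ∈ W, I.types.costAt (I.types.kindOf w.rank) =
      (S.map fun X => I.charge w X).sum := by
    intro w hw
    have hc : (0 : ℝ) < I.types.capAt (I.types.kindOf w.rank) := by
      exact_mod_cast I.types.one_le_capAt (I.types.kindOf_lt _)
    have := hS.sum_meet w.jobs fun x hx => hlt x (List.mem_flatMap.2 ⟨w, hw, hx⟩)
    rw [hW.full w hw] at this
    simp only [Problem.charge]
    rw [List.sum_map_mul_left]
    have h' : (S.map fun X => (meet w.jobs X : ℝ)).sum =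
        I.types.capAt (I.types.kindOf w.rank) := by
      rw [← this, Nat.cast_list_sum, List.map_map]; rfl
    rw [h']
    field_simp
  rw [List.map_congr_left h1, list_sum_comm, Problem.cost, ← List.sum_map_mul_left]
  refine List.sum_le_sum fun X hX => ?_
  rw [list_sum_filter_split W _ fun w => I.types.costAt X.kind ≤ I.types.budget w.rank]
  linarith [hW.sum_charge_cheap hS hX, hW.sum_charge_dear hS hX]

/-- Jobs with pairwise disjoint windows need as many batches. -/
theorem Problem.IsSchedule.length_mul_le (hS : I.IsSchedule S) (F : List ℕ)
    (hF : ∀ j ∈ F, j < I.n) (hd : F.Pairwise fun j' j => I.due j < I.rel j') :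
    F.length * I.types.costAt 0 ≤ I.cost S := by
  have h1 : ∀ X ∈ S, meet F X ≤ 1 := by
    intro X hX
    clear hF
    induction F with
    | nil => simp [meet]
    | cons j F ih =>
      rw [List.pairwise_cons] at hd
      have ih := ih hd.2
      have hc := List.nodup_iff_count_le_one.1 (hS.nodup hX) j
      have hm : meet (j :: F) X = X.jobs.count j + meet F X := by simp [meet]
      -- If `X` contains `j`, it is executed after every other job of the list is due.
      rcases Nat.eq_zero_or_pos (X.jobs.count j) with h0 | h0
      · omega
      · have hj : j ∈ X.jobs := List.count_pos_iff.1 h0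
        have : ¬ 0 < meet F X := by
          intro hpos
          obtain ⟨x, hx, hxX⟩ := exists_mem_of_meet_pos hpos
          have := hd.1 x hx
          have := hS.rel_le hX hj
          have := hS.le_due hX hxX
          omega
        omega
  have h2 := hS.sum_meet F hF
  calc F.length * I.types.costAt 0
      = (S.map fun X => (meet F X : ℝ) * I.types.costAt 0).sum := by
        rw [← h2, List.sum_map_mul_right, Nat.cast_list_sum, List.map_map]; rfl
    _ ≤ I.cost S := by
        refine List.sum_le_sum fun X hX => ?_
        have hm : (meet F X : ℝ) ≤ 1 := by exact_mod_cast h1 X hX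
        have := I.types.costAt_nonneg 0
        have := I.types.costAt_le (Nat.zero_le X.kind) (hS.kind_lt X hX)
        nlinarith

end Schedules

/-! ### Cohorts, witnesses and the cost invariant. -/

/-- The jobs from `start` on (up to the next cohort) after a launch of rank `rank` and cost `cost`
that executed the jobs `jobs`, all of them from `start` on. -/
structure Cohort where
  start : ℕ
  rank : ℕ
  jobs : List ℕ
  cost : ℝ

/-- The jobs of the launch of `g` fill a batch of the type of its rank, which is less than `R`,
and none of them is due later than `q`. -/
structure Cohort.FullBefore (M : MachineTypes) (R : ℕ) (due : ℕ → ℕ) (g : Cohort) (q : ℕ) :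
    Prop where
  rank_lt : g.rank < R
  cost_eq : g.cost = M.costAt (M.kindOf g.rank)
  length_eq : g.jobs.length = M.capAt (M.kindOf g.rank)
  due_le : ∀ x ∈ g.jobs, due x ≤ due q

/-- The cohorts, the youngest first, are consecutive intervals below `e`, of increasing rank. -/
def CohortsOK (M : MachineTypes) (R : ℕ) (due : ℕ → ℕ) (P : Finset ℕ) : ℕ → List Cohort → Prop
  | e, [] => e = 0
  | e, g :: gs => g.start < e ∧ (∀ q ∈ P, g.start ≤ q → q < e → g.FullBefore M R due q) ∧
      (∀ h ∈ gs, g.rank < h.rank) ∧ g.cost ≤ M.budget g.rank ∧ CohortsOK M R due P g.start gs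

/-- The unused budget of the cohorts. -/
noncomputable def credit (M : MachineTypes) (G : List Cohort) : ℝ :=
  (G.map fun g => M.budget g.rank - g.cost).sum

theorem CohortsOK.mono {M : MachineTypes} {R R' : ℕ} {due : ℕ → ℕ} {P P' : Finset ℕ}
    (hP : P' ⊆ P) (hR : R ≤ R') {e : ℕ} {G : List Cohort} (h : CohortsOK M R due P e G) :
    CohortsOK M R' due P' e G := by
  induction G generalizing e with
  | nil => exact h
  | cons g G ih =>
    obtain ⟨h1, h2, h3, h4, h5⟩ := h
    exact ⟨h1, fun q hq hgq hqe => { h2 q (hP hq) hgq hqe with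
      rank_lt := (h2 q (hP hq) hgq hqe).rank_lt.trans_le hR }, h3, h4, ih h5⟩

/-- A new job has a number outside all cohorts, so it imposes no condition on their launches. -/
theorem CohortsOK.insert {M : MachineTypes} {R : ℕ} {due : ℕ → ℕ} {P : Finset ℕ} {e j : ℕ}
    {G : List Cohort} (h : CohortsOK M R due P e G) (hj : e ≤ j) :
    CohortsOK M R due (insert j P) e G := by
  induction G generalizing e with
  | nil => exact h
  | cons g G ih =>
    obtain ⟨h1, h2, h3, h4, h5⟩ := h
    refine ⟨h1, fun q hq hgq hqe => h2 q ?_ hgq hqe, h3, h4, ih h5 (by omega)⟩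
    rcases Finset.mem_insert.1 hq with rfl | hq
    · omega
    · exact hq

theorem CohortsOK.cost_le {M : MachineTypes} {R : ℕ} {due : ℕ → ℕ} {P : Finset ℕ} {e : ℕ}
    {G : List Cohort} (h : CohortsOK M R due P e G) : ∀ g ∈ G, g.cost ≤ M.budget g.rank := by
  induction G generalizing e with
  | nil => simp
  | cons g G ih =>
    obtain ⟨h1, h2, h3, h4, h5⟩ := h
    intro g' hg'
    rcases List.mem_cons.1 hg' with rfl | hg'
    · exact h4
    · exact ih h5 g' hg'

theorem CohortsOK.credit_nonneg {M : MachineTypes} {R : ℕ} {due : ℕ → ℕ} {P : Finset ℕ} {e : ℕ}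
    {G : List Cohort} (h : CohortsOK M R due P e G) : 0 ≤ credit M G :=
  List.sum_nonneg fun x hx => by
    obtain ⟨g, hg, rfl⟩ := List.mem_map.1 hx
    exact sub_nonneg.2 (h.cost_le g hg)

/-- Discarding young cohorts. -/
theorem CohortsOK.of_append {M : MachineTypes} {R : ℕ} {due : ℕ → ℕ} {P : Finset ℕ} {e : ℕ}
    {D G : List Cohort} (h : CohortsOK M R due P e (D ++ G)) :
    ∃ e' ≤ e, CohortsOK M R due P e' G ∧ (∀ g ∈ D, e' ≤ g.start) ∧
      (∀ g ∈ D, ∀ g' ∈ G, g.rank < g'.rank) ∧ ∀ x, (∀ g ∈ D, x < g.start) → x < e → x < e' := by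
  induction D generalizing e with
  | nil => exact ⟨e, le_rfl, h, by simp, by simp, by simp⟩
  | cons d D ih =>
    obtain ⟨h1, h2, h3, h4, h5⟩ := h
    obtain ⟨e', he', hG, hD, hr, hx⟩ := ih h5
    refine ⟨e', by omega, hG, ?_, ?_, ?_⟩
    · intro g hg
      rcases List.mem_cons.1 hg with rfl | hg
      · exact he'
      · exact hD g hg
    · intro g hg g' hg'
      rcases List.mem_cons.1 hg with rfl | hg
      · exact h3 g' (by simp [hg'])
      · exact hr g hg g' hg'
    · intro x hx1 _
      exact hx x (fun g hg => hx1 g (by simp [hg])) (hx1 d (by simp))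

/-- The part of the invariant of the algorithm that does not mention the youngest cohort. `a` is
the number of jobs that have arrived, `P` is the set of the pending jobs, `O` the list of the
batches executed so far, `G` the list of the cohorts, `W` the list of the witnesses, `F` the list
of the jobs that triggered a launch of rank `0`. -/
structure Ledger (I : Problem) (a : ℕ) (P : Finset ℕ) (O : List Batch) (G : List Cohort)
    (W : List Witness) (F : List ℕ) : Prop where
  arrived_le : a ≤ I.n
  partition : (↑(O.flatMap Batch.jobs) : Multiset ℕ) + P.val = Multiset.range a
  nonempty : ∀ X ∈ O, X.jobs ≠ []
  kind_lt : ∀ X ∈ O, X.kind < I.types.K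
  capacity : ∀ X ∈ O, X.jobs.length ≤ I.types.capAt X.kind
  window : ∀ X ∈ O, ∀ x ∈ X.jobs, I.rel x ≤ X.time ∧ X.time ≤ I.due x
  used : (↑(W.flatMap Witness.jobs) : Multiset ℕ) + ↑(G.flatMap Cohort.jobs) ≤
    ↑(O.flatMap Batch.jobs)
  witness_full : ∀ w ∈ W, w.jobs.length = I.types.capAt (I.types.kindOf w.rank)
  witness_due : ∀ w ∈ W, ∀ x ∈ w.jobs, I.due x ≤ w.time
  witness_rel : ∀ w ∈ W, ∀ x < I.n, w.bound ≤ x → w.time < I.rel x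
  witness_rank : W.Pairwise fun w' w => w'.rank = w.rank → ∀ x ∈ w'.jobs, w.bound ≤ x
  -- This becomes `witness_rank` when `g` is turned into a witness.
  cohort_rank : ∀ g ∈ G, ∀ w ∈ W, w.rank = g.rank → ∀ x ∈ g.jobs, w.bound ≤ x
  -- A launch that reaches back behind a witness has a higher rank. Hence a launch of the same rank
  -- uses only jobs that arrived after the witness was created.
  cohort_start : ∀ g ∈ G, ∀ w ∈ W, g.start < w.bound → w.rank < g.rank
  first_lt : ∀ j ∈ F, j < a
  first_disjoint : F.Pairwise fun j' j => I.due j < I.rel j'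

variable {I : Problem} {a : ℕ} {P : Finset ℕ} {O : List Batch} {G : List Cohort}
  {W : List Witness} {F : List ℕ}

theorem Ledger.lt_of_mem (h : Ledger I a P O G W F) {q : ℕ} (hq : q ∈ P) : q < a := by
  have : q ∈ Multiset.range a := by
    rw [← h.partition]; exact Multiset.mem_add.2 (Or.inr hq)
  simpa using this

theorem Ledger.lt_of_mem_out (h : Ledger I a P O G W F) {q : ℕ}
    (hq : q ∈ O.flatMap Batch.jobs) : q < a := by
  have : q ∈ Multiset.range a := by
    rw [← h.partition]; exact Multiset.mem_add.2 (Or.inl (by simpa using hq))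
  simpa using this

theorem Ledger.drop (h : Ledger I a P O G W F) {G' : List Cohort} (hG : G'.Sublist G) :
    Ledger I a P O G' W F where
  __ := h
  used := by
    refine le_trans ?_ h.used
    gcongr
    exact (hG.flatMap Cohort.jobs).subperm
  cohort_rank g hg := h.cohort_rank g (hG.subset hg)
  cohort_start g hg := h.cohort_start g (hG.subset hg)

theorem Ledger.arrive (h : Ledger I a P O G W F) (ha : a < I.n) :
    Ledger I (a + 1) (insert a P) O G W F where
  __ := h
  arrived_le := ha
  partition := by
    have : a ∉ P := fun hq => by have := h.lt_of_mem hq; omega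
    rw [Finset.insert_val_of_notMem this, Multiset.add_cons, h.partition, Multiset.range_succ]
  first_lt j hj := (h.first_lt j hj).trans (by omega)

/-- The youngest cohort becomes a witness. -/
theorem Ledger.certify {g : Cohort} (h : Ledger I a P O (g :: G) W F) {j τ : ℕ}
    {R : ℕ} (hg : g.FullBefore I.types R I.due j) (hj : I.due j = τ)
    (ha : ∀ x < I.n, a ≤ x → τ < I.rel x) (hr : ∀ h' ∈ G, g.rank < h'.rank) :
    Ledger I a P O G (⟨g.rank, g.jobs, τ, a⟩ :: W) F where
  __ := h
  used := by
    refine le_trans (le_of_eq ?_) h.used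
    simp only [List.flatMap_cons, ← Multiset.coe_add]
    abel
  witness_full w hw := by
    rcases List.mem_cons.1 hw with rfl | hw
    · exact hg.length_eq
    · exact h.witness_full w hw
  witness_due w hw := by
    rcases List.mem_cons.1 hw with rfl | hw
    · intro x hx; rw [← hj]; exact hg.due_le x hx
    · exact h.witness_due w hw
  witness_rel w hw := by
    rcases List.mem_cons.1 hw with rfl | hw
    · exact ha
    · exact h.witness_rel w hw
  witness_rank := by
    refine List.pairwise_cons.2 ⟨fun w hw heq => ?_, h.witness_rank⟩
    exact h.cohort_rank g (by simp) w hw heq.symm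
  cohort_rank g' hg' w hw heq := by
    rcases List.mem_cons.1 hw with rfl | hw
    · have := hr g' hg'
      simp only at heq
      omega
    · exact h.cohort_rank g' (by simp [hg']) w hw heq
  cohort_start g' hg' w hw hlt := by
    rcases List.mem_cons.1 hw with rfl | hw
    · exact hr g' hg'
    · exact h.cohort_start g' (by simp [hg']) w hw hlt

theorem Ledger.first (h : Ledger I a P O G W F) {j : ℕ} (hj : j < a)
    (hd : ∀ i ∈ F, I.due i < I.rel j) : Ledger I a P O G W (j :: F) where
  __ := h
  first_lt i hi := by
    rcases List.mem_cons.1 hi with rfl | hi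
    · exact hj
    · exact h.first_lt i hi
  first_disjoint := List.pairwise_cons.2 ⟨hd, h.first_disjoint⟩

/-- A launch of rank `r` for the pending jobs from `st` on. -/
theorem Ledger.launch (h : Ledger I a P O G W F) {J : List ℕ} {st r k τ : ℕ} {c : ℝ}
    (hJ : J.Nodup) (hJP : ∀ x ∈ J, x ∈ P ∧ st ≤ x) (hne : J ≠ []) (hk : k < I.types.K)
    (hcap : J.length ≤ I.types.capAt k)
    (hw : ∀ x ∈ P, I.rel x ≤ τ ∧ τ ≤ I.due x)
    (hst : ∀ w ∈ W, st < w.bound → w.rank < r) :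
    Ledger I a (P \ J.toFinset) (⟨τ, k, J⟩ :: O) (⟨st, r, J, c⟩ :: G) W F where
  __ := h
  partition := by
    have hsub : J.toFinset ⊆ P := fun x hx => (hJP x (by simpa using hx)).1
    have : (↑J : Multiset ℕ) + (P \ J.toFinset).val = P.val := by
      have h2 := congrArg Finset.val (Finset.disjUnion_eq_union J.toFinset (P \ J.toFinset)
        Finset.disjoint_sdiff)
      rw [Finset.union_sdiff_of_subset hsub] at h2
      rw [← h2]
      simp [Finset.disjUnion, List.toFinset_val, hJ.dedup]
    rw [← h.partition, ← this, List.flatMap_cons, ← Multiset.coe_add]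
    abel
  nonempty X hX := by
    rcases List.mem_cons.1 hX with rfl | hX
    · exact hne
    · exact h.nonempty X hX
  kind_lt X hX := by
    rcases List.mem_cons.1 hX with rfl | hX
    · exact hk
    · exact h.kind_lt X hX
  capacity X hX := by
    rcases List.mem_cons.1 hX with rfl | hX
    · exact hcap
    · exact h.capacity X hX
  window X hX := by
    rcases List.mem_cons.1 hX with rfl | hX
    · exact fun x hx => hw x (hJP x hx).1
    · exact h.window X hX
  used := by
    have := h.used
    simp only [List.flatMap_cons, ← Multiset.coe_add] at this ⊢
    calc _ = (↑J : Multiset ℕ) + (↑(W.flatMap Witness.jobs) + ↑(G.flatMap Cohort.jobs)) := by abel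
      _ ≤ _ := by gcongr
  cohort_rank g hg w hw' heq x hx := by
    rcases List.mem_cons.1 hg with rfl | hg
    · by_contra hlt
      have h1 := (hJP x hx).2
      have := hst w hw' (by omega)
      simp only at heq
      omega
    · exact h.cohort_rank g hg w hw' heq x hx
  cohort_start g hg w hw' hlt := by
    rcases List.mem_cons.1 hg with rfl | hg
    · exact hst w hw' hlt
    · exact h.cohort_start g hg w hw' hlt

theorem Ledger.witnessesOK (h : Ledger I a P O G W F) : I.WitnessesOK W where
  nodup := by
    have h1 : (↑(W.flatMap Witness.jobs) : Multiset ℕ) ≤ Multiset.range a :=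
      (Multiset.le_add_right _ _).trans (h.used.trans
        ((Multiset.le_add_right _ _).trans h.partition.le))
    exact Multiset.coe_nodup.1 (Multiset.nodup_of_le h1 (Multiset.nodup_range a))
  full := h.witness_full
  due := h.witness_due
  rel := h.witness_rel
  rank := h.witness_rank

theorem Ledger.isSchedule (h : Ledger I I.n ∅ O G W F) : I.IsSchedule O where
  partition := by
    have := h.partition
    simp only [Finset.empty_val, add_zero] at this
    exact Multiset.coe_eq_coe.1 this
  nonempty := h.nonempty
  kind_lt := h.kind_lt
  capacity := h.capacity
  window X hX j hj := by
    have := h.window X hX j hj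
    simpa [Problem.rel, Problem.due] using this

/-- The factor is `2 * 3 + 1`: the witnesses cost at most three times the schedule, and the triggers
of rank `0` account for one more. The number `x` stands for the remaining credit. -/
theorem Ledger.cost_le (h : Ledger I a P O G W F) {x : ℝ} (hx : 0 ≤ x)
    (hc : I.cost O + x ≤
      2 * (W.map fun w => I.types.costAt (I.types.kindOf w.rank)).sum +
        F.length * I.types.costAt 0) {S : List Batch} (hS : I.IsSchedule S) :
    I.cost O ≤ 7 * I.cost S := by
  have h1 := h.witnessesOK.sum_cost_le hS fun x hx => by
    have : x ∈ (↑(O.flatMap Batch.jobs) : Multiset ℕ) :=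
      Multiset.mem_of_le h.used (Multiset.mem_add.2 (Or.inl (by simpa using hx)))
    exact (h.lt_of_mem_out (by simpa using this)).trans_le h.arrived_le
  have h2 := hS.length_mul_le F (fun j hj => (h.first_lt j hj).trans_le h.arrived_le)
    h.first_disjoint
  linarith

theorem Problem.cost_nonneg (I : Problem) (S : List Batch) : 0 ≤ I.cost S :=
  List.sum_nonneg fun x hx => by
    obtain ⟨X, -, rfl⟩ := List.mem_map.1 hx
    exact I.types.costAt_nonneg _

theorem Problem.le_opt {I : Problem} {S : List Batch} (hS : I.IsSchedule S) {x : ℝ}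
    (h : ∀ S', I.IsSchedule S' → x ≤ I.cost S') : x ≤ I.opt := by
  refine le_csInf ⟨_, S, hS, rfl⟩ ?_
  rintro _ ⟨S', hS', rfl⟩
  exact h S' hS'

/-- The invariant of the algorithm; `f` is the number of jobs that had arrived at the latest
launch, and `R` the number of ranks whose type is known. -/
structure Invariant (I : Problem) (R a : ℕ) (P : Finset ℕ) (O : List Batch) (G : List Cohort)
    (W : List Witness) (F : List ℕ) (f : ℕ) : Prop where
  ledger : Ledger I a P O G W F
  cohorts : CohortsOK I.types R I.due P f G
  le_arrived : f ≤ a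
  bound_le : ∀ w ∈ W, w.bound ≤ f
  first_due : ∀ j ∈ F, ∀ q < I.n, f ≤ q → I.due j < I.rel q
  cost_le : I.cost O + credit I.types G ≤
    2 * (W.map fun w => I.types.costAt (I.types.kindOf w.rank)).sum + F.length * I.types.costAt 0

/-- The invariant while a launch of rank `r` for the jobs from `st` on is being prepared. -/
structure Prepared (I : Problem) (R a : ℕ) (P : Finset ℕ) (O : List Batch) (G : List Cohort)
    (W : List Witness) (F : List ℕ) (st r : ℕ) : Prop where
  ledger : Ledger I a P O G W F
  cohorts : CohortsOK I.types R I.due P st G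
  bound_le : ∀ w ∈ W, w.bound ≤ a
  rank_lt : ∀ w ∈ W, st < w.bound → w.rank < r
  rank_le : ∀ g ∈ G, r ≤ g.rank
  rank_known : r ≤ R
  first_due : ∀ j ∈ F, ∀ q < I.n, a ≤ q → I.due j < I.rel q
  cost_le : I.cost O + credit I.types G + I.types.budget r ≤
    2 * (W.map fun w => I.types.costAt (I.types.kindOf w.rank)).sum + F.length * I.types.costAt 0

variable {f R : ℕ}

theorem Invariant.arrive (h : Invariant I R a P O G W F f) (ha : a < I.n) :
    Invariant I R (a + 1) (insert a P) O G W F f where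
  __ := h
  ledger := h.ledger.arrive ha
  cohorts := h.cohorts.insert h.le_arrived
  le_arrived := h.le_arrived.trans (by omega)

/-- The new member of `F` pays `budget 0`. Its window is disjoint from the earlier ones because `j`
arrived after the latest launch, whereas earlier triggers were due by then. -/
theorem Invariant.prepare_first (h : Invariant I R a P O G W F f) {j τ : ℕ} (hj : j ∈ P)
    (hf : f ≤ j) (hτ : I.due j = τ) (ha : ∀ q < I.n, a ≤ q → τ < I.rel q) :
    Prepared I R a P O G W (j :: F) f 0 where
  ledger := h.ledger.first (h.ledger.lt_of_mem hj) fun i hi =>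
    h.first_due i hi j ((h.ledger.lt_of_mem hj).trans_le h.ledger.arrived_le) hf
  cohorts := h.cohorts
  bound_le w hw := (h.bound_le w hw).trans h.le_arrived
  rank_lt w hw hlt := by have := h.bound_le w hw; omega
  rank_le _ _ := Nat.zero_le _
  rank_known := Nat.zero_le _
  first_due i hi q hq haq := by
    rcases List.mem_cons.1 hi with rfl | hi
    · rw [hτ]; exact ha q hq haq
    · exact h.first_due i hi q hq (h.le_arrived.trans haq)
  cost_le := by
    have := h.cost_le
    simp only [List.length_cons, MachineTypes.budget]
    push_cast
    linarith

/-- Since `j` is pending in the cohort `g`, the launch of `g` was full and becomes a witness. The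
credit `budget g.rank - g.cost` and twice the cost of the witness add up to `budget (g.rank + 1)`.
The credit of the younger cohorts `D` is given up. -/
theorem Invariant.prepare_next {D : List Cohort} {g : Cohort}
    (h : Invariant I R a P O (D ++ g :: G) W F f) {j τ : ℕ} (hj : j ∈ P) (hf : j < f)
    (hD : ∀ d ∈ D, j < d.start) (hg : g.start ≤ j) (hτ : I.due j = τ)
    (ha : ∀ q < I.n, a ≤ q → τ < I.rel q) :
    Prepared I R a P O G (⟨g.rank, g.jobs, τ, a⟩ :: W) F g.start (g.rank + 1) := by
  obtain ⟨e, he, hG, -, -, hx⟩ := h.cohorts.of_append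
  obtain ⟨h1, h2, h3, h4, h5⟩ := hG
  have hfull := h2 j hj hg (hx j hD hf)
  have hl : Ledger I a P O (g :: G) W F := h.ledger.drop (List.sublist_append_right _ _)
  refine ⟨hl.certify hfull hτ ha h3, h5, ?_, ?_, ?_, hfull.rank_lt, ?_, ?_⟩
  · intro w hw
    rcases List.mem_cons.1 hw with rfl | hw
    · exact le_rfl
    · exact (h.bound_le w hw).trans h.le_arrived
  · intro w hw hlt
    rcases List.mem_cons.1 hw with rfl | hw
    · exact Nat.lt_succ_self _
    · exact (hl.cohort_start g (by simp) w hw hlt).trans (Nat.lt_succ_self _)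
  · exact fun g' hg' => h3 g' hg'
  · exact fun i hi q hq haq => h.first_due i hi q hq (h.le_arrived.trans haq)
  · have hc := h.cost_le
    have hD : 0 ≤ credit I.types D := by
      refine List.sum_nonneg fun x hx => ?_
      obtain ⟨d, hd, rfl⟩ := List.mem_map.1 hx
      exact sub_nonneg.2 (h.cohorts.cost_le d (by simp [hd]))
    have he : credit I.types (D ++ g :: G) =
        credit I.types D + (I.types.budget g.rank - g.cost) + credit I.types G := by
      simp [credit, add_assoc]
    have hcost := hfull.cost_eq
    rw [he] at hc
    simp only [List.map_cons, List.sum_cons, MachineTypes.budget_succ]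
    linarith

/-- Absorbing a cohort of the same rank keeps the ranks on the stack strictly monotone; this
strictness is what `Ledger.certify` uses for `cohort_start`. No witness is created, and the credit
of `g` is dropped. -/
theorem Prepared.merge {g : Cohort} {st r : ℕ} (h : Prepared I R a P O (g :: G) W F st r)
    (hg : g.rank = r) :
    Prepared I R a P O G W F g.start r ∧ g.start < st ∧ ∀ g' ∈ G, r < g'.rank := by
  obtain ⟨h1, h2, h3, h4, h5⟩ := h.cohorts
  refine ⟨⟨h.ledger.drop (List.sublist_cons_self _ _), h5, h.bound_le, ?_, ?_, h.rank_known,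
    h.first_due, ?_⟩,
    h1, hg ▸ h3⟩
  · intro w hw hlt
    rw [← hg]
    exact h.ledger.cohort_start g (by simp) w hw hlt
  · exact fun g' hg' => h.rank_le g' (by simp [hg'])
  · have := h.cost_le
    have he : credit I.types (g :: G) =
        (I.types.budget g.rank - g.cost) + credit I.types G := by simp [credit]
    linarith

theorem Prepared.rank_lt_of_ne {g : Cohort} {st r : ℕ} (h : Prepared I R a P O (g :: G) W F st r)
    (hg : g.rank ≠ r) : ∀ g' ∈ g :: G, r < g'.rank := by
  obtain ⟨h1, h2, h3, h4, h5⟩ := h.cohorts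
  have := h.rank_le g (by simp)
  intro g' hg'
  rcases List.mem_cons.1 hg' with rfl | hg'
  · omega
  · have := h3 g' hg'
    omega

/-- The reserved budget of rank `r` is split into the cost of the batch and the credit of the new
cohort, which reaches from `st` up to all arrived jobs. `hfull` is vacuous for a launch that leaves
no job from `st` on. -/
theorem Prepared.launch {st r k τ R' : ℕ} {J : List ℕ} (h : Prepared I R a P O G W F st r)
    (hR : R ≤ R') (hr : ∀ g ∈ G, r < g.rank) (hst : st < a) (hJ : J.Nodup)
    (hJP : ∀ x ∈ J, x ∈ P ∧ st ≤ x) (hne : J ≠ []) (hk : k < I.types.K)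
    (hcap : J.length ≤ I.types.capAt k) (hw : ∀ x ∈ P, I.rel x ≤ τ ∧ τ ≤ I.due x)
    (hc : I.types.costAt k ≤ I.types.budget r)
    (hedf : ∀ x ∈ J, ∀ q ∈ P \ J.toFinset, st ≤ q → I.due x ≤ I.due q)
    (hfull : ∀ q ∈ P \ J.toFinset, st ≤ q →
      r < R' ∧ k = I.types.kindOf r ∧ J.length = I.types.capAt k) :
    Invariant I R' a (P \ J.toFinset) (⟨τ, k, J⟩ :: O) (⟨st, r, J, I.types.costAt k⟩ :: G) W F
      a where
  ledger := h.ledger.launch hJ hJP hne hk hcap hw h.rank_lt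
  cohorts := by
    refine ⟨hst, fun q hq hsq _ => ?_, hr, hc, h.cohorts.mono Finset.sdiff_subset hR⟩
    obtain ⟨hrR, rfl, hl⟩ := hfull q hq hsq
    exact ⟨hrR, rfl, hl, fun x hx => hedf x hx q hq hsq⟩
  le_arrived := le_rfl
  bound_le := h.bound_le
  first_due := h.first_due
  cost_le := by
    have := h.cost_le
    have he : credit I.types (⟨st, r, J, I.types.costAt k⟩ :: G) =
        (I.types.budget r - I.types.costAt k) + credit I.types G := by simp [credit]
    have ho : I.cost (⟨τ, k, J⟩ :: O) = I.types.costAt k + I.cost O := by simp [Problem.cost]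
    linarith

/-! ### Rules for reasoning about programs. -/

/-- From the state `s`, the program `p` halts in a state and after a number of steps that
satisfy `Q`. -/
def Cmd.Meets (v : View) (p : Cmd) (s : State) (Q : State → ℕ → Prop) : Prop :=
  ∃ s' t, Exec v p s s' t ∧ Q s' t

namespace Cmd

variable {v : View} {s : State} {Q : State → ℕ → Prop}

theorem meets_skip : skip.Meets v s Q ↔ Q s 1 :=
  ⟨by rintro ⟨_, _, ⟨⟩, h⟩; exact h, fun h => ⟨_, _, .skip s, h⟩⟩

theorem meets_nstore {a : ℕ} {i e : NExp} :
    (nstore a i e).Meets v s Q ↔ Q (s.setNat a (i.eval v s) (e.eval v s)) 1 :=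
  ⟨by rintro ⟨_, _, ⟨⟩, h⟩; exact h, fun h => ⟨_, _, .nstore a i e s, h⟩⟩

theorem meets_rstore {a : ℕ} {i : NExp} {e : RExp} :
    (rstore a i e).Meets v s Q ↔ Q (s.setReal a (i.eval v s) (e.eval v s)) 1 :=
  ⟨by rintro ⟨_, _, ⟨⟩, h⟩; exact h, fun h => ⟨_, _, .rstore a i e s, h⟩⟩

theorem meets_setAlarm {e : NExp} :
    (setAlarm e).Meets v s Q ↔ Q { s with alarm := e.eval v s } 1 :=
  ⟨by rintro ⟨_, _, ⟨⟩, h⟩; exact h, fun h => ⟨_, _, .setAlarm e s, h⟩⟩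

theorem meets_launch {k : NExp} {a : ℕ} {m : NExp} :
    (launch k a m).Meets v s Q ↔
      Q { s with out := ⟨v.now, k.eval v s, (List.range (m.eval v s)).map (s.nat a)⟩ :: s.out }
        (1 + m.eval v s) :=
  ⟨by rintro ⟨_, _, ⟨⟩, h⟩; exact h, fun h => ⟨_, _, .launch k a m s, h⟩⟩

theorem meets_seq {p q : Cmd} : (seq p q).Meets v s Q ↔
    p.Meets v s fun s₁ t₁ => q.Meets v s₁ fun s₂ t₂ => Q s₂ (t₁ + t₂) := by
  constructor
  · rintro ⟨_, _, ⟨⟩, h⟩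
    rename_i h₁ h₂
    exact ⟨_, _, h₁, _, _, h₂, h⟩
  · rintro ⟨_, _, h₁, _, _, h₂, h⟩
    exact ⟨_, _, .seq h₁ h₂, h⟩

theorem meets_ite {b : BExp} {p q : Cmd} : (ite b p q).Meets v s Q ↔
    (b.eval v s → p.Meets v s fun s' t => Q s' (1 + t)) ∧
      (¬ b.eval v s → q.Meets v s fun s' t => Q s' (1 + t)) := by
  by_cases hb : b.eval v s
  · simp only [hb, not_true, false_imp_iff, and_true, true_imp_iff]
    constructor
    · rintro ⟨_, _, hx, h⟩
      cases hx with
      | iteTrue _ _ hx => exact ⟨_, _, hx, h⟩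
      | iteFalse _ hn _ => exact absurd hb hn
    · rintro ⟨_, _, hx, h⟩
      exact ⟨_, _, .iteTrue q hb hx, h⟩
  · simp only [hb, not_false_iff, false_imp_iff, true_and, true_imp_iff]
    constructor
    · rintro ⟨_, _, hx, h⟩
      cases hx with
      | iteTrue _ hp _ => exact absurd hp hb
      | iteFalse _ _ hx => exact ⟨_, _, hx, h⟩
    · rintro ⟨_, _, hx, h⟩
      exact ⟨_, _, .iteFalse p hb hx, h⟩

/-- The execution itself is handed on, so that the facts `Exec.nat_eq`, `Exec.real_eq` and
`Exec.out_eq` about untouched memory and output can be used afterwards instead of being part of each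
specification. -/
theorem Meets.imp {p : Cmd} {R : State → ℕ → Prop} (h : p.Meets v s R)
    (himp : ∀ s' t, Exec v p s s' t → R s' t → Q s' t) : p.Meets v s Q := by
  obtain ⟨s', t, hx, hR⟩ := h
  exact ⟨s', t, hx, himp s' t hx hR⟩

theorem Meets.seq {p q : Cmd} {R : State → ℕ → Prop} (hp : p.Meets v s R)
    (hq : ∀ s₁ t₁, Exec v p s s₁ t₁ → R s₁ t₁ →
      q.Meets v s₁ fun s₂ t₂ => Q s₂ (t₁ + t₂)) : (seq p q).Meets v s Q :=
  meets_seq.2 (hp.imp hq)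

/-- A loop with the invariant `Inv`, whose second argument bounds the number of the remaining
steps. -/
theorem Meets.loop {b : BExp} {p : Cmd} (Inv : State → ℕ → Prop)
    (step : ∀ s φ, Inv s φ → b.eval v s →
      p.Meets v s fun s' t => ∃ φ', Inv s' φ' ∧ t + 1 + φ' ≤ φ) {φ : ℕ} (h : Inv s φ) :
    (loop b p).Meets v s fun s' t => ∃ φ', Inv s' φ' ∧ ¬ b.eval v s' ∧ t + φ' ≤ φ + 1 := by
  induction φ using Nat.strong_induction_on generalizing s with
  | _ φ ih =>
    by_cases hb : b.eval v s
    · obtain ⟨s₁, t₁, hx, φ₁, h₁, hle⟩ := step s φ h hb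
      obtain ⟨s₂, t₂, hx₂, φ₂, h₂, hn, hle₂⟩ := ih φ₁ (by omega) h₁
      exact ⟨s₂, _, .loopTrue hb hx hx₂, φ₂, h₂, hn, by omega⟩
    · exact ⟨s, 1, .loopFalse p hb, φ, h, hb, by omega⟩

/-- The arrays of natural numbers that a program may change. -/
def natTargets : Cmd → List ℕ
  | nstore a _ _ => [a]
  | seq p q => p.natTargets ++ q.natTargets
  | ite _ p q => p.natTargets ++ q.natTargets
  | loop _ p => p.natTargets
  | _ => []

/-- The arrays of real numbers that a program may change. -/
def realTargets : Cmd → List ℕ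
  | rstore a _ _ => [a]
  | seq p q => p.realTargets ++ q.realTargets
  | ite _ p q => p.realTargets ++ q.realTargets
  | loop _ p => p.realTargets
  | _ => []

/-- Whether a program only computes: it neither executes batches nor sets the alarm. -/
def computes : Cmd → Bool
  | launch _ _ _ => false
  | setAlarm _ => false
  | seq p q => p.computes && q.computes
  | ite _ p q => p.computes && q.computes
  | loop _ p => p.computes
  | _ => true

end Cmd

theorem State.nat_setNat (s : State) (a i x b j : ℕ) :
    (s.setNat a i x).nat b j = if b = a ∧ j = i then x else s.nat b j := rfl

theorem State.nat_setNat_ne (s : State) (a i x : ℕ) {b : ℕ} (h : b ≠ a) :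
    (s.setNat a i x).nat b = s.nat b := by
  funext j; simp [State.nat_setNat, h]

theorem State.nat_setNat_self (s : State) (a i x j : ℕ) :
    (s.setNat a i x).nat a j = if j = i then x else s.nat a j := by
  simp [State.nat_setNat]

theorem State.real_setReal_ne (s : State) (a i : ℕ) (x : ℝ) {b : ℕ} (h : b ≠ a) :
    (s.setReal a i x).real b = s.real b := by
  funext j; simp [State.setReal, h]

theorem State.real_setReal_self (s : State) (a i : ℕ) (x : ℝ) (j : ℕ) :
    (s.setReal a i x).real a j = if j = i then x else s.real a j := by
  simp [State.setReal]

theorem State.real_setNat (s : State) (a i x : ℕ) : (s.setNat a i x).real = s.real := rfl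

theorem State.out_setNat (s : State) (a i x : ℕ) : (s.setNat a i x).out = s.out := rfl

theorem State.real_setReal (s : State) (a i : ℕ) (x : ℝ) (b j : ℕ) :
    (s.setReal a i x).real b j = if b = a ∧ j = i then x else s.real b j := rfl

theorem State.nat_setReal (s : State) (a i : ℕ) (x : ℝ) : (s.setReal a i x).nat = s.nat := rfl

theorem State.out_setReal (s : State) (a i : ℕ) (x : ℝ) : (s.setReal a i x).out = s.out := rfl

namespace Exec

variable {v : View} {p : Cmd} {s s' : State} {t : ℕ}

theorem nat_eq (h : Exec v p s s' t) {a : ℕ} (ha : a ∉ p.natTargets) : s'.nat a = s.nat a := by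
  induction h with
  | nstore b i e s =>
    funext j
    simp only [Cmd.natTargets, List.mem_singleton] at ha
    simp [State.nat_setNat, ha]
  | seq _ _ ih ih' =>
    simp only [Cmd.natTargets, List.mem_append, not_or] at ha
    rw [ih' ha.2, ih ha.1]
  | iteTrue _ _ _ ih =>
    simp only [Cmd.natTargets, List.mem_append, not_or] at ha
    exact ih ha.1
  | iteFalse _ _ _ ih =>
    simp only [Cmd.natTargets, List.mem_append, not_or] at ha
    exact ih ha.2
  | loopTrue _ _ _ ih ih' => rw [ih' ha, ih ha]
  | _ => rfl

theorem real_eq (h : Exec v p s s' t) {a : ℕ} (ha : a ∉ p.realTargets) :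
    s'.real a = s.real a := by
  induction h with
  | rstore b i e s =>
    funext j
    simp only [Cmd.realTargets, List.mem_singleton] at ha
    simp [State.real_setReal, ha]
  | seq _ _ ih ih' =>
    simp only [Cmd.realTargets, List.mem_append, not_or] at ha
    rw [ih' ha.2, ih ha.1]
  | iteTrue _ _ _ ih =>
    simp only [Cmd.realTargets, List.mem_append, not_or] at ha
    exact ih ha.1
  | iteFalse _ _ _ ih =>
    simp only [Cmd.realTargets, List.mem_append, not_or] at ha
    exact ih ha.2
  | loopTrue _ _ _ ih ih' => rw [ih' ha, ih ha]
  | _ => rfl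

theorem out_eq (h : Exec v p s s' t) (hp : p.computes) : s'.out = s.out := by
  induction h with
  | launch | setAlarm => simp [Cmd.computes] at hp
  | seq _ _ ih ih' =>
    simp only [Cmd.computes, Bool.and_eq_true] at hp
    rw [ih' hp.2, ih hp.1]
  | iteTrue _ _ _ ih =>
    simp only [Cmd.computes, Bool.and_eq_true] at hp
    exact ih hp.1
  | iteFalse _ _ _ ih =>
    simp only [Cmd.computes, Bool.and_eq_true] at hp
    exact ih hp.2
  | loopTrue _ _ _ ih ih' => rw [ih' hp, ih hp]
  | _ => rfl

end Exec

/-- The scalar variable stored in cell `0` of array `a`. -/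
abbrev NExp.var (a : ℕ) : NExp := .load a (.const 0)

/-- The scalar variable stored in cell `0` of array `a`. -/
abbrev RExp.var (a : ℕ) : RExp := .load a (.const 0)

/-- Assignment to a scalar variable. -/
abbrev Cmd.set (a : ℕ) (e : NExp) : Cmd := .nstore a (.const 0) e

/-- Assignment to a scalar variable. -/
abbrev Cmd.rset (a : ℕ) (e : RExp) : Cmd := .rstore a (.const 0) e

/-- `x < y`. -/
abbrev BExp.nlt (x y : NExp) : BExp := .not (.nle y x)

/-! ### The tournament tree of pending jobs. -/

/-- `x` is the number, increased by one, of a job of `P` in `[lo, hi)` that is due first, or `0`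
if there is no such job. -/
def FirstDue (due : ℕ → ℕ) (P : Finset ℕ) (lo hi x : ℕ) : Prop :=
  (x = 0 ∧ ∀ q ∈ P, lo ≤ q → ¬ q < hi) ∨
    ∃ q ∈ P, x = q + 1 ∧ lo ≤ q ∧ q < hi ∧ ∀ q' ∈ P, lo ≤ q' → q' < hi → due q ≤ due q'

theorem FirstDue.left {due : ℕ → ℕ} {P : Finset ℕ} {lo mid hi x y : ℕ}
    (hx : FirstDue due P lo mid x) (hy : FirstDue due P mid hi y) (h₂ : mid ≤ hi)
    (h0 : x ≠ 0) (hle : y ≠ 0 → due (x - 1) ≤ due (y - 1)) : FirstDue due P lo hi x := by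
  rcases hx with ⟨hx, -⟩ | ⟨q, hq, rfl, hl, hh, hm⟩
  · exact absurd hx h0
  · refine Or.inr ⟨q, hq, rfl, hl, by omega, fun q' hq' hl' hh' => ?_⟩
    rcases Nat.lt_or_ge q' mid with h | h
    · exact hm q' hq' hl' h
    · rcases hy with ⟨-, hy⟩ | ⟨r, hr, rfl, -, -, hm'⟩
      · exact absurd hh' (hy q' hq' h)
      · have := hle (by omega)
        simp only [Nat.add_sub_cancel] at this
        exact this.trans (hm' q' hq' h hh')

theorem FirstDue.right {due : ℕ → ℕ} {P : Finset ℕ} {lo mid hi x y : ℕ}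
    (hx : FirstDue due P lo mid x) (hy : FirstDue due P mid hi y) (h₁ : lo ≤ mid)
    (hle : x ≠ 0 → y ≠ 0 ∧ due (y - 1) ≤ due (x - 1)) : FirstDue due P lo hi y := by
  rcases hy with ⟨hy0, hy⟩ | ⟨r, hr, rfl, hl, hh, hm⟩
  · rcases hx with ⟨-, hx⟩ | ⟨q, hq, rfl, hl, hh, hm⟩
    · refine Or.inl ⟨hy0, fun q hq hlo hhi => ?_⟩
      rcases Nat.lt_or_ge q mid with h | h
      · exact hx q hq hlo h
      · exact hy q hq h hhi
    · exact absurd hy0 (hle (by omega)).1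
  · refine Or.inr ⟨r, hr, rfl, by omega, hh, fun q' hq' hl' hh' => ?_⟩
    rcases Nat.lt_or_ge q' mid with h | h
    · rcases hx with ⟨-, hx⟩ | ⟨q, hq, rfl, -, -, hm'⟩
      · exact absurd h (hx q' hq' hl')
      · have := (hle (by omega)).2
        simp only [Nat.add_sub_cancel] at this
        exact this.trans (hm' q' hq' hl' h)
    · exact hm q' hq' h hh'

theorem FirstDue.congr {due due' : ℕ → ℕ} {P P' : Finset ℕ} {lo hi x : ℕ}
    (h : FirstDue due P lo hi x) (hP : ∀ q, lo ≤ q → q < hi → (q ∈ P ↔ q ∈ P'))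
    (hd : ∀ q ∈ P, due q = due' q) : FirstDue due' P' lo hi x := by
  rcases h with ⟨h0, h⟩ | ⟨q, hq, rfl, hl, hh, hm⟩
  · exact Or.inl ⟨h0, fun q hq hl hh => h q ((hP q hl hh).2 hq) hl hh⟩
  · refine Or.inr ⟨q, (hP q hl hh).1 hq, rfl, hl, hh, fun q' hq' hl' hh' => ?_⟩
    have hq'P := (hP q' hl' hh').2 hq'
    rw [← hd q hq, ← hd q' hq'P]
    exact hm q' hq'P hl' hh'

/-- The cell of the `i`-th node of height `l` in an infinite binary tree in symmetric order. -/
def cell (l i : ℕ) : ℕ := (2 * i + 1) * 2 ^ l - 1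

theorem cell_zero (i : ℕ) : cell 0 i = i + i := by simp [cell]; omega

/-- The height is the exponent of `2` in the cell number plus one. Distinct nodes thus occupy
distinct cells, so a write affects one node only. As cells do not depend on the size of the tree,
doubling the tree moves nothing. -/
theorem cell_injective {l i l' i' : ℕ} (h : cell l i = cell l' i') : l = l' ∧ i = i' := by
  have key : ∀ l l' i i' : ℕ, (2 * i + 1) * 2 ^ l = (2 * i' + 1) * 2 ^ l' → l ≤ l' := by
    intro l l' i i' h
    by_contra hlt
    push Not at hlt
    obtain ⟨d, rfl⟩ := Nat.exists_eq_add_of_lt hlt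
    rw [pow_succ, pow_add] at h
    have h' : 2 ^ l' * ((2 * i + 1) * 2 ^ d * 2) = 2 ^ l' * (2 * i' + 1) := by
      rw [mul_comm (2 ^ l') (2 * i' + 1), ← h]; ring
    have := Nat.eq_of_mul_eq_mul_left (by positivity) h'
    omega
  have h1 : 0 < (2 * i + 1) * 2 ^ l := by positivity
  have h2 : 0 < (2 * i' + 1) * 2 ^ l' := by positivity
  have h' : (2 * i + 1) * 2 ^ l = (2 * i' + 1) * 2 ^ l' := by unfold cell at h; omega
  obtain rfl : l = l' := le_antisymm (key _ _ _ _ h') (key _ _ _ _ h'.symm)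
  have := Nat.eq_of_mul_eq_mul_right (by positivity) h'
  exact ⟨rfl, by omega⟩

theorem cell_left (l i : ℕ) : cell (l + 1) i - 2 ^ l = cell l (2 * i) := by
  have h : (2 * i + 1) * 2 ^ (l + 1) = (2 * (2 * i) + 1) * 2 ^ l + 2 ^ l := by ring
  rw [cell, cell, h, Nat.sub_right_comm, Nat.add_sub_cancel]

theorem cell_up_left (l i : ℕ) : cell l (2 * i) + 2 ^ l = cell (l + 1) i := by
  have h : (2 * i + 1) * 2 ^ (l + 1) = (2 * (2 * i) + 1) * 2 ^ l + 2 ^ l := by ring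
  have h' : 1 ≤ (2 * (2 * i) + 1) * 2 ^ l := Nat.one_le_iff_ne_zero.2 (by positivity)
  rw [cell, cell, h, Nat.sub_add_comm h']

theorem cell_right (l i : ℕ) : cell (l + 1) i + 2 ^ l = cell l (2 * i + 1) := by
  have h : (2 * (2 * i + 1) + 1) * 2 ^ l = (2 * i + 1) * 2 ^ (l + 1) + 2 ^ l := by ring
  have h' : 1 ≤ (2 * i + 1) * 2 ^ (l + 1) := Nat.one_le_iff_ne_zero.2 (by positivity)
  rw [cell, cell, h, Nat.sub_add_comm h']

theorem cell_up_right (l i : ℕ) : cell l (2 * i + 1) - 2 ^ l = cell (l + 1) i := by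
  rw [← cell_right, Nat.add_sub_cancel]

/-- The contents of the tree on the jobs below `2 ^ m`. -/
def TreeOK (due : ℕ → ℕ) (P : Finset ℕ) (m : ℕ) (T : ℕ → ℕ) : Prop :=
  ∀ l i, l ≤ m ∨ 1 ≤ i → FirstDue due P (i * 2 ^ l) ((i + 1) * 2 ^ l) (T (cell l i))

/-- Test whether the candidate `x` is to be replaced by the candidate `y`. -/
def BExp.better (x y : NExp) : BExp :=
  .not (.and (.not (.nle x (.const 0))) (.not (.and (.not (.nle y (.const 0)))
    (.nle (.deadline (.sub y (.const 1))) (.deadline (.sub x (.const 1)))))))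

theorem BExp.eval_better {v : View} {s : State} {x y : NExp} : (BExp.better x y).eval v s ↔
    (x.eval v s ≠ 0 → y.eval v s ≠ 0 ∧
      v.deadline (y.eval v s - 1) ≤ v.deadline (x.eval v s - 1)) := by
  simp only [better, eval, NExp.eval, Nat.le_zero]
  tauto

/-! Arrays of natural numbers: `0` tree, `1` number of leaves, `2` number of jobs seen, `3` number
of jobs seen at the latest launch, `4` number of cohorts, `5` start and `6` next rank of the
cohorts, `7` number of types seen, `8` best type up to each type, `9` largest type within budget,
`10` type of each rank, `11` number of ranks with a type, `12` batch; the others hold temporary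
values. Arrays of real numbers: `0` budget of each rank; the others hold temporary values. -/

namespace Prog

open NExp Cmd

/-- Recompute the tree above leaf number `13`. -/
def refresh : Cmd :=
  .seq (set 14 (const 1)) <| .seq (set 15 (add (var 13) (var 13))) <|
  .loop (.nlt (var 14) (var 1)) <|
    .seq (.ite (.nle (var 13) (add (half (var 13)) (half (var 13))))
      (set 15 (add (var 15) (var 14))) (set 15 (sub (var 15) (var 14)))) <|
    .seq (set 13 (half (var 13))) <|
    .seq (.ite (.better (load 0 (sub (var 15) (var 14))) (load 0 (add (var 15) (var 14))))
      (nstore 0 (var 15) (load 0 (add (var 15) (var 14))))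
      (nstore 0 (var 15) (load 0 (sub (var 15) (var 14))))) <|
    set 14 (add (var 14) (var 14))

/-- Find a pending job from job number `19` on that is due first. -/
def query : Cmd :=
  .seq (set 16 (load 0 (add (var 19) (var 19)))) <|
  .seq (set 13 (var 19)) <|
  .seq (set 14 (const 1)) <| .seq (set 15 (add (var 13) (var 13))) <|
  .loop (.nlt (var 14) (var 1)) <|
    .seq (.ite (.nle (var 13) (add (half (var 13)) (half (var 13))))
      (.seq (.ite (.better (var 16) (load 0 (add (var 15) (add (var 14) (var 14)))))
        (set 16 (load 0 (add (var 15) (add (var 14) (var 14))))) .skip)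
        (set 15 (add (var 15) (var 14))))
      (set 15 (sub (var 15) (var 14)))) <|
    .seq (set 13 (half (var 13))) <|
    set 14 (add (var 14) (var 14))

end Prog

section Tree

variable {v : View} {s : State} {P : Finset ℕ} {m j : ℕ}

theorem pow_lt_pow_iff_two {l m : ℕ} : 2 ^ l < 2 ^ m ↔ l < m :=
  Nat.pow_lt_pow_iff_right (by norm_num)

theorem FirstDue.node_left {due : ℕ → ℕ} {l i x y : ℕ}
    (hx : FirstDue due P (2 * i * 2 ^ l) ((2 * i + 1) * 2 ^ l) x)
    (hy : FirstDue due P ((2 * i + 1) * 2 ^ l) ((2 * i + 1 + 1) * 2 ^ l) y)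
    (h0 : x ≠ 0) (hle : y ≠ 0 → due (x - 1) ≤ due (y - 1)) :
    FirstDue due P (i * 2 ^ (l + 1)) ((i + 1) * 2 ^ (l + 1)) x := by
  have h1 : i * 2 ^ (l + 1) = 2 * i * 2 ^ l := by ring
  have h2 : (i + 1) * 2 ^ (l + 1) = (2 * i + 1 + 1) * 2 ^ l := by ring
  rw [h1, h2]
  exact hx.left hy (Nat.mul_le_mul_right _ (by omega)) h0 hle

theorem FirstDue.node_right {due : ℕ → ℕ} {l i x y : ℕ}
    (hx : FirstDue due P (2 * i * 2 ^ l) ((2 * i + 1) * 2 ^ l) x)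
    (hy : FirstDue due P ((2 * i + 1) * 2 ^ l) ((2 * i + 1 + 1) * 2 ^ l) y)
    (hle : x ≠ 0 → y ≠ 0 ∧ due (y - 1) ≤ due (x - 1)) :
    FirstDue due P (i * 2 ^ (l + 1)) ((i + 1) * 2 ^ (l + 1)) y := by
  have h1 : i * 2 ^ (l + 1) = 2 * i * 2 ^ l := by ring
  have h2 : (i + 1) * 2 ^ (l + 1) = (2 * i + 1 + 1) * 2 ^ l := by ring
  rw [h1, h2]
  exact hx.right hy (Nat.mul_le_mul_right _ (by omega)) hle

/-- Initially every node may be trusted except the proper ancestors of leaf `j`; the loop repairs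
these from the bottom up, using that parents and children of height `l` differ by `2 ^ l` cells.
Each level takes seven steps. -/
theorem Prog.refresh_meets (hW : s.nat 1 0 = 2 ^ m) (hi : s.nat 13 0 = j) (hj : j < 2 ^ m)
    (hT : ∀ l i, l ≤ m ∨ 1 ≤ i → l = 0 ∨ i ≠ j / 2 ^ l →
      FirstDue v.deadline P (i * 2 ^ l) ((i + 1) * 2 ^ l) (s.nat 0 (cell l i))) :
    refresh.Meets v s fun s' t => TreeOK v.deadline P m (s'.nat 0) ∧ t ≤ 7 * m + 3 := by
  unfold refresh
  simp only [Cmd.meets_seq, Cmd.meets_nstore]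
  refine (Cmd.Meets.loop (fun s φ => ∃ l ≤ m, s.nat 1 0 = 2 ^ m ∧ s.nat 13 0 = j / 2 ^ l ∧
    s.nat 14 0 = 2 ^ l ∧ s.nat 15 0 = cell l (j / 2 ^ l) ∧ φ = 7 * (m - l) ∧
    ∀ l' i, l' ≤ m ∨ 1 ≤ i → l' ≤ l ∨ i ≠ j / 2 ^ l' →
      FirstDue v.deadline P (i * 2 ^ l') ((i + 1) * 2 ^ l') (s.nat 0 (cell l' i))) ?_
    (φ := 7 * m) ?_).imp ?_
  · rintro s φ ⟨l, hlm, h1, h13, h14, h15, rfl, hT⟩ hb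
    simp only [BExp.eval, NExp.eval, h1, h14, not_le, pow_lt_pow_iff_two] at hb
    obtain ⟨i, hi⟩ : ∃ i, j / 2 ^ (l + 1) = i := ⟨_, rfl⟩
    have hhalf : j / 2 ^ l / 2 = i := by rw [← hi, pow_succ, Nat.div_div_eq_div_mul]
    have hleft := hT l (2 * i) (Or.inl hlm) (Or.inl le_rfl)
    have hright := hT l (2 * i + 1) (Or.inl hlm) (Or.inl le_rfl)
    have hw : 2 ^ l + 2 ^ l = 2 ^ (l + 1) := by ring
    have hstore : ∀ x, FirstDue v.deadline P (i * 2 ^ (l + 1)) ((i + 1) * 2 ^ (l + 1)) x →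
        ∀ l' i', l' ≤ m ∨ 1 ≤ i' → l' ≤ l + 1 ∨ i' ≠ j / 2 ^ l' →
          FirstDue v.deadline P (i' * 2 ^ l') ((i' + 1) * 2 ^ l')
            (if cell l' i' = cell (l + 1) i then x else s.nat 0 (cell l' i')) := by
      intro x hx l' i' h₁ h₂
      split_ifs with hc
      · obtain ⟨rfl, rfl⟩ := cell_injective hc
        exact hx
      · refine hT l' i' h₁ ?_
        by_cases hi' : i' = j / 2 ^ l'
        · rcases h₂ with h₂ | h₂
          · rcases Nat.lt_or_ge l' (l + 1) with h | h
            · omega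
            · obtain rfl : l' = l + 1 := by omega
              exact absurd (by rw [hi', hi]) hc
          · exact absurd hi' h₂
        · exact Or.inr hi'
    refine Cmd.Meets.seq (R := fun s₁ t₁ => t₁ = 2 ∧ s₁.nat 15 0 = cell (l + 1) i) ?_ ?_
    · simp only [Cmd.meets_ite, Cmd.meets_nstore, BExp.eval, NExp.eval, h13, h14, h15, hhalf,
        State.nat_setNat_self, if_true, true_and]
      constructor
      · intro he
        obtain he : j / 2 ^ l = 2 * i := by omega
        rw [he, cell_up_left]
      · intro he
        obtain he : j / 2 ^ l = 2 * i + 1 := by omega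
        rw [he, cell_up_right]
    · rintro s₁ t₁ hx ⟨rfl, g15⟩
      have g0 := hx.nat_eq (a := 0) (by decide)
      rw [← hx.nat_eq (a := 1) (by decide)] at h1
      rw [← hx.nat_eq (a := 13) (by decide)] at h13
      rw [← hx.nat_eq (a := 14) (by decide)] at h14
      simp only [Cmd.meets_seq, Cmd.meets_nstore, Cmd.meets_ite, BExp.eval_better, NExp.eval,
        State.nat_setNat_self, State.nat_setNat_ne, ne_eq, Nat.reduceEqDiff,
        not_false_eq_true, OfNat.zero_ne_ofNat, OfNat.one_ne_ofNat, OfNat.ofNat_ne_zero,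
        if_true, h1, h13, h14, g15, g0, hhalf, cell_left, cell_right, hw]
      refine ⟨fun hbt => ?_, fun hbt => ?_⟩
      · refine ⟨_, ⟨l + 1, hb, trivial, hi.symm, rfl, by rw [hi], rfl, ?_⟩, by omega⟩
        exact hstore _ (hleft.node_right hright hbt)
      · push Not at hbt
        refine ⟨_, ⟨l + 1, hb, trivial, hi.symm, rfl, by rw [hi], rfl, ?_⟩, by omega⟩
        exact hstore _ (hleft.node_left hright hbt.1 fun h => (hbt.2 h).le)
  · refine ⟨0, Nat.zero_le _, ?_⟩
    simp [State.nat_setNat_self, State.nat_setNat_ne, NExp.eval, hW, hi, cell_zero]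
    intro l' i' h₁ h₂
    exact hT l' i' h₁ h₂
  · rintro s' t - ⟨φ, ⟨l, hlm, h1, -, h14, -, rfl, hT⟩, hb, ht⟩
    simp only [BExp.eval, NExp.eval, h1, h14, not_le, pow_lt_pow_iff_two] at hb
    obtain rfl : l = m := by omega
    refine ⟨fun l' i' h => hT l' i' h ?_, by omega⟩
    rcases Nat.lt_or_ge l l' with hl | hl
    · right
      -- Above height `m` the node over leaf `j` has index `0`, and `TreeOK` claims nothing about
      -- it.
      have : j / 2 ^ l' = 0 :=
        Nat.div_eq_of_lt (hj.trans (Nat.pow_lt_pow_right (by norm_num) hl))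
      omega
    · exact Or.inl hl

/-- On the way up from leaf `j`, the answer covers the jobs from `j` to the end of the current
subtree. It is compared with the right sibling whenever the path comes from a left child. -/
theorem Prog.query_meets (hW : s.nat 1 0 = 2 ^ m) (hi : s.nat 19 0 = j) (hj : j < 2 ^ m)
    (hT : TreeOK v.deadline P m (s.nat 0)) :
    query.Meets v s fun s' t => FirstDue v.deadline P j (2 ^ m) (s'.nat 16 0) ∧
      t ≤ 7 * m + 5 := by
  unfold query
  simp only [Cmd.meets_seq, Cmd.meets_nstore]
  refine (Cmd.Meets.loop (fun s φ => ∃ l ≤ m, s.nat 1 0 = 2 ^ m ∧ s.nat 13 0 = j / 2 ^ l ∧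
    s.nat 14 0 = 2 ^ l ∧ s.nat 15 0 = cell l (j / 2 ^ l) ∧ φ = 7 * (m - l) ∧
    TreeOK v.deadline P m (s.nat 0) ∧
    FirstDue v.deadline P j ((j / 2 ^ l + 1) * 2 ^ l) (s.nat 16 0)) ?_
    (φ := 7 * m) ?_).imp ?_
  · rintro s φ ⟨l, hlm, h1, h13, h14, h15, rfl, hT, hq⟩ hb
    simp only [BExp.eval, NExp.eval, h1, h14, not_le, pow_lt_pow_iff_two] at hb
    obtain ⟨i, hi⟩ : ∃ i, j / 2 ^ (l + 1) = i := ⟨_, rfl⟩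
    have hhalf : j / 2 ^ l / 2 = i := by rw [← hi, pow_succ, Nat.div_div_eq_div_mul]
    have hright := hT l (2 * i + 1) (Or.inl hlm)
    have hw : 2 ^ l + 2 ^ l = 2 ^ (l + 1) := by ring
    have hji : j / 2 ^ l * 2 ^ l ≤ j := Nat.div_mul_le_self _ _
    have hji' : j < (j / 2 ^ l + 1) * 2 ^ l := Nat.lt_mul_of_div_lt (by omega) (by positivity)
    have hend : (2 * i + 1 + 1) * 2 ^ l = (i + 1) * 2 ^ (l + 1) := by ring
    have hcell : cell l (2 * i) + 2 ^ (l + 1) = cell l (2 * i + 1) := by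
      rw [← cell_right, ← cell_up_left]; omega
    refine Cmd.Meets.seq (R := fun s₁ t₁ => t₁ ≤ 4 ∧ s₁.nat 15 0 = cell (l + 1) i ∧
      FirstDue v.deadline P j ((i + 1) * 2 ^ (l + 1)) (s₁.nat 16 0)) ?_ ?_
    · simp only [Cmd.meets_ite, Cmd.meets_nstore, Cmd.meets_seq, Cmd.meets_skip, BExp.eval_better]
      simp only [BExp.eval, NExp.eval, h13, h14, h15, hhalf,
        State.nat_setNat_self, State.nat_setNat_ne, ne_eq, Nat.reduceEqDiff,
        not_false_eq_true, if_true, hw]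
      constructor
      · intro he
        obtain he : j / 2 ^ l = 2 * i := by omega
        rw [he] at hq hji' ⊢
        rw [cell_up_left, hcell]
        refine ⟨fun hbt => ⟨by omega, rfl, ?_⟩, fun hbt => ⟨by omega, rfl, ?_⟩⟩
        · rw [← hend]; exact hq.right hright hji'.le hbt
        · push Not at hbt
          rw [← hend]
          exact hq.left hright (Nat.mul_le_mul_right _ (by omega)) hbt.1 fun h => (hbt.2 h).le
      · intro he
        obtain he : j / 2 ^ l = 2 * i + 1 := by omega
        rw [he] at hq ⊢
        rw [cell_up_right]
        exact ⟨by omega, rfl, hend ▸ hq⟩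
    · rintro s₁ t₁ hx ⟨ht, g15, gq⟩
      rw [← hx.nat_eq (a := 0) (by decide)] at hT
      rw [← hx.nat_eq (a := 1) (by decide)] at h1
      rw [← hx.nat_eq (a := 13) (by decide)] at h13
      rw [← hx.nat_eq (a := 14) (by decide)] at h14
      simp only [Cmd.meets_seq, Cmd.meets_nstore, NExp.eval,
        State.nat_setNat_self, State.nat_setNat_ne, ne_eq, Nat.reduceEqDiff,
        not_false_eq_true, OfNat.zero_ne_ofNat, OfNat.one_ne_ofNat,
        if_true, h1, h13, h14, g15, hhalf, hw]
      refine ⟨_, ⟨l + 1, hb, trivial, hi.symm, rfl, by rw [hi], rfl, hT, ?_⟩, by omega⟩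
      rw [hi]; exact gq
  · refine ⟨0, Nat.zero_le _, ?_⟩
    simp [State.nat_setNat_self, State.nat_setNat_ne, NExp.eval, hW, hi, cell_zero]
    have := hT 0 j (Or.inl (Nat.zero_le _))
    exact ⟨hT, by simpa [cell_zero] using this⟩
  · rintro s' t - ⟨φ, ⟨l, hlm, h1, -, h14, -, rfl, hT, hq⟩, hb, ht⟩
    simp only [BExp.eval, NExp.eval, h1, h14, not_le, pow_lt_pow_iff_two] at hb
    obtain rfl : l = m := by omega
    rw [Nat.div_eq_of_lt hj] at hq
    exact ⟨by simpa using hq, by omega⟩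

end Tree

namespace Prog

open NExp Cmd

/-- Write `x` to leaf number `13` of the tree. -/
def setLeaf (x : NExp) : Cmd :=
  .seq (nstore 0 (add (var 13) (var 13)) x) refresh

/-- Move up to `cap 21` pending jobs from job number `19` on, those due first, to the batch. -/
def extract : Cmd :=
  .seq (set 17 (const 0)) <| .seq query <|
  .loop (.and (.nlt (var 17) (cap (var 21))) (.nle (const 1) (var 16))) <|
    .seq (nstore 12 (var 17) (sub (var 16) (const 1))) <|
    .seq (set 17 (add (var 17) (const 1))) <|
    .seq (set 13 (sub (var 16) (const 1))) <|
    .seq (setLeaf (const 0)) query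

/-- Insert the jobs that have arrived into the tree. -/
def arrive : Cmd :=
  .loop (.nlt (var 2) arrived) <|
    .seq (.ite (.nle (var 1) (var 2))
      (.ite (.nle (const 1) (var 1)) (set 1 (add (var 1) (var 1))) (set 1 (const 1))) .skip) <|
    .seq (set 13 (var 2)) <|
    .seq (set 2 (add (var 2) (const 1))) <|
    setLeaf (add (var 13) (const 1))

end Prog

section Leaf

variable {v : View} {s : State} {P P' : Finset ℕ} {m j x : ℕ}

theorem Prog.setLeaf_meets {e : NExp} (hW : s.nat 1 0 = 2 ^ m) (hi : s.nat 13 0 = j)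
    (hj : j < 2 ^ m) (hx : FirstDue v.deadline P' j (j + 1) (e.eval v s))
    (hP : ∀ q, q ≠ j → (q ∈ P ↔ q ∈ P'))
    (hT : ∀ l i, l ≤ m ∨ 1 ≤ i → i ≠ j / 2 ^ l →
      FirstDue v.deadline P (i * 2 ^ l) ((i + 1) * 2 ^ l) (s.nat 0 (cell l i))) :
    (setLeaf e).Meets v s fun s' t => TreeOK v.deadline P' m (s'.nat 0) ∧ t ≤ 7 * m + 4 := by
  unfold setLeaf
  simp only [Cmd.meets_seq, Cmd.meets_nstore, NExp.eval, hi]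
  refine (Prog.refresh_meets (m := m) (j := j) (P := P') ?_ ?_ hj ?_).imp ?_
  · simpa [State.nat_setNat_ne] using hW
  · simpa [State.nat_setNat_ne] using hi
  · intro l i h₁ h₂
    rw [State.nat_setNat_self, ← cell_zero]
    split_ifs with hc
    · obtain ⟨rfl, rfl⟩ := cell_injective hc
      simpa using hx
    · have hne : i ≠ j / 2 ^ l := by
        rcases h₂ with rfl | h₂
        · rintro rfl
          simp at hc
        · exact h₂
      refine (hT l i h₁ hne).congr (fun q hl hh => hP q ?_) fun _ _ => rfl
      rintro rfl
      refine hne (Nat.div_eq_of_lt_le ?_ ?_).symm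
      · exact hl
      · exact hh
  · rintro s' t - ⟨h, ht⟩
    exact ⟨h, by omega⟩

/-- What `Prog.extract` achieves. -/
structure Extracted (due : ℕ → ℕ) (P : Finset ℕ) (st c : ℕ) (J : List ℕ) : Prop where
  nodup : J.Nodup
  mem : ∀ x ∈ J, x ∈ P ∧ st ≤ x
  length_le : J.length ≤ c
  due_le : ∀ x ∈ J, ∀ q ∈ P \ J.toFinset, st ≤ q → due x ≤ due q

theorem Extracted.length_le_card {due : ℕ → ℕ} {st c : ℕ} {J : List ℕ}
    (h : Extracted due P st c J) : J.length ≤ P.card := by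
  rw [← List.toFinset_card_of_nodup h.nodup]
  exact Finset.card_le_card fun x hx => (h.mem x (by simpa using hx)).1

theorem Prog.extract_meets {st k : ℕ} (hW : s.nat 1 0 = 2 ^ m) (hst : s.nat 19 0 = st)
    (hst' : st < 2 ^ m) (hk : s.nat 21 0 = k) (hP : ∀ q ∈ P, q < 2 ^ m)
    (hT : TreeOK v.deadline P m (s.nat 0)) :
    extract.Meets v s fun s' t => ∃ J, Extracted v.deadline P st (v.cap k) J ∧
      s'.nat 17 0 = J.length ∧ (List.range J.length).map (s'.nat 12) = J ∧
      TreeOK v.deadline (P \ J.toFinset) m (s'.nat 0) ∧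
      (J.length = v.cap k ∨ ∀ q ∈ P \ J.toFinset, ¬ st ≤ q) ∧
      t ≤ (14 * m + 13) * J.length + 7 * m + 8 := by
  unfold extract
  simp only [Cmd.meets_seq (p := Cmd.set _ _), Cmd.meets_nstore, NExp.eval]
  refine (Prog.query_meets (m := m) (j := st) (P := P) ?_ ?_ hst' ?_).seq ?_
  · simpa [State.nat_setNat_ne] using hW
  · simpa [State.nat_setNat_ne] using hst
  · simpa [State.nat_setNat_ne] using hT
  rintro s₁ t₁ hx ⟨hq, ht₁⟩
  have g0 := hx.nat_eq (a := 0) (by decide)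
  have g1 := hx.nat_eq (a := 1) (by decide)
  have g17 := hx.nat_eq (a := 17) (by decide)
  have g19 := hx.nat_eq (a := 19) (by decide)
  have g21 := hx.nat_eq (a := 21) (by decide)
  rw [State.nat_setNat_ne _ _ _ _ (by decide)] at g0 g1 g19 g21
  -- A round costs `14 * m + 13`: one tree update, one query, three stores and the test. The
  -- potential `φ` counts the rounds still possible, one per job outside `J`.
  refine (Cmd.Meets.loop (fun s φ => ∃ J, Extracted v.deadline P st (v.cap k) J ∧
    s.nat 1 0 = 2 ^ m ∧ s.nat 19 0 = st ∧ s.nat 21 0 = k ∧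
      s.nat 17 0 = J.length ∧ (List.range J.length).map (s.nat 12) = J ∧
      TreeOK v.deadline (P \ J.toFinset) m (s.nat 0) ∧
      FirstDue v.deadline (P \ J.toFinset) st (2 ^ m) (s.nat 16 0) ∧
      φ + (14 * m + 13) * J.length = (14 * m + 13) * P.card) ?_
      (φ := (14 * m + 13) * P.card) ?_).imp ?_
  · rintro s φ ⟨J, hJ, h1, h19, h21, h17, h12, hT, hq, hφ⟩ hb
    simp only [BExp.eval, NExp.eval, h17, h21, not_le] at hb
    obtain ⟨hlt, hb⟩ := hb
    rcases hq with ⟨h0, -⟩ | ⟨q, hqP, hq, hstq, hqm, hmin⟩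
    · omega
    simp only [Cmd.meets_seq (p := Cmd.nstore _ _ _), Cmd.meets_nstore, NExp.eval]
    simp only [State.nat_setNat_ne, ne_eq, Nat.reduceEqDiff,
        not_false_eq_true, h17, hq, Nat.add_sub_cancel]
    have hqJ : q ∈ P ∧ q ∉ J := by simpa using hqP
    have hJ' : Extracted v.deadline P st (v.cap k) (J ++ [q]) := by
      refine ⟨?_, ?_, by simpa using hlt, ?_⟩
      · exact List.nodup_append.2 ⟨hJ.nodup, by simp, by
          intro a ha b hb; simp at hb; rintro rfl; subst hb; exact hqJ.2 ha⟩
      · intro x hx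
        rcases List.mem_append.1 hx with hx | hx
        · exact hJ.mem x hx
        · obtain rfl := List.mem_singleton.1 hx
          exact ⟨hqJ.1, hstq⟩
      · intro x hx r hr hsr
        have hr' : r ∈ P \ J.toFinset := by
          simp only [List.toFinset_append, Finset.mem_sdiff, Finset.mem_union, not_or] at hr ⊢
          exact ⟨hr.1, hr.2.1⟩
        rcases List.mem_append.1 hx with hx | hx
        · exact hJ.due_le x hx r hr' hsr
        · obtain rfl := List.mem_singleton.1 hx
          exact hmin r hr' hsr (hP r (Finset.mem_sdiff.1 hr').1)
    have hcard := hJ'.length_le_card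
    refine (Prog.setLeaf_meets (m := m) (j := q) (P := P \ J.toFinset)
      (P' := P \ (J ++ [q]).toFinset) ?_ ?_ hqm ?_ ?_ ?_).seq ?_
    · simpa [State.nat_setNat_ne] using h1
    · simp [State.nat_setNat_self]
    · refine Or.inl ⟨rfl, fun r hr hqr hrq => ?_⟩
      obtain rfl : r = q := by omega
      simp at hr
    · intro r hr
      simp [hr]
    · intro l i hl _
      simpa [State.nat_setNat_ne] using hT l i hl
    · rintro s₂ t₂ hx₂ ⟨hT₂, ht₂⟩
      have e1 := hx₂.nat_eq (a := 1) (by decide)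
      have e12 := hx₂.nat_eq (a := 12) (by decide)
      have e17 := hx₂.nat_eq (a := 17) (by decide)
      have e19 := hx₂.nat_eq (a := 19) (by decide)
      have e21 := hx₂.nat_eq (a := 21) (by decide)
      simp only [State.nat_setNat_ne, ne_eq, Nat.reduceEqDiff, OfNat.one_ne_ofNat,
        not_false_eq_true] at e1 e12 e17 e19 e21
      refine (Prog.query_meets (m := m) (j := st) (by rw [e1, h1]) (by rw [e19, h19]) hst'
        hT₂).imp ?_
      rintro s₃ t₃ hx₃ ⟨hq₃, ht₃⟩
      have d0 := hx₃.nat_eq (a := 0) (by decide)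
      have d1 := hx₃.nat_eq (a := 1) (by decide)
      have d12 := hx₃.nat_eq (a := 12) (by decide)
      have d17 := hx₃.nat_eq (a := 17) (by decide)
      have d19 := hx₃.nat_eq (a := 19) (by decide)
      have d21 := hx₃.nat_eq (a := 21) (by decide)
      have hlen : (J ++ [q]).length = J.length + 1 := by simp
      have hmul : (14 * m + 13) * (J.length + 1) ≤ (14 * m + 13) * P.card :=
        Nat.mul_le_mul_left _ (by simpa using hcard)
      have hexp : (14 * m + 13) * (J.length + 1) = (14 * m + 13) * J.length + (14 * m + 13) := by
        ring
      refine ⟨φ - (14 * m + 13), ⟨J ++ [q], hJ', by rw [d1, e1, h1], by rw [d19, e19, h19],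
        by rw [d21, e21, h21], ?_, ?_, by rw [d0]; exact hT₂, hq₃, ?_⟩, ?_⟩
      · rw [d17, e17, hlen]; simp [State.nat_setNat_self]
      · rw [d12, e12, hlen, List.range_succ, List.map_append]
        congr 1
        · conv_rhs => rw [← h12]
          refine List.map_congr_left fun i hi => ?_
          have : i < J.length := by simpa using hi
          simp [State.nat_setNat_self, this.ne]
        · simp [State.nat_setNat_self]
      · rw [hlen, hexp]; omega
      · omega
  · refine ⟨[], ⟨by simp, by simp, by simp, by simp⟩, by rw [g1, hW], by rw [g19, hst],
      by rw [g21, hk], ?_, by simp, ?_, ?_, by simp⟩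
    · rw [g17]; simp [State.nat_setNat_self]
    · rw [g0]; simpa using hT
    · simpa using hq
  · rintro s₂ t₂ - ⟨φ, ⟨J, hJ, h1, h19, h21, h17, h12, hT, hq, hφ⟩, hb, ht⟩
    refine ⟨J, hJ, h17, h12, hT, ?_, by omega⟩
    simp only [BExp.eval, NExp.eval, h17, h21, not_le, not_and] at hb
    by_cases hc : J.length = v.cap k
    · exact Or.inl hc
    · right
      have h0 := hb (lt_of_le_of_ne hJ.length_le hc)
      rcases hq with ⟨-, hq⟩ | ⟨q, -, hq, -⟩
      · exact fun q hqP hsq => hq q hqP hsq (hP q (Finset.mem_sdiff.1 hqP).1)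
      · omega

/-- The variables that describe the tree when `a` jobs have been inserted. -/
def TreeVars (due : ℕ → ℕ) (P : Finset ℕ) (a : ℕ) (s : State) : Prop :=
  (a = 0 ∧ s.nat 1 0 = 0 ∧ ∀ x, s.nat 0 x = 0) ∨
    ∃ m, s.nat 1 0 = 2 ^ m ∧ a ≤ 2 ^ m ∧ 2 ^ m < 2 * a ∧ TreeOK due P m (s.nat 0)

/-- The number of leaves doubles when the tree is full; the larger tree is already correct except
for its root, which lies above the inserted leaf and is recomputed with it. -/
theorem Prog.arrive_meets {a b : ℕ} (ha : s.nat 2 0 = a) (hav : a ≤ v.arrived)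
    (hb : v.arrived ≤ 2 ^ b) (hP : ∀ q ∈ P, q < a) (hT : TreeVars v.deadline P a s) :
    arrive.Meets v s fun s' t => s'.nat 2 0 = v.arrived ∧
      TreeVars v.deadline (P ∪ Finset.Ico a v.arrived) v.arrived s' ∧
      t ≤ (7 * b + 17) * (v.arrived - a) + 1 := by
  unfold arrive
  refine (Cmd.Meets.loop (fun s φ => ∃ a', a ≤ a' ∧ a' ≤ v.arrived ∧ s.nat 2 0 = a' ∧
    TreeVars v.deadline (P ∪ Finset.Ico a a') a' s ∧
    φ = (7 * b + 17) * (v.arrived - a')) ?_ ⟨a, le_rfl, hav, ha, by simpa using hT, rfl⟩).imp ?_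
  · rintro s φ ⟨c, hac, hcv, h2, hT, rfl⟩ hlt
    simp only [BExp.eval, NExp.eval, h2, not_le] at hlt
    have hset : P ∪ Finset.Ico a (c + 1) = insert c (P ∪ Finset.Ico a c) := by
      ext q
      simp only [Finset.mem_union, Finset.mem_Ico, Finset.mem_insert]
      constructor
      · rintro (h | h)
        · exact Or.inr (Or.inl h)
        · rcases Nat.lt_or_ge q c with h' | h'
          · exact Or.inr (Or.inr ⟨h.1, h'⟩)
          · exact Or.inl (by omega)
      · rintro (rfl | h | h)
        · exact Or.inr ⟨hac, by omega⟩
        · exact Or.inl h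
        · exact Or.inr ⟨h.1, by omega⟩
    have hP' : ∀ q ∈ P ∪ Finset.Ico a c, q < c := by
      intro q hq
      simp only [Finset.mem_union, Finset.mem_Ico] at hq
      rcases hq with hq | hq
      · exact (hP q hq).trans_le hac
      · exact hq.2
    refine Cmd.Meets.seq (R := fun s₁ t₁ => t₁ ≤ 3 ∧ ∃ m, s₁.nat 1 0 = 2 ^ m ∧ c < 2 ^ m ∧
      2 ^ m < 2 * (c + 1) ∧ ∀ l i, l ≤ m ∨ 1 ≤ i → i ≠ c / 2 ^ l →
        FirstDue v.deadline (P ∪ Finset.Ico a c) (i * 2 ^ l) ((i + 1) * 2 ^ l)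
          (s.nat 0 (cell l i))) ?_ ?_
    · simp only [Cmd.meets_ite, Cmd.meets_nstore, Cmd.meets_skip, BExp.eval, NExp.eval, h2]
      rcases hT with ⟨rfl, h1, h0⟩ | ⟨m, h1, hcm, hmc, hT⟩
      · refine ⟨fun _ => ⟨fun h => by omega, fun _ => ⟨by omega, 0, ?_⟩⟩, fun h => by omega⟩
        refine ⟨by simp [State.nat_setNat_self], by norm_num, by norm_num, fun l i _ _ => ?_⟩
        exact Or.inl ⟨h0 _, fun q hq => absurd (hP' q hq) (by omega)⟩
      · rw [h1]
        refine ⟨fun h => ⟨fun _ => ⟨by omega, m + 1, ?_⟩, fun h' => ?_⟩, fun h => ⟨by omega, m, ?_⟩⟩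
        · have hc : c = 2 ^ m := by omega
          have hpow : 2 ^ (m + 1) = 2 ^ m + 2 ^ m := by ring
          refine ⟨by simp [State.nat_setNat_self, hpow], by omega, by omega, fun l i hl hne => ?_⟩
          refine hT l i ?_
          rcases hl with hl | hl
          · rcases Nat.lt_or_ge m l with hml | hml
            · right
              -- At the new height, index `0` is the new root, an ancestor of leaf `c`; the nodes of
              -- positive index were correct before.
              obtain rfl : l = m + 1 := by omega
              have : c / 2 ^ (m + 1) = 0 := Nat.div_eq_of_lt (by omega)
              omega
            · exact Or.inl hml
          · exact Or.inr hl
        · have : 0 < 2 ^ m := by positivity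
          omega
        · exact ⟨rfl, by omega, by omega, fun l i hl _ => hT l i hl⟩
    · rintro s₁ t₁ hx ⟨ht₁, m, g1, hcm, hmc, hT₁⟩
      have g0 := hx.nat_eq (a := 0) (by decide)
      have g2 := hx.nat_eq (a := 2) (by decide)
      simp only [Cmd.meets_seq (p := Cmd.nstore _ _ _), Cmd.meets_nstore, NExp.eval]
      simp only [State.nat_setNat_ne, ne_eq, Nat.reduceEqDiff,
        not_false_eq_true, g2, h2]
      refine (Prog.setLeaf_meets (m := m) (j := c) (P := P ∪ Finset.Ico a c)
        (P' := P ∪ Finset.Ico a (c + 1)) ?_ ?_ hcm ?_ ?_ ?_).imp ?_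
      · simpa [State.nat_setNat_ne] using g1
      · simp [State.nat_setNat_self, State.nat_setNat_ne]
      · rw [hset]
        refine Or.inr ⟨c, by simp, ?_, le_rfl, by omega, fun q hq hcq hqc => ?_⟩
        · simp [NExp.eval, State.nat_setNat_self, State.nat_setNat_ne]
        · obtain rfl : q = c := by omega
          exact le_rfl
      · intro q hq
        rw [hset]
        simp [hq]
      · intro l i hl hne
        have := hT₁ l i hl hne
        simpa [State.nat_setNat_ne, g0] using this
      · rintro s₂ t₂ hx₂ ⟨hT₂, ht₂⟩
        have e1 := hx₂.nat_eq (a := 1) (by decide)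
        have e2 := hx₂.nat_eq (a := 2) (by decide)
        -- Because `2 ^ m` is less than twice the number of inserted jobs, the height stays at most
        -- `b`.
        have hmb : m ≤ b := by
          by_contra hcon
          have h1 : 2 ^ (b + 1) ≤ 2 ^ m := Nat.pow_le_pow_right (by norm_num) (by omega)
          have h2 : 2 ^ (b + 1) = 2 * 2 ^ b := by ring
          omega
        obtain ⟨d, hd⟩ : ∃ d, v.arrived - c = d + 1 := ⟨v.arrived - c - 1, by omega⟩
        have hd' : v.arrived - (c + 1) = d := by omega
        refine ⟨_, ⟨c + 1, by omega, hlt, ?_, Or.inr ⟨m, ?_, hcm, hmc, hT₂⟩, rfl⟩, ?_⟩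
        · rw [e2]; simp [State.nat_setNat_self]
        · rw [e1]; simpa [State.nat_setNat_ne] using g1
        · rw [hd, hd', Nat.mul_succ]
          omega
  · rintro s' t - ⟨φ, ⟨c, hac, hcv, h2, hT, rfl⟩, hb, ht⟩
    simp only [BExp.eval, NExp.eval, h2, not_le, not_lt] at hb
    obtain rfl : c = v.arrived := by omega
    exact ⟨h2, hT, by omega⟩

end Leaf

/-! ### Computing the types and budgets of the ranks. -/

namespace Prog

open NExp Cmd

/-- Multiply the real number in the variable `2` by the natural number in the variable `22`. -/
def mul : Cmd :=
  .seq (rset 1 (.const 0)) <|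
  .loop (.nle (const 1) (var 22)) <|
    .seq (.ite (.nle (var 22) (add (half (var 22)) (half (var 22)))) .skip
      (rset 1 (.add (.var 1) (.var 2)))) <|
    .seq (rset 2 (.add (.var 2) (.var 2))) <|
    set 22 (half (var 22))

/-- Find the best types up to each type of small capacity. -/
def scan : Cmd :=
  .loop (.and (.nlt (var 7) numTypes) (.nlt (cap (var 7)) arrived)) <|
    .seq (.ite (.nle (var 7) (const 0)) (nstore 8 (var 7) (const 0)) <|
      .seq (set 22 (cap (load 8 (sub (var 7) (const 1))))) <|
      .seq (rset 2 (.cost (var 7))) <| .seq mul <| .seq (rset 3 (.var 1)) <|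
      .seq (set 22 (cap (var 7))) <|
      .seq (rset 2 (.cost (load 8 (sub (var 7) (const 1))))) <| .seq mul <|
      .ite (.rle (.var 1) (.var 3)) (nstore 8 (var 7) (load 8 (sub (var 7) (const 1))))
        (nstore 8 (var 7) (var 7))) <|
    set 7 (add (var 7) (const 1))

/-- Determine the type of rank number `20` and the next budget, unless they are known. -/
def row : Cmd :=
  .ite (.nle (var 11) (var 20))
    (.seq (.loop (.and (.nlt (add (var 9) (const 1)) (var 7))
        (.rle (.cost (add (var 9) (const 1))) (.load 0 (var 20))))
        (set 9 (add (var 9) (const 1)))) <|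
      .seq (nstore 10 (var 20) (load 8 (var 9))) <|
      .seq (rstore 0 (add (var 20) (const 1))
        (.add (.load 0 (var 20)) (.cost (load 8 (var 9))))) <|
      set 11 (add (var 20) (const 1)))
    .skip

/-- Choose the type `21` of a launch of rank number `20`. -/
def pick : Cmd :=
  .ite (.and (.nlt (var 7) numTypes) (.rle (.cost (var 7)) (.load 0 (var 20))))
    (set 21 (var 7))
    (.seq row (set 21 (load 10 (var 20))))

end Prog

/-- The types on view are those of `M`. -/
structure View.Shows (v : View) (M : MachineTypes) : Prop where
  numTypes : v.numTypes = M.K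
  cap : v.cap = M.capAt
  cost : v.cost = M.costAt

/-- The first `p` types have capacity less than `a`, and `best` is right for them. -/
def Scanned (M : MachineTypes) (a p : ℕ) (best : ℕ → ℕ) : Prop :=
  p ≤ M.K ∧ ∀ k < p, M.capAt k < a ∧ M.IsBestUpTo k (best k)

theorem Scanned.le {M : MachineTypes} {a p : ℕ} {best : ℕ → ℕ} (h : Scanned M a p best) :
    p ≤ a := by
  by_contra hlt
  have h1 := (h.2 a (by omega)).1
  have h2 := M.lt_capAt (show a < M.K from lt_of_lt_of_le (by omega) h.1)
  omega

theorem Scanned.mono {M : MachineTypes} {a a' p : ℕ} {best : ℕ → ℕ} (h : Scanned M a p best)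
    (ha : a ≤ a') : Scanned M a' p best :=
  ⟨h.1, fun k hk => ⟨(h.2 k hk).1.trans_le ha, (h.2 k hk).2⟩⟩

/-- The types of the first `R` ranks and the budgets up to rank `R` are known. -/
structure RowsOK (M : MachineTypes) (p y R : ℕ) (XR : ℕ → ℝ) (KT : ℕ → ℕ) : Prop where
  kind_eq : ∀ r < R, KT r = M.kindOf r
  budget_eq : ∀ r ≤ R, XR r = M.budget r
  le : y < p ∨ y = 0
  cost_le : M.costAt y ≤ M.budget R

section Types

variable {M : MachineTypes} {v : View} {s : State}

/-- Binary multiplication: halving one factor and doubling the other preserves accumulator plus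
product. It is needed to compare costs per capacity, because the machine has no multiplication. -/
theorem Prog.mul_meets {c b : ℕ} {y : ℝ} (hc : s.nat 22 0 = c) (hy : s.real 2 0 = y)
    (hb : c < 2 ^ b) :
    mul.Meets v s fun s' t => s'.real 1 0 = c * y ∧ t ≤ 5 * b + 2 := by
  unfold mul
  simp only [Cmd.meets_seq, Cmd.meets_rstore]
  refine (Cmd.Meets.loop (fun s φ => ∃ e d : ℕ, s.nat 22 0 = e ∧ e < 2 ^ d ∧
    s.real 1 0 + e * s.real 2 0 = c * y ∧ φ = 5 * d) ?_ (φ := 5 * b) ?_).imp ?_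
  · rintro s φ ⟨e, d, h22, hd, hsum, rfl⟩ hpos
    simp only [BExp.eval, NExp.eval, h22] at hpos
    have hd0 : d ≠ 0 := by rintro rfl; simp at hd; omega
    obtain ⟨d, rfl⟩ := Nat.exists_eq_succ_of_ne_zero hd0
    have hhalf : e / 2 < 2 ^ d := by rw [pow_succ] at hd; omega
    simp only [Cmd.meets_seq, Cmd.meets_ite, Cmd.meets_skip, Cmd.meets_rstore, Cmd.meets_nstore,
      BExp.eval, NExp.eval, RExp.eval, h22, State.real_setReal_self, State.real_setReal_ne, ne_eq,
      not_false_eq_true, OfNat.one_ne_ofNat, OfNat.ofNat_ne_one,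
      State.nat_setReal, State.real_setNat, State.nat_setNat_self, if_true]
    refine ⟨fun h => ⟨_, ⟨e / 2, d, rfl, hhalf, ?_, rfl⟩, by omega⟩,
      fun h => ⟨_, ⟨e / 2, d, rfl, hhalf, ?_, rfl⟩, by omega⟩⟩
    · have : (e : ℝ) = 2 * (e / 2 : ℕ) := by exact_mod_cast (show e = 2 * (e / 2) by omega)
      rw [← hsum]; linear_combination -(s.real 2 0) * this
    · have : (e : ℝ) = 2 * (e / 2 : ℕ) + 1 := by exact_mod_cast (show e = 2 * (e / 2) + 1 by omega)
      rw [← hsum]; linear_combination -(s.real 2 0) * this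
  · refine ⟨c, b, by simpa [State.nat_setReal] using hc, hb, ?_, rfl⟩
    simp [State.real_setReal_self, State.real_setReal_ne, RExp.eval, NExp.eval, hy]
  · rintro s' t - ⟨φ, ⟨e, d, h22, hd, hsum, rfl⟩, h0, ht⟩
    simp only [BExp.eval, NExp.eval, h22, not_le, Nat.lt_one_iff] at h0
    subst h0
    exact ⟨by simpa using hsum, by omega⟩

/-- Scanning stops at the first type that could hold all arrived jobs. Capacities compared on the
way are below `2 ^ b`, so each of the two products takes `5 * b + 2` steps. -/
theorem Prog.scan_meets {a p b : ℕ} (hv : v.Shows M) (hp : s.nat 7 0 = p)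
    (hs : Scanned M a p (s.nat 8)) (ha : a ≤ v.arrived) (hb : v.arrived ≤ 2 ^ b) :
    scan.Meets v s fun s' t => ∃ p', s'.nat 7 0 = p' ∧ p ≤ p' ∧
      Scanned M v.arrived p' (s'.nat 8) ∧ (p' < M.K → v.arrived ≤ M.capAt p') ∧
      t ≤ (10 * b + 14) * (p' - p) + 1 := by
  unfold scan
  refine (Cmd.Meets.loop (fun s φ => ∃ p', s.nat 7 0 = p' ∧ p ≤ p' ∧
      Scanned M v.arrived p' (s.nat 8) ∧
      φ = (10 * b + 14) * (v.arrived - p')) ?_ ⟨p, hp, le_rfl, hs.mono ha, rfl⟩).imp ?_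
  · rintro s φ ⟨q, h7, hpq, hs, rfl⟩ hlt
    simp only [BExp.eval, NExp.eval, h7, not_le, hv.numTypes, hv.cap] at hlt
    obtain ⟨hqK, hcap⟩ := hlt
    have hqv := M.lt_capAt hqK
    obtain ⟨d, hd⟩ : ∃ d, v.arrived - q = d + 1 := ⟨v.arrived - q - 1, by omega⟩
    have hd' : v.arrived - (q + 1) = d := by omega
    refine Cmd.Meets.seq (R := fun s₁ t₁ => t₁ ≤ 10 * b + 12 ∧ s₁.nat 7 0 = q ∧
      Scanned M v.arrived (q + 1) (s₁.nat 8)) ?_ ?_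
    · have hstore : ∀ x, M.IsBestUpTo q x →
          Scanned M v.arrived (q + 1) fun j => if j = q then x else s.nat 8 j := by
        refine fun x hx => ⟨hqK, fun k hk => ?_⟩
        dsimp only
        split_ifs with hkq
        · subst hkq; exact ⟨hcap, hx⟩
        · exact hs.2 k (by omega)
      rw [Cmd.meets_ite]
      simp only [BExp.eval, NExp.eval, h7, Nat.le_zero]
      constructor
      · rintro rfl
        simp only [Cmd.meets_nstore, NExp.eval, h7]
        refine ⟨by omega, by simpa [State.nat_setNat_ne] using h7, ?_⟩
        have := hstore 0 M.isBestUpTo_zero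
        convert this using 2 with j
        simp [State.nat_setNat_self]
      · intro hq0
        obtain ⟨k, rfl⟩ := Nat.exists_eq_succ_of_ne_zero hq0
        obtain ⟨hcapk, hbest⟩ := hs.2 k (by omega)
        have hcapb : M.capAt (s.nat 8 k) < v.arrived := (hs.2 _ (by have := hbest.1; omega)).1
        simp only [Cmd.meets_seq (p := Cmd.nstore _ _ _), Cmd.meets_seq (p := Cmd.rstore _ _ _),
          Cmd.meets_nstore, Cmd.meets_rstore, NExp.eval, RExp.eval, hv.cap, hv.cost]
        simp only [State.nat_setNat_ne, ne_eq, Nat.reduceEqDiff, not_false_eq_true, h7,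
          Nat.succ_eq_add_one, Nat.add_sub_cancel]
        refine Cmd.Meets.seq (Prog.mul_meets (b := b) (c := M.capAt (s.nat 8 k))
          (y := M.costAt (k + 1)) ?_ ?_ (by omega)) ?_
        · simp [State.nat_setReal, State.nat_setNat_self]
        · simp [State.real_setReal_self]
        rintro s₁ t₁ hx₁ ⟨e1, ht₁⟩
        have e7 := hx₁.nat_eq (a := 7) (by decide)
        have e8 := hx₁.nat_eq (a := 8) (by decide)
        simp only [State.nat_setNat_ne, State.nat_setReal, ne_eq, Nat.reduceEqDiff,
          not_false_eq_true] at e7 e8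
        simp only [Cmd.meets_seq (p := Cmd.nstore _ _ _), Cmd.meets_seq (p := Cmd.rstore _ _ _),
          Cmd.meets_nstore, Cmd.meets_rstore, NExp.eval, RExp.eval, hv.cap, hv.cost]
        simp only [State.nat_setNat_ne, State.nat_setReal, ne_eq, Nat.reduceEqDiff,
          not_false_eq_true, e7, e8, h7, Nat.succ_eq_add_one, Nat.add_sub_cancel, e1]
        refine Cmd.Meets.seq (Prog.mul_meets (b := b) (c := M.capAt (k + 1))
          (y := M.costAt (s.nat 8 k)) ?_ ?_ (by simp at hcap; omega)) ?_
        · simp [State.nat_setReal, State.nat_setNat_self]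
        · simp [State.real_setReal_self]
        rintro s₂ t₂ hx₂ ⟨d1, ht₂⟩
        have d7 := hx₂.nat_eq (a := 7) (by decide)
        have d8 := hx₂.nat_eq (a := 8) (by decide)
        have d3 := hx₂.real_eq (a := 3) (by decide)
        simp only [State.nat_setNat_ne, State.nat_setReal, ne_eq, Nat.reduceEqDiff,
          not_false_eq_true, State.real_setReal_ne, State.real_setNat] at d7 d8 d3
        simp only [Cmd.meets_ite, Cmd.meets_nstore, BExp.eval, NExp.eval, RExp.eval]
        simp only [State.nat_setNat_ne, ne_eq, Nat.reduceEqDiff, not_false_eq_true,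
          d7, d8, d3, d1, e7, e8, h7, State.real_setReal_self, if_true,
          Nat.succ_eq_add_one, Nat.add_sub_cancel]
        refine ⟨fun hle => ⟨by omega, trivial, ?_⟩, fun hlt => ⟨by omega, trivial, ?_⟩⟩
        · convert hstore _ (hbest.succ_of_le hle) using 2 with j
          simp [State.nat_setNat_self, d8, e8]
        · convert hstore _ (hbest.succ_of_lt hqK (not_le.1 hlt)) using 2 with j
          simp [State.nat_setNat_self, d8, e8]
    · rintro s₁ t₁ - ⟨ht₁, e7, hs₁⟩
      simp only [Cmd.meets_nstore, NExp.eval, e7]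
      refine ⟨_, ⟨q + 1, by simp [State.nat_setNat_self], by omega, ?_, rfl⟩, ?_⟩
      · simpa [State.nat_setNat_ne] using hs₁
      · rw [hd, hd', Nat.mul_succ]; omega
  · rintro s' t - ⟨φ, ⟨q, h7, hpq, hs', rfl⟩, hb, ht⟩
    simp only [BExp.eval, NExp.eval, h7, not_le, hv.numTypes, hv.cap, not_and, not_lt] at hb
    refine ⟨q, h7, hpq, hs', hb, ?_⟩
    have hle := hs'.le
    obtain ⟨d, hd⟩ := Nat.exists_eq_add_of_le hpq
    obtain ⟨d', hd'⟩ := Nat.exists_eq_add_of_le hle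
    have h1 : v.arrived - p = d + d' := by omega
    have h2 : v.arrived - q = d' := by omega
    have h3 : q - p = d := by omega
    rw [h1, h2, Nat.mul_add] at ht
    rw [h3]
    omega

/-- If type `p` exceeds the budget, all affordable types have been scanned; when the pointer `y`
cannot advance, it is at the dearest of them. -/
theorem RowsOK.isEff {p y R : ℕ} {XR : ℕ → ℝ} {KT best : ℕ → ℕ} {a : ℕ}
    (h : RowsOK M p y R XR KT) (hs : Scanned M a p best)
    (hp : p < M.K → M.budget R < M.costAt p)
    (hy : y + 1 < p → M.budget R < M.costAt (y + 1)) : best y = M.kindOf R := by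
  have hp0 : p ≠ 0 := by
    rintro rfl
    exact absurd (hp M.K_pos) (M.costAt_zero_le_budget R).not_gt
  have hyp : y < p := by rcases h.le with h | h <;> omega
  have hyK : y < M.K := hyp.trans_le hs.1
  refine MachineTypes.IsEff.eq_eff ⟨y, hyK, h.cost_le, fun j hj hjx => ?_, (hs.2 y hyp).2⟩
  by_contra hlt
  push Not at hlt
  rcases Nat.lt_or_ge (y + 1) p with h1 | h1
  · have h2 := hy h1
    have h3 := M.costAt_le (show y + 1 ≤ j by omega) hj
    linarith
  · have h2 := hp (by omega)
    have h3 := M.costAt_le (show p ≤ j by omega) hj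
    linarith

/-- Ranks are tabulated on demand. Budgets grow with the rank, so the pointer `y` never moves back
and its moves are amortized by `2 * (y' - y)`. -/
theorem Prog.row_meets {p y R r a : ℕ} (hv : v.Shows M) (hp : s.nat 7 0 = p)
    (hy : s.nat 9 0 = y) (hR : s.nat 11 0 = R) (hr : s.nat 20 0 = r) (hrR : r ≤ R)
    (hs : Scanned M a p (s.nat 8)) (hrow : RowsOK M p y R (s.real 0) (s.nat 10))
    (hpr : p < M.K → M.budget r < M.costAt p) :
    row.Meets v s fun s' t => ∃ y' R', s'.nat 9 0 = y' ∧ s'.nat 11 0 = R' ∧ R ≤ R' ∧ r < R' ∧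
      y ≤ y' ∧ RowsOK M p y' R' (s'.real 0) (s'.nat 10) ∧ t ≤ 2 * (y' - y) + 5 := by
  unfold row
  rw [Cmd.meets_ite]
  simp only [BExp.eval, NExp.eval, hR, hr, not_le, Cmd.meets_skip]
  refine ⟨fun hle => ?_, fun hlt => ⟨y, R, hy, rfl, le_rfl, hlt, le_rfl, hrow, by omega⟩⟩
  obtain rfl : r = R := le_antisymm hrR hle
  refine Cmd.Meets.seq (Cmd.Meets.loop (fun s φ => ∃ y', s.nat 9 0 = y' ∧ y ≤ y' ∧ s.nat 7 0 = p ∧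
    s.nat 20 0 = r ∧ RowsOK M p y' r (s.real 0) (s.nat 10) ∧ φ = 2 * (p - y'))
    ?_ ⟨y, hy, le_rfl, hp, hr, hrow, rfl⟩) ?_
  · rintro s φ ⟨z, h9, hyz, h7, h20, hrow, rfl⟩ hb
    simp only [BExp.eval, NExp.eval, RExp.eval, h9, h7, h20, not_le, hv.cost,
      hrow.budget_eq r le_rfl] at hb
    simp only [Cmd.meets_nstore, NExp.eval, h9]
    refine ⟨_, ⟨z + 1, by simp [State.nat_setNat_self], by omega, by simpa [State.nat_setNat_ne],
      by simpa [State.nat_setNat_ne], ?_, rfl⟩, by omega⟩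
    rw [State.nat_setNat_ne _ _ _ _ (by decide), State.real_setNat]
    exact { hrow with le := Or.inl hb.1, cost_le := hb.2 }
  · rintro s₁ t₁ hx ⟨φ, ⟨z, h9, hyz, h7, h20, hrow, rfl⟩, hb, ht⟩
    have e8 := hx.nat_eq (a := 8) (by decide)
    simp only [BExp.eval, NExp.eval, RExp.eval, h9, h7, h20, not_le, hv.cost,
      hrow.budget_eq r le_rfl, not_and] at hb
    have hkind := hrow.isEff hs hpr hb
    simp only [Cmd.meets_seq, Cmd.meets_nstore, Cmd.meets_rstore, NExp.eval, RExp.eval, hv.cost]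
    simp only [State.nat_setNat_self, State.nat_setNat_ne, State.nat_setReal, State.real_setNat,
      ne_eq, Nat.reduceEqDiff, not_false_eq_true, if_true, h9, h20, e8, hkind]
    refine ⟨z, r + 1, rfl, rfl, by omega, by omega, hyz, ⟨fun q hq => ?_, fun q hq => ?_,
      hrow.le, ?_⟩, ?_⟩
    · rw [State.nat_setNat_self]
      split_ifs with h
      · rw [h]
      · exact hrow.kind_eq q (by omega)
    · rw [State.real_setReal_self, State.real_setNat, hrow.budget_eq r le_rfl]
      split_ifs with h
      · rw [h, MachineTypes.budget_succ]
      · exact hrow.budget_eq q (by omega)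
    · exact hrow.cost_le.trans (M.budget_mono (by omega))
    · have : z ≤ p := by rcases hrow.le with h | h <;> omega
      omega

/-- Type `p`, the first one not scanned, is preferred when affordable, since it can hold everything.
Otherwise `kindOf r` depends on scanned types only. -/
theorem Prog.pick_meets {p y R r a : ℕ} (hv : v.Shows M) (hp : s.nat 7 0 = p)
    (hy : s.nat 9 0 = y) (hR : s.nat 11 0 = R) (hr : s.nat 20 0 = r) (hrR : r ≤ R)
    (hs : Scanned M a p (s.nat 8)) (hrow : RowsOK M p y R (s.real 0) (s.nat 10)) :
    pick.Meets v s fun s' t => ∃ y' R' k, s'.nat 9 0 = y' ∧ s'.nat 11 0 = R' ∧ R ≤ R' ∧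
      y ≤ y' ∧ RowsOK M p y' R' (s'.real 0) (s'.nat 10) ∧ s'.nat 21 0 = k ∧ k < M.K ∧
      M.costAt k ≤ M.budget r ∧ (k = p ∨ r < R' ∧ k = M.kindOf r) ∧ t ≤ 2 * (y' - y) + 7 := by
  unfold pick
  rw [Cmd.meets_ite]
  simp only [BExp.eval, NExp.eval, RExp.eval, hp, hr, not_le, hv.numTypes, hv.cost,
    hrow.budget_eq r hrR]
  constructor
  · rintro ⟨hpK, hle⟩
    simp only [Cmd.meets_nstore, NExp.eval, hp]
    refine ⟨y, R, p, by simpa [State.nat_setNat_ne], by simpa [State.nat_setNat_ne], le_rfl, le_rfl,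
      ?_, by simp [State.nat_setNat_self], hpK, hle, Or.inl rfl, by omega⟩
    rw [State.nat_setNat_ne _ _ _ _ (by decide), State.real_setNat]
    exact hrow
  · intro hn
    simp only [not_and, not_le] at hn
    refine (Prog.row_meets hv hp hy hR hr hrR hs hrow hn).seq ?_
    rintro s₁ t₁ hx ⟨y', R', h9, h11, hRR, hrR', hyy, hrow', ht⟩
    have e20 := hx.nat_eq (a := 20) (by decide)
    simp only [Cmd.meets_nstore, NExp.eval, e20, hr, hrow'.kind_eq r hrR']
    refine ⟨y', R', _, by simpa [State.nat_setNat_ne], by simpa [State.nat_setNat_ne], hRR, hyy,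
      ?_, by simp only [State.nat_setNat_self, if_true], M.kindOf_lt r, M.costAt_kindOf_le r,
      Or.inr ⟨hrR', rfl⟩, by omega⟩
    rw [State.nat_setNat_ne _ _ _ _ (by decide), State.real_setNat]
    exact hrow'

end Types

/-! ### A single launch. -/

namespace Prog

open NExp Cmd

/-- Find the cohort of job number `18`, discard it and the younger ones, and compute the first
job `19` and the rank `20` of the launch. -/
def locate : Cmd :=
  .ite (.nle (var 3) (var 18)) (.seq (set 19 (var 3)) (set 20 (const 0))) <|
  .seq (.loop (.nlt (var 18) (load 5 (sub (var 4) (const 1)))) (set 4 (sub (var 4) (const 1)))) <|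
  .seq (set 4 (sub (var 4) (const 1))) <|
  .seq (set 19 (load 5 (var 4))) (set 20 (load 6 (var 4)))

/-- If the youngest cohort has rank `20`, include it in the launch. -/
def merge : Cmd :=
  .ite (.and (.nle (const 1) (var 4))
      (.nle (load 6 (sub (var 4) (const 1))) (add (var 20) (const 1))))
    (.seq (set 4 (sub (var 4) (const 1))) (set 19 (load 5 (var 4)))) .skip

/-- The launch that is triggered by the pending job that is due first. -/
def trigger : Cmd :=
  .seq (set 18 (sub (load 0 (sub (var 1) (const 1))) (const 1))) <|
  .seq locate <| .seq merge <| .seq pick <| .seq extract <| .seq (launch (var 21) 12 (var 17)) <|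
  .seq (nstore 5 (var 4) (var 19)) <| .seq (nstore 6 (var 4) (add (var 20) (const 1))) <|
  .seq (set 4 (add (var 4) (const 1))) (set 3 (var 2))

end Prog

/-- The arrays `ST` and `NR` contain the starts and the next ranks of the cohorts. -/
def StackOK (ST NR : ℕ → ℕ) : List Cohort → Prop
  | [] => True
  | g :: gs => ST gs.length = g.start ∧ NR gs.length = g.rank + 1 ∧ StackOK ST NR gs

theorem StackOK.of_append {ST NR : ℕ → ℕ} {D G : List Cohort} (h : StackOK ST NR (D ++ G)) :
    StackOK ST NR G := by
  induction D with
  | nil => exact h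
  | cons d D ih => exact ih h.2.2

theorem StackOK.congr {ST NR ST' NR' : ℕ → ℕ} {G : List Cohort} (h : StackOK ST NR G)
    (h' : ∀ i < G.length, ST' i = ST i ∧ NR' i = NR i) : StackOK ST' NR' G := by
  induction G with
  | nil => trivial
  | cons g G ih =>
    have := h' G.length (by simp)
    exact ⟨this.1.trans h.1, this.2.trans h.2.1,
      ih h.2.2 fun i hi => h' i (hi.trans (by simp))⟩

/-- The memory of the machine represents the situation of the algorithm. -/
structure Synced (I : Problem) (a : ℕ) (P : Finset ℕ) (G : List Cohort) (f R p y : ℕ)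
    (s : State) : Prop where
  known : s.nat 2 0 = a
  tree : TreeVars I.due P a s
  fresh : s.nat 3 0 = f
  size : s.nat 4 0 = G.length
  stack : StackOK (s.nat 5) (s.nat 6) G
  types : s.nat 7 0 = p
  scanned : Scanned I.types a p (s.nat 8)
  dearest : s.nat 9 0 = y
  ranks : s.nat 11 0 = R
  rows : RowsOK I.types p y R (s.real 0) (s.nat 10)

theorem TreeOK.congr {due due' : ℕ → ℕ} {P : Finset ℕ} {m : ℕ} {T : ℕ → ℕ}
    (h : TreeOK due P m T) (hd : ∀ q ∈ P, due q = due' q) : TreeOK due' P m T :=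
  fun l i hl => (h l i hl).congr (fun _ _ _ => Iff.rfl) hd

theorem TreeVars.congr {due due' : ℕ → ℕ} {P : Finset ℕ} {a : ℕ} {s : State}
    (h : TreeVars due P a s) (hd : ∀ q ∈ P, due q = due' q) : TreeVars due' P a s := by
  rcases h with h | ⟨m, h1, h2, h3, h4⟩
  · exact Or.inl h
  · exact Or.inr ⟨m, h1, h2, h3, h4.congr hd⟩

theorem TreeOK.root {due : ℕ → ℕ} {P : Finset ℕ} {m : ℕ} {T : ℕ → ℕ} (h : TreeOK due P m T) :
    FirstDue due P 0 (2 ^ m) (T (2 ^ m - 1)) := by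
  simpa [cell] using h m 0 (Or.inl le_rfl)

/-- The root of the tree with `2 ^ m` leaves is cell `2 ^ m - 1`. Before the first arrival,
truncated subtraction yields cell `0`, which holds `0`, the code for "no job". -/
theorem TreeVars.root {due : ℕ → ℕ} {P : Finset ℕ} {a : ℕ} {s : State}
    (h : TreeVars due P a s) (hP : ∀ q ∈ P, q < a) :
    FirstDue due P 0 a (s.nat 0 (s.nat 1 0 - 1)) := by
  rcases h with ⟨rfl, -, h0⟩ | ⟨m, h1, h2, h3, h4⟩
  · exact Or.inl ⟨h0 _, fun q _ _ => by omega⟩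
  · rw [h1]
    rcases h4.root with ⟨h0, h⟩ | ⟨q, hq, h0, -, -, h⟩
    · exact Or.inl ⟨h0, fun q hq hl hq' => h q hq hl (hq'.trans_le h2)⟩
    · exact Or.inr ⟨q, hq, h0, Nat.zero_le _, hP q hq,
        fun q' hq' hl hh => h q' hq' hl (hh.trans_le h2)⟩

section Trigger

variable {I : Problem} {v : View} {s : State} {R a f : ℕ} {P : Finset ℕ} {O : List Batch}
  {G : List Cohort} {W : List Witness} {F : List ℕ} {j τ : ℕ}

/-- The stack is popped until the top cohort starts no later than `j`. The stack is not exhausted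
before that, because the cohorts cover all numbers below `f`. Each further pop takes two steps, paid
by the shorter stack. -/
theorem Prog.locate_meets (h : Invariant I R a P O G W F f) (h3 : s.nat 3 0 = f)
    (h4 : s.nat 4 0 = G.length) (h56 : StackOK (s.nat 5) (s.nat 6) G) (hj : j ∈ P)
    (h18 : s.nat 18 0 = j) (hτ : I.due j = τ) (ha : ∀ q < I.n, a ≤ q → τ < I.rel q) :
    locate.Meets v s fun s' t => ∃ G' W' F' st r, Prepared I R a P O G' W' F' st r ∧ st ≤ j ∧
      s'.nat 4 0 = G'.length ∧ StackOK (s'.nat 5) (s'.nat 6) G' ∧ s'.nat 19 0 = st ∧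
      s'.nat 20 0 = r ∧ t + 2 * G'.length ≤ 2 * G.length + 5 := by
  unfold locate
  rw [Cmd.meets_ite]
  simp only [BExp.eval, NExp.eval, h3, h18]
  constructor
  · intro hfj
    simp only [Cmd.meets_seq, Cmd.meets_nstore, NExp.eval]
    refine ⟨G, W, j :: F, f, 0, h.prepare_first hj hfj hτ ha, hfj, ?_⟩
    simp [State.nat_setNat_self, State.nat_setNat_ne, h3, h4, h56]
    omega
  · intro hjf
    refine Cmd.Meets.seq (Cmd.Meets.loop (fun s₁ φ => ∃ D G', G = D ++ G' ∧ s₁.nat 18 0 = j ∧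
      s₁.nat 4 0 = G'.length ∧ s₁.nat 5 = s.nat 5 ∧ s₁.nat 6 = s.nat 6 ∧
      (∀ d ∈ D, j < d.start) ∧ φ = 2 * G'.length) ?_
      ⟨[], G, rfl, h18, h4, rfl, rfl, by simp, rfl⟩) ?_
    · rintro s₁ φ ⟨D, G', rfl, g18, g4, g5, g6, hD, rfl⟩ hb
      obtain ⟨e, -, hG, -, -, hx⟩ := h.cohorts.of_append
      have hje := hx j hD (by omega)
      cases G' with
      | nil => simp only [CohortsOK] at hG; omega
      | cons g G' =>
        have hst := h56.of_append.1
        simp only [BExp.eval, NExp.eval, g4, g18, g5, List.length_cons, Nat.add_sub_cancel, hst,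
          not_le] at hb
        simp only [Cmd.meets_nstore, NExp.eval, g4, List.length_cons, Nat.add_sub_cancel]
        refine ⟨_, ⟨D ++ [g], G', by simp, by simpa [State.nat_setNat_ne],
          by simp [State.nat_setNat_self], by simpa [State.nat_setNat_ne],
          by simpa [State.nat_setNat_ne], ?_, rfl⟩, by omega⟩
        intro d hd
        rcases List.mem_append.1 hd with hd | hd
        · exact hD d hd
        · rw [List.mem_singleton.1 hd]; exact hb
    · rintro s₁ t₁ - ⟨φ, ⟨D, G', rfl, g18, g4, g5, g6, hD, rfl⟩, hb, ht⟩
      obtain ⟨e, -, hG, -, -, hx⟩ := h.cohorts.of_append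
      have hje := hx j hD (by omega)
      cases G' with
      | nil => simp only [CohortsOK] at hG; omega
      | cons g G' =>
        obtain ⟨hst, hrk, hrest⟩ := h56.of_append
        simp only [BExp.eval, NExp.eval, g4, g18, g5, List.length_cons, Nat.add_sub_cancel, hst,
          not_le, not_lt] at hb
        simp only [Cmd.meets_seq, Cmd.meets_nstore, NExp.eval, g4, List.length_cons,
          Nat.add_sub_cancel]
        refine ⟨G', _, F, g.start, g.rank + 1, h.prepare_next hj (by omega) hD hb hτ ha, hb, ?_⟩
        simp [State.nat_setNat_self, State.nat_setNat_ne, g5, g6, hst, hrk, hrest]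
        simp at ht
        omega

/-- No remaining cohort has rank below `r`, so the inequality tested by the program amounts to
equality of ranks. -/
theorem Prog.merge_meets {st r : ℕ} (h : Prepared I R a P O G W F st r) (hst : st ≤ j)
    (h4 : s.nat 4 0 = G.length) (h56 : StackOK (s.nat 5) (s.nat 6) G) (h19 : s.nat 19 0 = st)
    (h20 : s.nat 20 0 = r) :
    merge.Meets v s fun s' t => ∃ G' st', Prepared I R a P O G' W F st' r ∧ st' ≤ j ∧
      (∀ g ∈ G', r < g.rank) ∧ s'.nat 4 0 = G'.length ∧ StackOK (s'.nat 5) (s'.nat 6) G' ∧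
      s'.nat 19 0 = st' ∧ G'.length ≤ G.length ∧ t ≤ 3 := by
  unfold merge
  rw [Cmd.meets_ite]
  simp only [BExp.eval, NExp.eval, h4, h20]
  cases G with
  | nil =>
    simp only [List.length_nil, Cmd.meets_skip]
    exact ⟨fun h' => by omega, fun _ => ⟨[], st, h, hst, by simp, h4, h56, h19, le_rfl, by omega⟩⟩
  | cons g G =>
    obtain ⟨e5, e6, hrest⟩ := h56
    have hle := h.rank_le g (by simp)
    simp only [List.length_cons, Nat.add_sub_cancel, e6, Cmd.meets_skip]
    constructor
    · intro hr
      obtain ⟨h1, h2, h3⟩ := h.merge (show g.rank = r by omega)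
      simp only [Cmd.meets_seq, Cmd.meets_nstore, NExp.eval, h4, List.length_cons,
        Nat.add_sub_cancel]
      refine ⟨G, g.start, h1, by omega, h3, ?_⟩
      simp [State.nat_setNat_self, State.nat_setNat_ne, e5, hrest]
    · intro hr
      exact ⟨g :: G, st, h, hst, h.rank_lt_of_ne (by omega), h4, ⟨e5, e6, hrest⟩, h19, le_rfl,
        by omega⟩

/-- The time bound is amortized with the stack length and the pointer `y` as potentials; `c` is the
number of jobs executed. -/
theorem Prog.trigger_meets {p y b : ℕ} (hv : v.Shows I.types) (hnow : v.now = τ)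
    (hdl : ∀ q < a, v.deadline q = I.due q) (hnew : ∀ q < I.n, a ≤ q → τ < I.rel q)
    (hw : ∀ q ∈ P, I.rel q ≤ τ ∧ τ ≤ I.due q) (hb : a ≤ 2 ^ b)
    (h : Invariant I R a P s.out G W F f) (hs : Synced I a P G f R p y s)
    (hp : p < I.types.K → a ≤ I.types.capAt p) (hroot : s.nat 0 (s.nat 1 0 - 1) ≠ 0)
    (hdue : v.deadline (s.nat 0 (s.nat 1 0 - 1) - 1) ≤ τ) :
    trigger.Meets v s fun s' t => ∃ (P' : Finset ℕ) (G' : List Cohort) (W' : List Witness)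
      (F' : List ℕ) (R' y' c : ℕ), P' ⊆ P ∧ P'.card + c = P.card ∧ 1 ≤ c ∧
      Invariant I R' a P' s'.out G' W' F' a ∧
      Synced I a P' G' a R' p y' s' ∧ y ≤ y' ∧
      t + 2 * G'.length + 2 * y ≤ (21 * b + 60) * c + 2 * G.length + 2 * y' := by
  have hPa : ∀ q ∈ P, q < a := fun q hq => h.ledger.lt_of_mem hq
  obtain ⟨j, hjP, hj, hmin⟩ : ∃ j ∈ P, s.nat 0 (s.nat 1 0 - 1) = j + 1 ∧
      ∀ q ∈ P, I.due j ≤ I.due q := by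
    rcases hs.tree.root hPa with ⟨h0, -⟩ | ⟨j, hjP, hj, -, -, hm⟩
    · exact absurd h0 hroot
    · exact ⟨j, hjP, hj, fun q hq => hm q hq (Nat.zero_le _) (hPa q hq)⟩
  have hja := hPa j hjP
  have hτ : I.due j = τ := by
    rw [hj, Nat.add_sub_cancel, hdl j hja] at hdue
    exact le_antisymm hdue (hw j hjP).2
  obtain ⟨m, hW, ham, hma, hT⟩ : ∃ m, s.nat 1 0 = 2 ^ m ∧ a ≤ 2 ^ m ∧ 2 ^ m < 2 * a ∧
      TreeOK v.deadline P m (s.nat 0) := by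
    rcases hs.tree with ⟨h0, -⟩ | ⟨m, h1, h2, h3, h4⟩
    · omega
    · exact ⟨m, h1, h2, h3, h4.congr fun q hq => (hdl q (hPa q hq)).symm⟩
  have hmb : m ≤ b := by
    by_contra hcon
    have h1 : 2 ^ (b + 1) ≤ 2 ^ m := Nat.pow_le_pow_right (by norm_num) (by omega)
    have h2 : 2 ^ (b + 1) = 2 * 2 ^ b := by ring
    omega
  unfold trigger
  simp only [Cmd.meets_seq (p := Cmd.set 18 _), Cmd.meets_nstore, NExp.eval, hj,
    Nat.add_sub_cancel]
  refine (Prog.locate_meets h (by simpa [State.nat_setNat_ne] using hs.fresh)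
    (by simpa [State.nat_setNat_ne] using hs.size) (by simpa [State.nat_setNat_ne] using hs.stack)
    hjP (by simp [State.nat_setNat_self]) hτ hnew).seq ?_
  rintro s₁ t₁ hx₁ ⟨G₁, W₁, F₁, st₁, r, hpre₁, hst₁, g4, g56, g19, g20, ht₁⟩
  refine (Prog.merge_meets hpre₁ hst₁ g4 g56 g19 g20).seq ?_
  rintro s₂ t₂ hx₂ ⟨G₂, st, hpre, hst, hrank, e4, e56, e19, hlen, ht₂⟩
  have e20 : s₂.nat 20 0 = r := by rw [hx₂.nat_eq (a := 20) (by decide), g20]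
  have keep : ∀ i, i ∉ [4, 18, 19, 20] → s₂.nat i = s.nat i := by
    intro i hi
    simp only [List.mem_cons, List.not_mem_nil, or_false, not_or] at hi
    rw [hx₂.nat_eq (by simp [merge, Cmd.natTargets]; omega),
      hx₁.nat_eq (by simp [locate, Cmd.natTargets]; omega), State.nat_setNat_ne _ _ _ _ (by omega)]
  have keepR : s₂.real 0 = s.real 0 := by
    rw [hx₂.real_eq (by decide), hx₁.real_eq (by decide), State.real_setNat]
  have out₂ : s₂.out = s.out := by
    rw [hx₂.out_eq (by decide), hx₁.out_eq (by decide), State.out_setNat]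
  have e7 : s₂.nat 7 0 = p := by rw [keep 7 (by decide)]; exact hs.types
  have e9 : s₂.nat 9 0 = y := by rw [keep 9 (by decide)]; exact hs.dearest
  have e11 : s₂.nat 11 0 = R := by rw [keep 11 (by decide)]; exact hs.ranks
  have e8 : Scanned I.types a p (s₂.nat 8) := by rw [keep 8 (by decide)]; exact hs.scanned
  have erow : RowsOK I.types p y R (s₂.real 0) (s₂.nat 10) := by
    rw [keepR, keep 10 (by decide)]; exact hs.rows
  refine (Prog.pick_meets hv e7 e9 e11 e20 hpre.rank_known e8 erow).seq ?_
  rintro s₃ t₃ hx₃ ⟨y', R', k, d9, d11, hRR, hyy, drow, d21, hkK, hkc, hkind, ht₃⟩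
  have d0 : s₃.nat 0 = s.nat 0 := by rw [hx₃.nat_eq (by decide), keep 0 (by decide)]
  have d1 : s₃.nat 1 = s.nat 1 := by rw [hx₃.nat_eq (by decide), keep 1 (by decide)]
  have d19 : s₃.nat 19 0 = st := by rw [hx₃.nat_eq (by decide), e19]
  refine (Prog.extract_meets (m := m) (P := P) (st := st) (k := k) (by rw [d1, hW]) d19 (by omega)
    d21 (fun q hq => (hPa q hq).trans_le ham) (by rw [d0]; exact hT)).seq ?_
  rintro s₄ t₄ hx₄ ⟨J, hJ, c17, c12, c0, hfull, ht₄⟩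
  have c1 : s₄.nat 1 0 = 2 ^ m := by rw [hx₄.nat_eq (by decide), d1, hW]
  have c2 : s₄.nat 2 0 = a := by
    rw [hx₄.nat_eq (by decide), hx₃.nat_eq (by decide), keep 2 (by decide)]; exact hs.known
  have c4 : s₄.nat 4 0 = G₂.length := by
    rw [hx₄.nat_eq (by decide), hx₃.nat_eq (by decide), e4]
  have c5 : s₄.nat 5 = s₂.nat 5 := by rw [hx₄.nat_eq (by decide), hx₃.nat_eq (by decide)]
  have c6 : s₄.nat 6 = s₂.nat 6 := by rw [hx₄.nat_eq (by decide), hx₃.nat_eq (by decide)]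
  have c7 : s₄.nat 7 0 = p := by rw [hx₄.nat_eq (by decide), hx₃.nat_eq (by decide), e7]
  have c8 : s₄.nat 8 = s₂.nat 8 := by rw [hx₄.nat_eq (by decide), hx₃.nat_eq (by decide)]
  have c9 : s₄.nat 9 0 = y' := by rw [hx₄.nat_eq (by decide), d9]
  have c10 : s₄.nat 10 = s₃.nat 10 := by rw [hx₄.nat_eq (by decide)]
  have c11 : s₄.nat 11 0 = R' := by rw [hx₄.nat_eq (by decide), d11]
  have c19 : s₄.nat 19 0 = st := by rw [hx₄.nat_eq (by decide), d19]
  have c20 : s₄.nat 20 0 = r := by rw [hx₄.nat_eq (by decide), hx₃.nat_eq (by decide), e20]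
  have c21 : s₄.nat 21 0 = k := by rw [hx₄.nat_eq (by decide), d21]
  have cR : s₄.real 0 = s₃.real 0 := by rw [hx₄.real_eq (by decide)]
  have out₄ : s₄.out = s.out := by
    rw [hx₄.out_eq (by decide), hx₃.out_eq (by decide), out₂]
  have hne : J ≠ [] := by
    rintro rfl
    rcases hfull with hfull | hfull
    · have := I.types.one_le_capAt hkK
      rw [hv.cap] at hfull
      simp at hfull
      omega
    · exact hfull j (by simpa using hjP) hst
  have hJcard : J.toFinset.card = J.length := List.toFinset_card_of_nodup hJ.nodup
  have hJsub : J.toFinset ⊆ P := fun x hx => (hJ.mem x (by simpa using hx)).1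
  have hdlP : ∀ q ∈ P, v.deadline q = I.due q := fun q hq => hdl q (hPa q hq)
  have hinv := hpre.launch (τ := τ) (k := k) hRR hrank (by omega) hJ.nodup hJ.mem hne hkK
    (by simpa [hv.cap] using hJ.length_le) hw hkc (fun x hx q hq hsq => by
      rw [← hdlP x (hJ.mem x hx).1, ← hdlP q (Finset.mem_sdiff.1 hq).1]
      exact hJ.due_le x hx q hq hsq) (fun q hq hsq => by
      have hlen : J.length = I.types.capAt k := by
        rcases hfull with hfull | hfull
        · rw [hfull, hv.cap]
        · exact absurd hsq (hfull q hq)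
      -- Type `p` has room for all `a` arrived jobs, so it cannot be full while `q` is left over.
      rcases hkind with rfl | ⟨h1, h2⟩
      · have h1 := hp hkK
        have h2 : (insert q J.toFinset).card ≤ a := by
          rw [← Finset.card_range a]
          refine Finset.card_le_card fun x hx => ?_
          rcases Finset.mem_insert.1 hx with rfl | hx
          · exact Finset.mem_range.2 (hPa _ (Finset.mem_sdiff.1 hq).1)
          · exact Finset.mem_range.2 (hPa _ (hJsub hx))
        rw [Finset.card_insert_of_notMem (Finset.mem_sdiff.1 hq).2] at h2
        omega
      · exact ⟨h1, h2, hlen⟩)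
  have hJlen : 1 ≤ J.length := List.length_pos_iff.2 hne
  simp only [Cmd.meets_seq, Cmd.meets_launch, Cmd.meets_nstore, NExp.eval]
  simp only [State.nat_setNat_ne, ne_eq, Nat.reduceEqDiff,
    not_false_eq_true, c2, c4, c17, c19, c20, c21, c12, out₄, State.out_setNat, hnow]
  refine ⟨P \ J.toFinset, _, _, _, R', y', J.length, Finset.sdiff_subset, ?_, hJlen, hinv, ?_, hyy,
    ?_⟩
  · rw [Finset.card_sdiff_of_subset hJsub, hJcard]
    have := Finset.card_le_card hJsub
    omega
  · constructor
    · simp [State.nat_setNat_ne, c2]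
    · refine Or.inr ⟨m, by simp [State.nat_setNat_ne, c1], ham, hma, ?_⟩
      have := c0.congr (fun q hq => hdlP q (Finset.mem_sdiff.1 hq).1)
      simpa [State.nat_setNat_ne] using this
    · simp [State.nat_setNat_self]
    · simp [State.nat_setNat_self, State.nat_setNat_ne]
    · refine ⟨?_, ?_, e56.congr fun i hi => ?_⟩
      · simp [State.nat_setNat_self, State.nat_setNat_ne]
      · simp [State.nat_setNat_self, State.nat_setNat_ne]
      · simp [State.nat_setNat_self, State.nat_setNat_ne, hi.ne, c5, c6]
    · simp [State.nat_setNat_ne, c7]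
    · simpa [State.nat_setNat_ne, c8] using e8
    · simp [State.nat_setNat_ne, c9]
    · simp [State.nat_setNat_ne, c11]
    · simpa [State.nat_setNat_ne, State.real_setNat, c10, cR] using drow
  · have h1 : (14 * m + 13) * J.length ≤ (14 * b + 13) * J.length :=
      Nat.mul_le_mul_right _ (by omega)
    -- The initial query of the extraction is charged to the jobs of the batch, of which there is at
    -- least one.
    have h2 : 7 * b * 1 ≤ 7 * b * J.length := Nat.mul_le_mul_left _ hJlen
    have h3 : (21 * b + 60) * J.length = (14 * b + 13) * J.length + 7 * b * J.length
      + 47 * J.length := by ring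
    rw [h3]
    simp only [List.length_cons]
    omega

end Trigger

/-! ### The events of a run. -/

section View

variable {I : Problem} {τ q : ℕ}

theorem Problem.arrived_le (I : Problem) (τ : ℕ) : (I.view τ).arrived ≤ I.n :=
  (Finset.card_le_univ (Finset.univ.filter fun j => I.release j ≤ τ)).trans_eq (Fintype.card_fin _)

/-- Jobs are numbered by release time, so the arrived jobs form an initial segment and their count
determines them. -/
theorem Problem.lt_arrived_iff (hq : q < I.n) : q < (I.view τ).arrived ↔ I.rel q ≤ τ := by
  simp only [Problem.view, Problem.rel, hq, dif_pos]
  constructor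
  · intro h
    by_contra hlt
    refine absurd h (not_lt.2 ?_)
    refine (Finset.card_le_card fun j hj => ?_).trans_eq (Fin.card_Iio (⟨q, hq⟩ : Fin I.n))
    rw [Finset.mem_Iio]
    by_contra hge
    exact hlt ((I.release_mono (not_lt.1 hge)).trans (Finset.mem_filter.1 hj).2)
  · intro h
    refine (Fin.card_Iic (⟨q, hq⟩ : Fin I.n)).symm.trans_le (Finset.card_le_card fun j hj => ?_)
    exact Finset.mem_filter.2
      ⟨Finset.mem_univ _, (I.release_mono (Finset.mem_Iic.1 hj)).trans h⟩

theorem Problem.view_deadline (hq : q < (I.view τ).arrived) :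
    (I.view τ).deadline q = I.due q := by
  have hn := hq.trans_le (I.arrived_le τ)
  have h := (Problem.lt_arrived_iff hn).1 hq
  simp only [Problem.rel, hn, dif_pos] at h
  simp [Problem.view, Problem.due, hn, h]

theorem Problem.rel_le_due (hq : q < I.n) : I.rel q ≤ I.due q := by
  simpa [Problem.rel, Problem.due, hq] using I.release_le_deadline ⟨q, hq⟩

theorem Problem.view_shows (I : Problem) (τ : ℕ) : (I.view τ).Shows I.types := ⟨rfl, rfl, rfl⟩

end View

namespace Prog

open NExp Cmd

/-- The pending job that is due first, increased by one, or `0`. -/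
abbrev root : NExp := load 0 (sub (var 1) (const 1))

/-- The online algorithm. -/
def event : Cmd :=
  .seq (rset 0 (.cost (const 0))) <| .seq arrive <| .seq scan <|
  .seq (.loop (.and (.nle (const 1) root) (.nle (deadline (sub root (const 1))) now)) trigger) <|
  .ite (.nle (const 1) root) (setAlarm (deadline (sub root (const 1)))) (setAlarm now)

end Prog

section Event

variable {I : Problem} {s : State} {R a f p y b : ℕ} {P : Finset ℕ} {O : List Batch}
  {G : List Cohort} {W : List Witness} {F : List ℕ} {τ τ₀ : ℕ}

theorem union_Ico_succ (hle : a ≤ b) :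
    P ∪ Finset.Ico a (b + 1) = insert b (P ∪ Finset.Ico a b) := by
  rw [← Finset.insert_Ico_right_eq_Ico_add_one hle, Finset.union_insert]

theorem Invariant.arrive_until (h : Invariant I R a P O G W F f) {a' : ℕ} (ha : a ≤ a')
    (hn : a' ≤ I.n) : Invariant I R a' (P ∪ Finset.Ico a a') O G W F f := by
  induction a', ha using Nat.le_induction with
  | base => simpa using h
  | succ a' hle ih =>
    rw [union_Ico_succ hle]
    exact (ih (by omega)).arrive hn

theorem Prog.event_meets (h : Invariant I R a P s.out G W F f)
    (hs : Synced I a P G f R p y (s.setReal 0 0 (I.types.costAt 0)))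
    (ha : a ≤ (I.view τ).arrived) (hb : (I.view τ).arrived ≤ 2 ^ b)
    (hw : ∀ q ∈ P ∪ Finset.Ico a (I.view τ).arrived, I.rel q ≤ τ ∧ τ ≤ I.due q) :
    event.Meets (I.view τ) s fun s' t => ∃ (P' : Finset ℕ) (G' : List Cohort) (W' : List Witness)
      (F' : List ℕ) (f' R' p' y' c : ℕ), P' ⊆ P ∪ Finset.Ico a (I.view τ).arrived ∧
      P'.card + c = P.card + ((I.view τ).arrived - a) ∧
      Invariant I R' (I.view τ).arrived P' s'.out G' W' F' f' ∧
      Synced I (I.view τ).arrived P' G' f' R' p' y' (s'.setReal 0 0 (I.types.costAt 0)) ∧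
      (∀ q ∈ P', τ < I.due q) ∧
      ((P' = ∅ ∧ s'.alarm = τ) ∨ ∃ q ∈ P', I.due q = s'.alarm ∧ ∀ q' ∈ P', I.due q ≤ I.due q') ∧
      p ≤ p' ∧ y ≤ y' ∧
      t + 2 * G'.length + 2 * y ≤ (7 * b + 17) * ((I.view τ).arrived - a) +
        (10 * b + 14) * (p' - p) + (21 * b + 61) * c + 2 * G.length + 2 * y' + 6 := by
  have hdl : ∀ q < (I.view τ).arrived, (I.view τ).deadline q = I.due q :=
    fun q hq => Problem.view_deadline hq
  have hv := I.view_shows τ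
  have hnow : (I.view τ).now = τ := rfl
  have hnew : ∀ q < I.n, (I.view τ).arrived ≤ q → τ < I.rel q := fun q hq hle => by
    by_contra hlt
    exact absurd ((Problem.lt_arrived_iff hq).2 (not_lt.1 hlt)) (not_lt.2 hle)
  have hinv := h.arrive_until ha (I.arrived_le τ)
  have hPa : ∀ q ∈ P, q < a := fun q hq => h.ledger.lt_of_mem hq
  generalize I.view τ = v at *
  obtain ⟨hknown, htree, hfresh, hsize, hstack, htypes, hscan, hdear, hranks, hrows⟩ := hs
  unfold event
  simp only [Cmd.meets_seq (p := Cmd.rset _ _), Cmd.meets_rstore, NExp.eval, RExp.eval, hv.cost]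
  refine (Prog.arrive_meets (P := P) hknown ha hb hPa
    (htree.congr fun q hq => (hdl q ((hPa q hq).trans_le ha)).symm)).seq ?_
  rintro s₁ t₁ hx₁ ⟨g2, hT₁, ht₁⟩
  have g7 : s₁.nat 7 0 = p := by rw [hx₁.nat_eq (by decide), htypes]
  have g8 : Scanned I.types a p (s₁.nat 8) := by rw [hx₁.nat_eq (by decide)]; exact hscan
  refine (Prog.scan_meets hv g7 g8 ha hb).seq ?_
  rintro s₂ t₂ hx₂ ⟨p', e7, hpp, hs₂, hcap, ht₂⟩
  have hsync : Synced I v.arrived (P ∪ Finset.Ico a v.arrived) G f R p' y s₂ := by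
    refine ⟨?_, ?_, ?_, ?_, ?_, e7, hs₂, ?_, ?_, ?_⟩
    · rw [hx₂.nat_eq (by decide), g2]
    · have h0 := hT₁.congr fun q hq => hdl q (hinv.ledger.lt_of_mem hq)
      rwa [TreeVars, ← hx₂.nat_eq (a := 0) (by decide), ← hx₂.nat_eq (a := 1) (by decide)] at h0
    · rw [hx₂.nat_eq (by decide), hx₁.nat_eq (by decide), hfresh]
    · rw [hx₂.nat_eq (by decide), hx₁.nat_eq (by decide), hsize]
    · rw [hx₂.nat_eq (by decide), hx₁.nat_eq (by decide), hx₂.nat_eq (by decide),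
        hx₁.nat_eq (by decide)]
      exact hstack
    · rw [hx₂.nat_eq (by decide), hx₁.nat_eq (by decide), hdear]
    · rw [hx₂.nat_eq (by decide), hx₁.nat_eq (by decide), hranks]
    · rw [hx₂.nat_eq (by decide), hx₁.nat_eq (by decide), hx₂.real_eq (by decide),
        hx₁.real_eq (by decide)]
      refine ⟨hrows.kind_eq, hrows.budget_eq, ?_, hrows.cost_le⟩
      rcases hrows.le with h | h <;> omega
  have out₂ : s₂.out = s.out := by
    rw [hx₂.out_eq (by decide), hx₁.out_eq (by decide), State.out_setReal]
  have hcard : (P ∪ Finset.Ico a v.arrived).card = P.card + (v.arrived - a) := by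
    rw [Finset.card_union_of_disjoint, Nat.card_Ico]
    refine Finset.disjoint_left.2 fun q hq hq' => ?_
    have := hPa q hq
    have := (Finset.mem_Ico.1 hq').1
    omega
  refine Cmd.Meets.seq (Cmd.Meets.loop (fun s φ => ∃ (P' : Finset ℕ) (G' : List Cohort)
    (W' : List Witness) (F' : List ℕ) (f' R' y' : ℕ), P' ⊆ P ∪ Finset.Ico a v.arrived ∧
      Invariant I R' v.arrived P' s.out G' W' F' f' ∧ Synced I v.arrived P' G' f' R' p' y' s ∧
      y ≤ y' ∧ φ = (21 * b + 61) * P'.card + 2 * G'.length + 2 * (p' - y')) ?_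
      ⟨_, G, W, F, f, R, y, subset_rfl, by rw [out₂]; exact hinv, hsync, le_rfl, rfl⟩) ?_
  · rintro s φ ⟨P', G', W', F', f', R', y', hsub, hinv', hsync', hyy, rfl⟩ hc
    simp only [BExp.eval, NExp.eval, hnow] at hc
    refine (Prog.trigger_meets (b := b) hv hnow hdl hnew (fun q hq => hw q (hsub hq)) hb hinv'
      hsync' hcap (by omega) hc.2).imp ?_
    rintro s' t - ⟨P'', G'', W'', F'', R'', y'', c, hsub', hc', hc1, hinv'', hsync'', hyy', ht⟩
    refine ⟨_, ⟨P'', G'', W'', F'', _, R'', y'', hsub'.trans hsub, hinv'', hsync'', hyy.trans hyy',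
      rfl⟩, ?_⟩
    have : y'' ≤ p' := by rcases hsync''.rows.le with h | h <;> omega
    rw [← hc']
    have h1 : (21 * b + 61) * (P''.card + c) =
      (21 * b + 61) * P''.card + (21 * b + 60) * c + c := by ring
    omega
  · rintro s₃ t₃ - ⟨φ, ⟨P', G', W', F', f', R', y', hsub, hinv', hsync', hyy, rfl⟩, hc, ht₃⟩
    have hPa' : ∀ q ∈ P', q < v.arrived := fun q hq => hinv'.ledger.lt_of_mem hq
    have hroot := hsync'.tree.root hPa'
    -- The program stores `budget 0` at the start of every event. This matters only for the first
    -- event, whose memory is zero; from then on the store changes nothing.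
    have hreset : s₃.setReal 0 0 (I.types.costAt 0) = s₃ := by
      have h0 : s₃.real 0 0 = I.types.costAt 0 := hsync'.rows.budget_eq 0 (Nat.zero_le _)
      cases s₃
      simp only [State.setReal, State.mk.injEq, true_and, and_true]
      funext i k
      split_ifs with hik
      · rw [hik.1, hik.2]; exact h0.symm
      · rfl
    obtain ⟨c, hcc⟩ := Nat.exists_eq_add_of_le (Finset.card_le_card hsub)
    have hyp : y' ≤ p' := by rcases hsync'.rows.le with h | h <;> omega
    have hmain : t₃ + 2 * G'.length + 2 * y ≤ (21 * b + 61) * c + 2 * G.length + 2 * y' + 1 := by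
      rw [hcc, Nat.mul_add] at ht₃
      omega
    simp only [BExp.eval, NExp.eval, hnow, not_and, not_le] at hc
    simp only [Cmd.meets_ite, Cmd.meets_setAlarm, BExp.eval, NExp.eval, hnow]
    refine ⟨fun h1 => ⟨P', G', W', F', f', R', p', y', c, hsub, by omega, hinv', ?_, ?_, Or.inr ?_,
      hpp, hyy, by omega⟩, fun h1 => ⟨P', G', W', F', f', R', p', y', c, hsub, by omega, hinv', ?_,
      ?_, Or.inl ⟨?_, trivial⟩, hpp, hyy, by omega⟩⟩
    · rw [← hreset] at hsync'
      exact ⟨hsync'.known, hsync'.tree, hsync'.fresh, hsync'.size, hsync'.stack, hsync'.types,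
        hsync'.scanned, hsync'.dearest, hsync'.ranks, hsync'.rows⟩
    · have hlt := hc h1
      rcases hroot with ⟨h0, -⟩ | ⟨q, hq, h0, -, -, hm⟩
      · omega
      · rw [h0, Nat.add_sub_cancel, hdl q (hPa' q hq)] at hlt
        exact fun q' hq' => hlt.trans_le (hm q' hq' (Nat.zero_le _) (hPa' q' hq'))
    · rcases hroot with ⟨h0, -⟩ | ⟨q, hq, h0, -, -, hm⟩
      · omega
      · refine ⟨q, hq, ?_, fun q' hq' => hm q' hq' (Nat.zero_le _) (hPa' q' hq')⟩
        rw [h0, Nat.add_sub_cancel, hdl q (hPa' q hq)]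
    · rw [← hreset] at hsync'
      exact ⟨hsync'.known, hsync'.tree, hsync'.fresh, hsync'.size, hsync'.stack, hsync'.types,
        hsync'.scanned, hsync'.dearest, hsync'.ranks, hsync'.rows⟩
    · rcases hroot with ⟨h0, h⟩ | ⟨q, hq, h0, -, -, hm⟩
      · exact fun q hq => absurd (hPa' q hq) (h q hq (Nat.zero_le _))
      · omega
    · rcases hroot with ⟨h0, h⟩ | ⟨q, hq, h0, -, -, hm⟩
      · exact Finset.eq_empty_of_forall_notMem fun q hq => h q hq (Nat.zero_le _) (hPa' q hq)
      · omega

/-- The situation before the events from time `τ₀` on. -/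
structure Waiting (I : Problem) (τ₀ a : ℕ) (P : Finset ℕ) (G : List Cohort) (W : List Witness)
    (F : List ℕ) (f R p y : ℕ) (s : State) : Prop where
  invariant : Invariant I R a P s.out G W F f
  synced : Synced I a P G f R p y (s.setReal 0 0 (I.types.costAt 0))
  seen : ∀ q < I.n, q < a ↔ I.rel q < τ₀
  due_ge : ∀ q ∈ P, τ₀ ≤ I.due q
  alarm : τ₀ = 0 ∨ (P = ∅ ∧ s.alarm < τ₀) ∨
    ∃ q ∈ P, I.due q = s.alarm ∧ ∀ q' ∈ P, I.due q ≤ I.due q'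

theorem Waiting.start (I : Problem) : Waiting I 0 0 ∅ [] [] [] 0 0 0 0 State.start where
  invariant := by
    refine ⟨⟨Nat.zero_le _, ?_, ?_, ?_, ?_, ?_, ?_, ?_, ?_, ?_, ?_, ?_, ?_, ?_, ?_⟩, rfl, le_rfl,
      ?_, ?_, ?_⟩ <;> simp [State.start, Problem.cost, credit]
  synced := by
    refine ⟨rfl, Or.inl ⟨rfl, rfl, fun _ => rfl⟩, rfl, rfl, trivial, rfl, ⟨Nat.zero_le _, by simp⟩,
      rfl, rfl, ⟨by simp, ?_, Or.inr rfl, le_rfl⟩⟩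
    intro r hr
    obtain rfl : r = 0 := by omega
    simp [State.real_setReal_self, MachineTypes.budget]
  seen := by simp
  due_ge := by simp
  alarm := Or.inl rfl

theorem Waiting.eq_empty_or (h : Waiting I τ₀ a P G W F f R p y s) :
    P = ∅ ∨ τ₀ ≤ s.alarm ∧ ∀ q ∈ P, s.alarm ≤ I.due q := by
  rcases h.alarm with rfl | ⟨h, -⟩ | ⟨q, hq, h1, h2⟩
  · refine Or.inl (Finset.eq_empty_of_forall_notMem fun q hq => ?_)
    have h1 := h.invariant.ledger.lt_of_mem hq
    exact absurd ((h.seen q (h1.trans_le h.invariant.ledger.arrived_le)).1 h1) (by omega)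
  · exact Or.inl h
  · exact Or.inr ⟨h1 ▸ h.due_ge q hq, fun q' hq' => h1 ▸ h2 q' hq'⟩

theorem Problem.isEvent_rel {q : ℕ} (hq : q < I.n) : I.IsEvent s (I.rel q) :=
  Or.inl ⟨⟨q, hq⟩, by simp [Problem.rel, hq]⟩

/-- A job still to arrive carries the costs of its insertion and its execution, a pending job those
of its execution. Each of the two also carries seven steps for the overhead of an event; the extra
`7` at time `0` pays for an event that may neither receive nor execute a job, as the alarm is
initially `0`. -/
theorem Waiting.run (hb : I.n ≤ 2 ^ b) (h : Waiting I τ₀ a P G W F f R p y s) :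
    ∃ s' t R' G' W' F' f', Run Prog.event I τ₀ s s' t ∧ Invariant I R' I.n ∅ s'.out G' W' F' f' ∧
      t ≤ (28 * b + 92) * (I.n - a) + (21 * b + 68) * P.card + 2 * G.length +
        (10 * b + 14) * (I.n - p) + 2 * (I.n - y) + if τ₀ = 0 then 7 else 0 := by
  -- An arrival lowers this measure by one, since the job becomes pending, and its execution lowers
  -- it by one more.
  obtain ⟨μ, hμ⟩ : ∃ μ, 2 * (I.n - a) + P.card + (if τ₀ = 0 then 1 else 0) = μ := ⟨_, rfl⟩
  induction μ using Nat.strong_induction_on generalizing τ₀ a P G W F f R p y s with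
  | _ μ ih =>
  have han := h.invariant.ledger.arrived_le
  by_cases hev : ∃ τ, τ₀ ≤ τ ∧ I.IsEvent s τ
  · classical
    obtain ⟨τ, ⟨hle, he⟩, hmin⟩ : ∃ τ, (τ₀ ≤ τ ∧ I.IsEvent s τ) ∧
        ∀ σ, τ₀ ≤ σ → σ < τ → ¬ I.IsEvent s σ :=
      ⟨Nat.find hev, Nat.find_spec hev, fun σ h1 h2 h3 => Nat.find_min hev h2 ⟨h1, h3⟩⟩
    have hlate : ∀ q < I.n, a ≤ q → τ ≤ I.rel q := fun q hq haq => by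
      by_contra hlt
      refine hmin _ ?_ (not_le.1 hlt) (Problem.isEvent_rel hq)
      by_contra hlt'
      exact absurd ((h.seen q hq).2 (not_le.1 hlt')) (not_lt.2 haq)
    have haa : a ≤ (I.view τ).arrived := by
      by_contra hlt
      push Not at hlt
      have hn := hlt.trans_le han
      have := (Problem.lt_arrived_iff hn).2 (((h.seen _ hn).1 hlt).le.trans hle)
      omega
    have hn := I.arrived_le τ
    obtain ⟨s₁, t₁, hx, P', G', W', F', f', R', p', y', c, hsub, hcard, hinv, hsync, hdue, halarm,
      hpp, hyy, ht⟩ := Prog.event_meets (τ := τ) (b := b) h.invariant h.synced haa (hn.trans hb) (by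
        intro q hq
        rcases Finset.mem_union.1 hq with hq | hq
        · have hqa := h.invariant.ledger.lt_of_mem hq
          refine ⟨((h.seen q (hqa.trans_le han)).1 hqa).le.trans hle, ?_⟩
          -- The alarm is an event, so the next event comes no later than the earliest pending
          -- deadline and no job is missed.
          rcases h.eq_empty_or with h0 | ⟨h1, h2⟩
          · simp [h0] at hq
          · refine le_trans ?_ (h2 q hq)
            by_contra hlt
            exact hmin _ h1 (not_le.1 hlt) (Or.inr rfl)
        · obtain ⟨h1, h2⟩ := Finset.mem_Ico.1 hq
          have hqn := h2.trans_le hn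
          exact ⟨(Problem.lt_arrived_iff hqn).1 h2,
            (hlate q hqn h1).trans (Problem.rel_le_due hqn)⟩)
    have hwait : Waiting I (τ + 1) (I.view τ).arrived P' G' W' F' f' R' p' y' s₁ := by
      refine ⟨hinv, hsync, fun q hq => ?_, hdue, Or.inr ?_⟩
      · rw [Problem.lt_arrived_iff hq, Nat.lt_succ_iff]
      · rcases halarm with ⟨h1, h2⟩ | h1
        · exact Or.inl ⟨h1, by omega⟩
        · exact Or.inr h1
    -- An event after time `0` is an arrival or the deadline of a pending job, and that job gets
    -- executed.
    have hprog : 1 ≤ ((I.view τ).arrived - a) + c + if τ₀ = 0 then 1 else 0 := by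
      rcases he with ⟨j, hj⟩ | he
      · have hrel : I.rel j = τ := by simpa [Problem.rel] using hj
        have h1 := (Problem.lt_arrived_iff j.2).2 hrel.le
        have h2 : ¬ (j : ℕ) < a := fun hlt => by
          have := (h.seen j j.2).1 hlt
          omega
        omega
      · rcases h.alarm with h0 | ⟨-, h0⟩ | ⟨q, hq, h1, -⟩
        · simp [h0]
        · omega
        · have hqP : q ∉ P' := fun hq' => by have := hdue q hq'; omega
          have hlt := Finset.card_lt_card (Finset.ssubset_iff_subset_ne.2
            ⟨hsub, fun heq => hqP (heq ▸ Finset.mem_union_left _ hq)⟩)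
          have hle := Finset.card_union_le P (Finset.Ico a (I.view τ).arrived)
          rw [Nat.card_Ico] at hle
          omega
    obtain ⟨s₂, t₂, R₂, G₂, W₂, F₂, f₂, hrun, hinv₂, ht₂⟩ := ih _ (by
      rw [if_neg (Nat.succ_ne_zero τ)]; omega) hwait rfl
    refine ⟨s₂, _, R₂, G₂, W₂, F₂, f₂, .event hle he hmin hx hrun, hinv₂, ?_⟩
    rw [if_neg (Nat.succ_ne_zero τ)] at ht₂
    have hpn : p' ≤ I.n := hsync.scanned.le.trans hn
    have hyp : y' ≤ p' := by rcases hsync.rows.le with h | h <;> omega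
    obtain ⟨d, hd⟩ : ∃ d, (I.view τ).arrived - a = d := ⟨_, rfl⟩
    obtain ⟨N, hN⟩ : ∃ N, I.n - (I.view τ).arrived = N := ⟨_, rfl⟩
    obtain ⟨d', hd'⟩ : ∃ d', p' - p = d' := ⟨_, rfl⟩
    obtain ⟨N', hN'⟩ : ∃ N', I.n - p' = N' := ⟨_, rfl⟩
    have e1 : I.n - a = N + d := by rw [← hN, ← hd, Nat.sub_add_sub_cancel hn haa]
    have e2 : I.n - p = N' + d' := by rw [← hN', ← hd', Nat.sub_add_sub_cancel hpn hpp]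
    have e3 : P.card + d = P'.card + c := by rw [← hd, hcard]
    have e4 : I.n - y' + y' = I.n - y + y := by
      rw [Nat.sub_add_cancel (hyp.trans hpn), Nat.sub_add_cancel (hyy.trans (hyp.trans hpn))]
    have hind : 7 ≤ 7 * d + 7 * c + if τ₀ = 0 then 7 else 0 := by
      rw [hd] at hprog
      split_ifs at hprog ⊢ <;> omega
    have e5 : (21 * b + 68) * P.card + (21 * b + 68) * d =
        (21 * b + 68) * P'.card + (21 * b + 68) * c := by
      rw [← Nat.mul_add, ← Nat.mul_add, e3]
    rw [hd, hd'] at ht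
    rw [hN, hN'] at ht₂
    rw [e1, e2]
    linarith
  · push Not at hev
    have hP : P = ∅ := by
      rcases h.eq_empty_or with h0 | ⟨h1, -⟩
      · exact h0
      · exact absurd (Or.inr rfl) (hev _ h1)
    have hna : a = I.n := by
      by_contra hne
      have hlt : a < I.n := by omega
      refine hev _ ?_ (Problem.isEvent_rel hlt)
      by_contra hlt'
      exact absurd ((h.seen a hlt).2 (not_le.1 hlt')) (lt_irrefl a)
    subst hP hna
    exact ⟨s, 0, R, G, W, F, f, .done hev, h.invariant, Nat.zero_le _⟩

end Event

/-! ### The bound `O(n log n)` and the theorem. -/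

theorem linear_log_bound (n : ℕ) :
    ((((38 * (Nat.log 2 n + 1) + 108) * n + 7 : ℕ) : ℝ)) ≤ 300 * (n * Real.log n + 1) := by
  rcases Nat.lt_or_ge n 2 with hn | hn
  -- The summand `1` on the right is needed here, because `n * log n` vanishes.
  · interval_cases n <;> norm_num
  · have h2 : (0.69 : ℝ) ≤ Real.log 2 := by linarith [Real.log_two_gt_d9]
    have hpow : ((2 ^ Nat.log 2 n : ℕ) : ℝ) ≤ n := by
      exact_mod_cast Nat.pow_log_le_self 2 (by omega)
    have hlog : (Nat.log 2 n : ℝ) * Real.log 2 ≤ Real.log n := by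
      rw [← Real.log_pow]
      exact Real.log_le_log (by positivity) (by exact_mod_cast hpow)
    have h1 : (1 : ℝ) ≤ Nat.log 2 n := by
      exact_mod_cast Nat.log_pos (by norm_num) hn
    have h3 : (Nat.log 2 n : ℝ) * 0.69 ≤ Real.log n :=
      (mul_le_mul_of_nonneg_left h2 (by linarith)).trans hlog
    have hn0 : (0 : ℝ) ≤ n := Nat.cast_nonneg n
    push_cast
    have h4 : (38 * ((Nat.log 2 n : ℝ) + 1) + 108) ≤ 300 * Real.log n := by linarith
    have := mul_le_mul_of_nonneg_right h4 hn0
    linarith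

/-- There is a deterministic online algorithm that, on every instance, produces a valid schedule
of cost at most `8` times the optimal offline cost, in `O(n log n)` steps in total. -/
theorem theorem1 :
    ∃ (A : Cmd) (C : ℝ), ∀ I : Problem, ∃ (S : List Batch) (t : ℕ),
      Produces A I S t ∧
      I.IsSchedule S ∧
      I.cost S ≤ 8 * I.opt ∧
      (t : ℝ) ≤ C * (I.n * Real.log I.n + 1) := by
  refine ⟨Prog.event, 300, fun I => ?_⟩
  obtain ⟨s, t, R, G, W, F, f, hrun, hinv, ht⟩ :=
    (Waiting.start I).run (b := Nat.log 2 I.n + 1) (Nat.lt_pow_succ_log_self (by norm_num) _).le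
  have hS := hinv.ledger.isSchedule
  refine ⟨s.out, t, ⟨s, hrun, rfl⟩, hS, ?_, ?_⟩
  -- The cost is at most `7` times that of any schedule `S'`, whose cost is nonnegative. The
  -- schedule just produced shows that `opt` is not the infimum of the empty set.
  · have h0 : I.cost s.out / 8 ≤ I.opt := Problem.le_opt hS fun S' hS' => by
      have h7 := hinv.ledger.cost_le hinv.cohorts.credit_nonneg hinv.cost_le hS'
      have h1 := I.cost_nonneg S'
      linarith
    linarith
  · refine le_trans (Nat.cast_le.2 (ht.trans ?_)) (linear_log_bound I.n)
    simp only [Finset.card_empty, List.length_nil, Nat.sub_zero, if_true]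
    exact le_of_eq (by ring)
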